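/- Let $p$ be a prime and let $H$ be a torsion-free nilpotent group without nontrivial elements of infinite $p$-height (an element has infinite $p$-height if it is a $p^m$-th power for every $m\ge 0$). Let $$H=U_1\supsetneq U_2\supsetneq\cdots\supsetneq U_{k}=1$$ be a properly descending central series all of whose factors $U_i/U_{i+1}$ are torsion-free and have no nontrivial elements of infinite $p$-height. For $1\le i\le k-1$ let $E_i\subseteq U_i$ be a system of elements which is a basis of the $\mathbb F_p$-vector space $U_i/U_i^pU_{i+1}$, and let $E=\bigcup_i E_i$, $E-1=\{e-1\mid e\in E\}$. Let $R$ be an associative ring with $1$ (not necessarily commutative) and $\pi\in R$ a central regular element such that $\bigcap_{m\ge 1}(\pi)^m=0$ and $K=R/(\pi)$ is a field of characteristic $p$. Let $\varepsilon\colon RH\to K$ be the homomorphism which is the natural map on $R$ and sends every $h\in H$ to $1$; let $I=\ker\varepsilon$. A pseudovaluation of a ring $A$ is a function $v\colon A\to\mathbb Z\cup\{\infty\}$ with $v(x)=\infty$ iff $x=0$, $v(x+y)\ge\min\{v(x),v(y)\}$, $v(-x)=v(x)$, $v(xy)\ge v(x)+v(y)$ and $v(1)\ge 0$. Its graded ring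 is $\mathrm{gr}_v(A)=\bigoplus_{j\in\mathbb Z}A_j/A_{j+1}$ with $A_j=\{x\mid v(x)\ge j\}$, and the homogeneous component $\tilde x$ of $x\neq 0$ is the class of $x$ in degree $v(x)$. Let $f$ be a function on the system $\langle\pi,E-1\rangle$ whose values are positive integers and such that $$f(\pi)>2f(e-1)\quad(e\in E_{k-1}),\qquad f(e_1-1)>2f(e_2-1)\quad(e_1\in E_{i+1},\ e_2\in E_i,\ 1\le i\le k-2).$$ Then there is a unique pseudovaluation $v$ of $RH$ such that $v(\pi)=f(\pi)$, $v(e-1)=f(e-1)$ for all $e\in E$, and $\mathrm{gr}_v(RH)$ is the polynomial ring $$K[\tilde\pi,\widetilde{(E-1)}]$$ in the homogeneous components $\tilde\pi$, $\widetilde{e-1}$ $(e\in E)$ as independent commuting variables over $K$, where $K$ is identified with the component of degree zero through $\varepsilon$ (that is, $v\ge 0$ on $RH$ and the class of each $x\in RH$ in degree zero is the constant $\varepsilon(x)$). The topology of $RH$ defined by $v$ is the one defined by the powers of $I$. Moreover, let $\bar\phi\colon RH\to KH$ be the map induced by $R\to R/(\pi)=K$. The images $\bar\phi(\{x\mid v(x)\ge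 j\})$, $j\in\mathbb Z$, form the filtration of a pseudovaluation $\bar v$ of $KH$ with $\bar v(e-1)=f(e-1)$ for $e\in E$, whose graded ring is the polynomial ring $K[\widetilde{(E-1)}]$ (in the same sense), and $\bar\phi$ induces an epimorphism of graded rings $\tilde\phi\colon K[\tilde\pi,\widetilde{(E-1)}]\to K[\widetilde{(E-1)}]$, which is the $K$-algebra homomorphism with $\tilde\pi\mapsto 0$ and $\widetilde{e-1}\mapsto\widetilde{e-1}$. -/

import Mathlib

open scoped DirectSum

/-- A discrete pseudovaluation of a ring `A` with values in `ℤ ∪ {∞}`, taking the value `∞` only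
at `0`.  The conditions `v (-x) = v x` and `0 ≤ v 1` say that the sets `{x | j ≤ v x}` form a ring
filtration by additive subgroups, so that there is an associated graded ring. -/
structure PseudoValuation (A : Type*) [Ring A] where
  toFun : A → WithTop ℤ
  eq_top_iff' : ∀ x, toFun x = ⊤ ↔ x = 0
  min_le_add' : ∀ x y, min (toFun x) (toFun y) ≤ toFun (x + y)
  neg' : ∀ x, toFun (-x) = toFun x
  add_le_mul' : ∀ x y, toFun x + toFun y ≤ toFun (x * y)
  one_nonneg' : 0 ≤ toFun 1

namespace PseudoValuation

instance {A : Type*} [Ring A] : CoeFun (PseudoValuation A) (fun _ => A → WithTop ℤ) :=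
  ⟨PseudoValuation.toFun⟩

section

variable {A : Type*} [Ring A] (v : PseudoValuation A)

/-- The `j`-th term `{x | j ≤ v x}` of the filtration of `A` defined by `v`. -/
def filt (j : ℤ) : AddSubgroup A where
  carrier := {x | (j : WithTop ℤ) ≤ v x}
  zero_mem' := by
    have h : v 0 = ⊤ := (v.eq_top_iff' 0).2 rfl
    simp [h]
  add_mem' := fun {x y} hx hy => le_trans (le_min hx hy) (v.min_le_add' x y)
  neg_mem' := fun {x} hx => by
    have h := v.neg' x
    simpa [h] using hx

theorem mem_filt {j : ℤ} {x : A} : x ∈ v.filt j ↔ (j : WithTop ℤ) ≤ v x := Iff.rfl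

theorem filt_succ_le (j : ℤ) : v.filt (j + 1) ≤ v.filt j := fun x hx => by
  rw [mem_filt] at *
  exact le_trans (by exact_mod_cast (by omega : j ≤ j + 1)) hx

theorem mul_mem_filt {i j : ℤ} {x y : A} (hx : x ∈ v.filt i) (hy : y ∈ v.filt j) :
    x * y ∈ v.filt (i + j) := by
  rw [mem_filt] at *
  refine le_trans ?_ (v.add_le_mul' x y)
  rw [WithTop.coe_add]
  exact add_le_add hx hy

theorem one_mem_filt : (1 : A) ∈ v.filt 0 := by
  rw [mem_filt]; exact v.one_nonneg'

/-- The homogeneous component `{x | j ≤ v x} / {x | j + 1 ≤ v x}` of degree `j`. -/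
abbrev piece (j : ℤ) : Type _ := v.filt j ⧸ (v.filt (j + 1)).addSubgroupOf (v.filt j)

/-- The class of `x` in the component of degree `j`. -/
def pieceMk (j : ℤ) (x : A) (hx : x ∈ v.filt j) : v.piece j :=
  QuotientAddGroup.mk ⟨x, hx⟩

theorem pieceMk_eq_iff {j : ℤ} {x y : A} {hx : x ∈ v.filt j} {hy : y ∈ v.filt j} :
    v.pieceMk j x hx = v.pieceMk j y hy ↔ -x + y ∈ v.filt (j + 1) := by
  unfold pieceMk
  rw [QuotientAddGroup.eq]
  rfl

theorem piece_ind {j : ℤ} {P : v.piece j → Prop}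
    (h : ∀ x hx, P (v.pieceMk j x hx)) (a : v.piece j) : P a :=
  QuotientAddGroup.induction_on a (fun x => h x.1 x.2)

/-- Multiplication of homogeneous components, induced by the multiplication of `A`. -/
def pieceMul {i j : ℤ} (a : v.piece i) (b : v.piece j) : v.piece (i + j) :=
  Quotient.liftOn₂' a b
    (fun x y => v.pieceMk (i + j) (x.1 * y.1) (v.mul_mem_filt x.2 y.2)) (by
      intro x y x' y' hx hy
      rw [QuotientAddGroup.leftRel_apply] at hx hy
      have hx' : -(x : A) + x' ∈ v.filt (i + 1) := hx
      have hy' : -(y : A) + y' ∈ v.filt (j + 1) := hy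
      rw [pieceMk_eq_iff]
      have h1 := v.mul_mem_filt hx' y'.2
      have h2 := v.mul_mem_filt x.2 hy'
      have e1 : i + 1 + j = i + j + 1 := by ring
      have e2 : i + (j + 1) = i + j + 1 := by ring
      rw [e1] at h1
      rw [e2] at h2
      have h3 := add_mem h1 h2
      have e3 : -((x : A) * y) + x' * y' = (-x + x') * y' + x * (-y + y') := by noncomm_ring
      rw [e3]
      exact h3)

theorem pieceMul_mk {i j : ℤ} {x y : A} (hx : x ∈ v.filt i) (hy : y ∈ v.filt j) :
    v.pieceMul (v.pieceMk i x hx) (v.pieceMk j y hy) =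
      v.pieceMk (i + j) (x * y) (v.mul_mem_filt hx hy) := rfl

theorem pieceMk_add {j : ℤ} {x y : A} (hx : x ∈ v.filt j) (hy : y ∈ v.filt j) :
    v.pieceMk j x hx + v.pieceMk j y hy = v.pieceMk j (x + y) (add_mem hx hy) := rfl

theorem pieceMk_zero {j : ℤ} : v.pieceMk j 0 (zero_mem _) = 0 := rfl

theorem pieceMk_congr {j : ℤ} {x y : A} (h : x = y) (hx : x ∈ v.filt j) (hy : y ∈ v.filt j) :
    v.pieceMk j x hx = v.pieceMk j y hy := by subst h; rfl

theorem gradedMk_congr {i j : ℤ} {x y : A} (hij : i = j) (hxy : x = y)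
    (hx : x ∈ v.filt i) (hy : y ∈ v.filt j) :
    (GradedMonoid.mk i (v.pieceMk i x hx) : GradedMonoid v.piece) =
      GradedMonoid.mk j (v.pieceMk j y hy) := by subst hij; subst hxy; rfl

theorem natCast_mem_filt (n : ℕ) : (n : A) ∈ v.filt 0 := by
  induction n with
  | zero => simp
  | succ n ih => rw [Nat.cast_succ]; exact add_mem ih v.one_mem_filt

theorem intCast_mem_filt (n : ℤ) : (n : A) ∈ v.filt 0 := by
  cases n with
  | ofNat n => simpa using v.natCast_mem_filt n
  | negSucc n =>
    rw [Int.cast_negSucc]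
    exact neg_mem (v.natCast_mem_filt (n + 1))

instance instGOne : GradedMonoid.GOne v.piece where
  one := v.pieceMk 0 1 v.one_mem_filt

instance instGMul : GradedMonoid.GMul v.piece where
  mul := v.pieceMul

instance instGMonoid : GradedMonoid.GMonoid v.piece where
  one_mul := fun ⟨i, a⟩ => by
    induction a using piece_ind with
    | h x hx => exact v.gradedMk_congr (zero_add i) (one_mul x) _ _
  mul_one := fun ⟨i, a⟩ => by
    induction a using piece_ind with
    | h x hx => exact v.gradedMk_congr (add_zero i) (mul_one x) _ _
  mul_assoc := fun ⟨i, a⟩ ⟨j, b⟩ ⟨k, c⟩ => by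
    induction a using piece_ind with
    | h x hx =>
      induction b using piece_ind with
      | h y hy =>
        induction c using piece_ind with
        | h z hz => exact v.gradedMk_congr (add_assoc i j k) (mul_assoc x y z) _ _

instance instGRing : DirectSum.GRing v.piece where
  __ := v.instGMonoid
  mul_zero := fun {i j} a => by
    induction a using piece_ind with
    | h x hx => exact v.pieceMk_congr (mul_zero x) _ _
  zero_mul := fun {i j} b => by
    induction b using piece_ind with
    | h x hx => exact v.pieceMk_congr (zero_mul x) _ _
  mul_add := fun {i j} a b c => by
    induction a using piece_ind with
    | h x hx =>
      induction b using piece_ind with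
      | h y hy =>
        induction c using piece_ind with
        | h z hz => exact v.pieceMk_congr (mul_add x y z) _ _
  add_mul := fun {i j} a b c => by
    induction a using piece_ind with
    | h x hx =>
      induction b using piece_ind with
      | h y hy =>
        induction c using piece_ind with
        | h z hz => exact v.pieceMk_congr (add_mul x y z) _ _
  natCast := fun n => v.pieceMk 0 n (v.natCast_mem_filt n)
  natCast_zero := v.pieceMk_congr Nat.cast_zero _ _
  natCast_succ := fun n => v.pieceMk_congr (Nat.cast_succ n) _ _
  intCast := fun n => v.pieceMk 0 n (v.intCast_mem_filt n)
  intCast_ofNat := fun n => v.pieceMk_congr (Int.cast_natCast n) _ _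
  intCast_negSucc_ofNat := fun n => v.pieceMk_congr (Int.cast_negSucc n) _ _

/-- The associated graded ring `⨁ j, {x | j ≤ v x} / {x | j + 1 ≤ v x}`. -/
abbrev gr : Type _ := ⨁ j : ℤ, v.piece j

/-- The class in the degree `j` component of the graded ring of an element `x` with `j ≤ v x`. -/
noncomputable def cls (j : ℤ) (x : A) (hx : (j : WithTop ℤ) ≤ v x) : v.gr :=
  DirectSum.of v.piece j (v.pieceMk j x hx)

open Classical in
/-- The homogeneous component of `x`: its class in degree `v x` (and `0` for `x = 0`). -/
noncomputable def homComp (x : A) : v.gr :=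
  if hx : v x = ⊤ then 0 else v.cls ((v x).untop hx) x (by simp)

/-- `Φ` is an isomorphism of the polynomial ring over `K` in variables indexed by `σ` onto the
associated graded ring of `v`, which identifies `K` with the component of degree zero through the
homomorphism `ε : A → K` (so all values are nonnegative, and the class of `x` in degree zero is
`ε x`), and the variables with the homogeneous components of the elements `t s`. -/
structure IsPolynomialGr {K σ : Type*} [Field K] (ε : A →+* K) (t : σ → A)
    (Φ : MvPolynomial σ K ≃+* v.gr) : Prop where
  const : ∀ x : A, ∃ hx : ((0 : ℤ) : WithTop ℤ) ≤ v x, Φ (MvPolynomial.C (ε x)) = v.cls 0 x hx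
  var : ∀ s : σ, Φ (MvPolynomial.X s) = v.homComp (t s)

/-- The topology defined by `v` is the topology defined by the powers of the ideal `I`. -/
def IsAdicFor (I : Ideal A) : Prop :=
  (∀ n : ℕ, ∃ j : ℤ, ∀ x : A, (j : WithTop ℤ) ≤ v x → x ∈ I ^ n) ∧
    (∀ j : ℤ, ∃ n : ℕ, ∀ x ∈ I ^ n, (j : WithTop ℤ) ≤ v x)

end

end PseudoValuation

/-- `U` and `V` being subgroups of `H`, with `V` normal and containing the commutators of `U`: the
elements `e a` of `U` form a basis modulo `U ^ p V` of the vector space `U / U ^ p V` over the field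
of `p` elements.  A basis is given as an isomorphism of `U / U ^ p V` with the space of finitely
supported functions, under which the `e a` correspond to the standard basis vectors; here `U ^ p` is
the subgroup generated by the `p`-th powers. -/
def IsBasisModPow {H : Type*} [Group H] (p : ℕ) (U V : Subgroup H) {ι : Type*} (e : ι → H) : Prop :=
  ∃ (he : ∀ a, e a ∈ U) (β : U →* Multiplicative (ι →₀ ZMod p)),
    Function.Surjective β ∧
    (∀ u : U, β u = 1 ↔ (u : H) ∈ Subgroup.closure {y | ∃ x ∈ U, y = x ^ p} ⊔ V) ∧
    (∀ a, β ⟨e a, he a⟩ = Multiplicative.ofAdd (Finsupp.single a 1))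

/-- The factor `U / V` is torsion free. -/
def FactorTorsionFree {H : Type*} [Group H] (U V : Subgroup H) : Prop :=
  ∀ h ∈ U, ∀ m : ℕ, 0 < m → h ^ m ∈ V → h ∈ V

/-- Every element of infinite `p`-height of the factor `U / V` (that is, every element which is a
`p ^ m`-th power for all `m`) is trivial. -/
def FactorNoInfiniteHeight {H : Type*} [Group H] (p : ℕ) (U V : Subgroup H) : Prop :=
  ∀ h ∈ U, (∀ m : ℕ, ∃ u ∈ U, (u ^ p ^ m)⁻¹ * h ∈ V) → h ∈ V

/-- A properly descending central series `H = U 0 > U 1 > ⋯ > U n = 1` whose factors are torsion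
free (abelian) groups without nontrivial elements of infinite `p`-height. -/
structure IsGoodCentralSeries {H : Type*} [Group H] (p : ℕ) {n : ℕ}
    (U : Fin (n + 1) → Subgroup H) : Prop where
  top : U 0 = ⊤
  bot : U (Fin.last n) = ⊥
  lt : ∀ i : Fin n, U i.succ < U i.castSucc
  central : ∀ i : Fin n, ⁅U i.castSucc, (⊤ : Subgroup H)⁆ ≤ U i.succ
  torsionFree : ∀ i : Fin n, FactorTorsionFree (U i.castSucc) (U i.succ)
  height : ∀ i : Fin n, FactorNoInfiniteHeight p (U i.castSucc) (U i.succ)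

/-- The homomorphism `R[H] → K` which is `φ` on `R` and sends every element of `H` to `1`. -/
noncomputable def augHom {R K : Type*} [Ring R] [Field K] (H : Type*) [Group H] (φ : R →+* K) :
    MonoidAlgebra R H →+* K :=
  MonoidAlgebra.liftNCRingHom φ (1 : H →* K) (fun _ _ => Commute.all _ _)

/-- The element `h - 1` of the group ring `S[H]`. -/
noncomputable def groupSubOne (S : Type*) [Ring S] {H : Type*} [Group H] (h : H) :
    MonoidAlgebra S H :=
  MonoidAlgebra.single h 1 - 1

/-- The system `⟨π, E - 1⟩` of elements of `R[H]`: `none` stands for `π`. -/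
noncomputable def systemPi {R : Type*} [Ring R] {H : Type*} [Group H] (π : R)
    {n : ℕ} {ι : Fin n → Type*} (e : ∀ i, ι i → H) : Option (Σ i, ι i) → MonoidAlgebra R H
  | none => MonoidAlgebra.single 1 π
  | some s => groupSubOne R (e s.1 s.2)

/-- The system `E - 1` of elements of `K[H]`. -/
noncomputable def systemE (K : Type*) [Ring K] {H : Type*} [Group H]
    {n : ℕ} {ι : Fin n → Type*} (e : ∀ i, ι i → H) : (Σ i, ι i) → MonoidAlgebra K H :=
  fun s => groupSubOne K (e s.1 s.2)

/-!
The pseudovaluation is the one defined by a filtration of `R[H]` in terms of weights of words. The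
letters are `π`, the elements `e - 1`, and also `u - 1` for every `u` in a term `U k` of the series;
the last are given the least weight `W k` occurring on level `k`. The term of index `j` consists of
the sums of multiples of words of weight at least `j` (`CentralBasis.filt`). Its properties rest on
the following points.

*Generation.* The commutator of two elements lies on a higher level than both, and the weights more
than double from one level to the next, and to `π`. Therefore `x y - y x` has higher weight than
`x y` for any two of the letters `π` and `e - 1`, and words in these may be permuted modulo higher
terms. Moreover, modulo terms of index greater than `W k` and for `u`, `w` in `U k`, the element
`u w - 1` agrees with `(u - 1) + (w - 1)`, and `p (u - 1)` vanishes as `π` divides `p`. So those `u`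
for which `u - 1` is, modulo higher terms, a combination of words in `π` and the `e - 1` of weight
`W k` form a subgroup, which contains the basis elements of level `k`, the `p`-th powers and
`U (k + 1)`; it is all of `U k` (`CentralBasis.groupSubOne_mem_wordSpan`). Hence the classes of the
words in `π` and the `e - 1` generate the graded ring, which is commutative (`CentralBasis.filt_le_wordSpan`,
`RingFiltration.gr_mul_comm`). The term of index one is the kernel of the augmentation, and since
the weights of letters are positive and bounded, the topology is the adic one
(`CentralBasis.mem_ker_pow_of_mem_filt`, `CentralBasis.mem_filt_of_mem_ker_pow`).

*Independence.* That distinct monomials in these classes are independent over `K` is shown in finite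
`p`-groups (`CentralBasis.dvd_of_sum_wordOf_mem`). There are normal subgroups `N` of `H` which meet
every factor of the series in its `p ^ m`-th powers, with `m` as large as desired
(`exists_congruence_subgroup`). In `H / N` every element has a unique normal form as an ordered
product of powers of the `e` with bounded exponents, and the normal forms in suitable finitely many
`e` form a finite subgroup (`CoordSystem.exists_box_mul_mem`). In the group ring of a finite group
with such normal forms, the ordered monomials in the `e - 1` with the same bounds on exponents are a
basis over the coefficients (`exists_coordinates`): they generate, and their number is the order of
the group. Finally, up to a bound which grows with `m`, an element of weight at least `j` is a
combination of reduced ordered monomials of weight at least `j` (`wordFilt_le_monoSpan`). Indeed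
words can be sorted modulo words of higher weight; the power of `e - 1` with exponent `p ^ m` is
rewritten by the binomial expansion of `e ^ p ^ m = 1`, in which the coefficients of low powers of
`e - 1` are divisible by high powers of `p`, hence of `π`; and very long words are divisible by high
powers of `π`, since the augmentation ideal of a finite `p`-group is nilpotent modulo `p`. So the
coefficients of a relation between words are divisible by `π`.

*Separation.* An element `x` in the intersection of the filtration is divisible by `π`: a section
`H / N` in which the support of `x` stays distinct exists, because the factors have no elements of
infinite height; there `x` involves only monomials of bounded weight, whose coefficients must vanish
modulo `π` (`CentralBasis.exists_eq_pi_mul_of_forall_mem`). By independence, multiplication by `π` is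
injective on the graded ring, so that the argument can be repeated, and `x` vanishes as no nonzero
element of `R` is divisible by all powers of `π` (`CentralBasis.eq_zero_of_forall_mem_filt`).

*Uniqueness.* For another pseudovaluation with the same properties, words have at least their weight
and powers of the augmentation ideal have large values. As words generate each term of the
filtration up to terms of arbitrarily high degree, its values are not smaller; they are not larger
since the classes of an element in both graded rings are given by one and the same polynomial
(`RingFiltration.eq_val_of_isPolynomialGr`).

*Reduction modulo `π`.* The images of the terms of the filtration in `K[H]` are treated in the same
way, with independence and separation modulo `π`
(`CentralBasis.exists_isPolynomialGr_imageFiltration`), and the homomorphism of graded rings is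
determined on words (`RingFiltration.exists_grMap`).
-/

open scoped commutatorElement

/-! ### Pseudovaluations defined by filtrations -/

theorem WithTop.le_of_forall_int_le {a b : WithTop ℤ} (h : ∀ j : ℤ, (j : WithTop ℤ) ≤ a → j ≤ b) :
    a ≤ b := by
  induction a using WithTop.recTopCoe with
  | top =>
    induction b using WithTop.recTopCoe with
    | top => exact le_rfl
    | coe b =>
      have := h (b + 1) le_top
      exact absurd (WithTop.coe_le_coe.1 this) (by omega)
  | coe a => exact h a le_rfl

/-- A separated exhaustive filtration of a ring by additive subgroups, indexed by the natural
numbers and compatible with multiplication. -/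
structure RingFiltration (A : Type*) [Ring A] where
  F : ℕ → AddSubgroup A
  anti : Antitone F
  zero : F 0 = ⊤
  mul : ∀ {i j : ℕ} {x y : A}, x ∈ F i → y ∈ F j → x * y ∈ F (i + j)
  sep : ∀ x : A, (∀ j, x ∈ F j) → x = 0

namespace RingFiltration

variable {A : Type*} [Ring A] (D : RingFiltration A)

open Classical in
/-- The largest index of a term of the filtration containing `x`, and `⊤` for `x = 0`. -/
noncomputable def order (x : A) : WithTop ℤ :=
  if h : ∃ j, x ∉ D.F j then (((Nat.find h : ℕ) : ℤ) - 1 : ℤ) else ⊤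

theorem le_order_iff (x : A) (j : ℤ) : (j : WithTop ℤ) ≤ D.order x ↔ x ∈ D.F j.toNat := by
  classical
  unfold order
  split_ifs with h
  · rw [WithTop.coe_le_coe]
    constructor
    · intro hj
      by_contra hx
      have h1 := Nat.find_min' h hx
      have h0 : Nat.find h ≠ 0 := fun h0 => by
        have := Nat.find_spec h
        rw [h0, D.zero] at this
        exact this trivial
      omega
    · intro hx
      by_contra hj
      exact Nat.find_spec h (D.anti (by omega) hx)
  · push Not at h
    simp [h]

theorem order_eq_top_iff (x : A) : D.order x = ⊤ ↔ x = 0 := by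
  constructor
  · intro h
    refine D.sep x fun j => ?_
    have := (D.le_order_iff x j).1 (by rw [h]; exact le_top)
    simpa using this
  · rintro rfl
    unfold order
    simp

/-- The pseudovaluation defined by a filtration. -/
noncomputable def val : PseudoValuation A where
  toFun := D.order
  eq_top_iff' := D.order_eq_top_iff
  min_le_add' x y := WithTop.le_of_forall_int_le fun j hj => by
    rw [le_min_iff, D.le_order_iff, D.le_order_iff] at hj
    rw [D.le_order_iff]
    exact add_mem hj.1 hj.2
  neg' x := by
    refine le_antisymm (WithTop.le_of_forall_int_le fun j hj => ?_)
      (WithTop.le_of_forall_int_le fun j hj => ?_)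
    · rw [D.le_order_iff] at *
      simpa using hj
    · rw [D.le_order_iff] at *
      simpa using hj
  add_le_mul' x y := by
    by_cases hx : D.order x = ⊤
    · rw [D.order_eq_top_iff] at hx
      have : D.order (x * y) = ⊤ := by rw [D.order_eq_top_iff, hx, zero_mul]
      rw [this]; exact le_top
    by_cases hy : D.order y = ⊤
    · rw [D.order_eq_top_iff] at hy
      have : D.order (x * y) = ⊤ := by rw [D.order_eq_top_iff, hy, mul_zero]
      rw [this]; exact le_top
    obtain ⟨a, ha⟩ := WithTop.ne_top_iff_exists.1 hx
    obtain ⟨b, hb⟩ := WithTop.ne_top_iff_exists.1 hy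
    rw [← ha, ← hb, ← WithTop.coe_add, D.le_order_iff]
    have h1 := (D.le_order_iff x a).1 ha.le
    have h2 := (D.le_order_iff y b).1 hb.le
    exact D.anti (by omega) (D.mul h1 h2)
  one_nonneg' := by
    have := (D.le_order_iff 1 0).2 (by simp [D.zero])
    exact_mod_cast this

theorem le_val_iff (x : A) (j : ℤ) : (j : WithTop ℤ) ≤ D.val x ↔ x ∈ D.F j.toNat :=
  D.le_order_iff x j

theorem natCast_le_val_iff (x : A) (j : ℕ) :
    (((j : ℕ) : ℤ) : WithTop ℤ) ≤ D.val x ↔ x ∈ D.F j := by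
  rw [le_val_iff, Int.toNat_natCast]

theorem val_eq_iff (x : A) (j : ℕ) :
    D.val x = ((j : ℤ) : WithTop ℤ) ↔ x ∈ D.F j ∧ x ∉ D.F (j + 1) := by
  rw [← D.natCast_le_val_iff, ← D.natCast_le_val_iff]
  constructor
  · intro h
    rw [h]
    refine ⟨le_rfl, fun h1 => ?_⟩
    have := WithTop.coe_le_coe.1 h1
    push_cast at this
    omega
  · rintro ⟨h1, h2⟩
    generalize D.val.toFun x = a at h1 h2
    induction a using WithTop.recTopCoe with
    | top => exact absurd le_top h2
    | coe a =>
      rw [WithTop.coe_le_coe] at h1 h2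
      rw [WithTop.coe_eq_coe]
      push_cast at h2
      omega

end RingFiltration

/-! ### Classes in the graded ring -/

namespace PseudoValuation

variable {A : Type*} [Ring A] (v : PseudoValuation A)

theorem cls_add {j : ℤ} {x y : A} (hx : (j : WithTop ℤ) ≤ v x) (hy : (j : WithTop ℤ) ≤ v y)
    (hxy : (j : WithTop ℤ) ≤ v (x + y)) : v.cls j (x + y) hxy = v.cls j x hx + v.cls j y hy := by
  unfold cls
  rw [← map_add]
  rfl

theorem cls_congr {i j : ℤ} {x y : A} (hij : i = j) (hxy : x = y) (hx : (i : WithTop ℤ) ≤ v x)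
    (hy : (j : WithTop ℤ) ≤ v y) : v.cls i x hx = v.cls j y hy := by
  subst hij; subst hxy; rfl

theorem cls_eq_zero_iff {j : ℤ} {x : A} (hx : (j : WithTop ℤ) ≤ v x) :
    v.cls j x hx = 0 ↔ ((j + 1 : ℤ) : WithTop ℤ) ≤ v x := by
  unfold cls
  rw [← map_zero (DirectSum.of v.piece j), (DirectSum.of_injective j).eq_iff, eq_comm]
  exact (v.pieceMk_eq_iff (hx := zero_mem _) (hy := hx)).trans (by simp [mem_filt])

theorem le_mul {i j : ℤ} {x y : A} (hx : (i : WithTop ℤ) ≤ v x) (hy : (j : WithTop ℤ) ≤ v y) :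
    ((i + j : ℤ) : WithTop ℤ) ≤ v (x * y) := v.mul_mem_filt hx hy

theorem cls_mul {i j : ℤ} {x y : A} (hx : (i : WithTop ℤ) ≤ v x) (hy : (j : WithTop ℤ) ≤ v y) :
    v.cls i x hx * v.cls j y hy = v.cls (i + j) (x * y) (v.le_mul hx hy) := by
  unfold cls
  rw [DirectSum.of_mul_of]
  rfl

theorem cls_one : v.cls 0 1 v.one_nonneg' = 1 := rfl

theorem homComp_eq_cls {x : A} {j : ℤ} (h : v x = (j : WithTop ℤ)) :
    v.homComp x = v.cls j x h.ge := by
  unfold homComp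
  rw [dif_neg (by rw [h]; exact WithTop.coe_ne_top)]
  exact v.cls_congr (by simp [h]) rfl _ _

theorem le_zero (j : ℤ) : (j : WithTop ℤ) ≤ v 0 := by
  rw [(v.eq_top_iff' 0).2 rfl]; exact le_top

theorem cls_zero (j : ℤ) : v.cls j 0 (v.le_zero j) = 0 := by
  rw [cls_eq_zero_iff]; exact v.le_zero _

theorem le_neg {j : ℤ} {x : A} (hx : (j : WithTop ℤ) ≤ v x) : (j : WithTop ℤ) ≤ v (-x) := by
  rw [v.neg']; exact hx

theorem cls_neg {j : ℤ} {x : A} (hx : (j : WithTop ℤ) ≤ v x) :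
    v.cls j (-x) (v.le_neg hx) = -v.cls j x hx := by
  have := v.cls_add hx (v.le_neg hx) (by rw [add_neg_cancel]; exact v.le_zero j)
  rw [v.cls_congr rfl (add_neg_cancel x) _ (v.le_zero j), cls_zero] at this
  exact (neg_eq_of_add_eq_zero_right this.symm).symm

theorem le_add {j : ℤ} {x y : A} (hx : (j : WithTop ℤ) ≤ v x) (hy : (j : WithTop ℤ) ≤ v y) :
    (j : WithTop ℤ) ≤ v (x + y) := (v.filt j).add_mem hx hy

theorem le_sub {j : ℤ} {x y : A} (hx : (j : WithTop ℤ) ≤ v x) (hy : (j : WithTop ℤ) ≤ v y) :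
    (j : WithTop ℤ) ≤ v (x - y) := (v.filt j).sub_mem hx hy

theorem cls_eq_iff {j : ℤ} {x y : A} (hx : (j : WithTop ℤ) ≤ v x) (hy : (j : WithTop ℤ) ≤ v y) :
    v.cls j x hx = v.cls j y hy ↔ ((j + 1 : ℤ) : WithTop ℤ) ≤ v (x - y) := by
  rw [← v.cls_eq_zero_iff (v.le_sub hx hy), ← sub_eq_zero, sub_eq_add_neg, ← v.cls_neg,
    ← v.cls_add hx (v.le_neg hy) (v.le_add hx (v.le_neg hy))]
  rw [v.cls_congr rfl (sub_eq_add_neg x y).symm]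

end PseudoValuation

/-! ### Filtrations with polynomial graded ring -/

/-- The monomial `t ^ α`, the factors being taken in some order. -/
noncomputable def wordOf {A S : Type*} [Ring A] (t : S → A) (α : S →₀ ℕ) : A :=
  (α.toMultiset.toList.map t).prod

theorem sum_map_toList_toMultiset {S : Type*} (f : S → ℕ) (α : S →₀ ℕ) :
    (α.toMultiset.toList.map f).sum = Finsupp.weight f α := by
  have h : (α.toMultiset.toList.map f).sum = (α.toMultiset.map f).sum := by
    conv_rhs => rw [← Multiset.coe_toList α.toMultiset]
    rw [Multiset.map_coe, Multiset.sum_coe]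
  rw [h]
  clear h
  induction α using Finsupp.induction_linear with
  | zero => simp
  | add a b ha hb =>
    simp only [map_add, Multiset.map_add, Multiset.sum_add, ha, hb]
  | single a n => simp [Finsupp.weight_single, Multiset.map_nsmul, Multiset.sum_nsmul]

/-- For a filtration `F`, the elements of `F j` whose class modulo `F (j + 1)` is a combination of
words in the `t s` of weight exactly `j`. -/
def wordSpan {A : Type*} [Ring A] (F : ℕ → AddSubgroup A) {S : Type*} (t : S → A) (f : S → ℕ)
    (j : ℕ) : AddSubgroup A :=
  AddSubgroup.closure {x | ∃ (c : A) (l : List S), (l.map f).sum = j ∧ x = c * (l.map t).prod} ⊔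
    F (j + 1)

namespace RingFiltration

variable {A : Type*} [Ring A] (D : RingFiltration A)

theorem mem_zero (x : A) : x ∈ D.F 0 := by rw [D.zero]; trivial

theorem prod_map_mem {S : Type*} {t : S → A} {f : S → ℕ} (ht : ∀ s, t s ∈ D.F (f s)) (l : List S) :
    (l.map t).prod ∈ D.F (l.map f).sum := by
  induction l with
  | nil => exact D.mem_zero _
  | cons s l ih => simpa using D.mul (ht s) ih

theorem mul_prod_map_mem {S : Type*} {t : S → A} {f : S → ℕ} (ht : ∀ s, t s ∈ D.F (f s)) (c : A)
    (l : List S) : c * (l.map t).prod ∈ D.F (l.map f).sum := by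
  simpa using D.mul (D.mem_zero c) (D.prod_map_mem ht l)

/-- Two elements of given degrees commute modulo terms of higher degree. -/
def CommAt (i j : ℕ) (x y : A) : Prop :=
  x ∈ D.F i ∧ y ∈ D.F j ∧ x * y - y * x ∈ D.F (i + j + 1)

variable {D}

theorem CommAt.symm {i j : ℕ} {x y : A} (h : D.CommAt i j x y) : D.CommAt j i y x := by
  refine ⟨h.2.1, h.1, ?_⟩
  have := neg_mem h.2.2
  rw [neg_sub] at this
  rwa [add_comm j i]

theorem CommAt.mul_left {i j k : ℕ} {x y z : A} (hx : D.CommAt i k x z) (hy : D.CommAt j k y z) :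
    D.CommAt (i + j) k (x * y) z := by
  refine ⟨D.mul hx.1 hy.1, hx.2.1, ?_⟩
  have h1 := D.mul hx.1 hy.2.2
  have h2 := D.mul hx.2.2 hy.1
  have e : x * y * z - z * (x * y) = x * (y * z - z * y) + (x * z - z * x) * y := by noncomm_ring
  rw [e]
  refine add_mem ?_ ?_
  · convert h1 using 2; ring
  · convert h2 using 2; ring

theorem CommAt.prod_left {S : Type*} {t : S → A} {f : S → ℕ} {k : ℕ} {z : A} (hz : z ∈ D.F k)
    (h : ∀ s, D.CommAt (f s) k (t s) z) (l : List S) :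
    D.CommAt (l.map f).sum k (l.map t).prod z := by
  induction l with
  | nil => exact ⟨D.mem_zero _, hz, by simp⟩
  | cons s l ih => simpa using (h s).mul_left ih

variable (D)

section Polynomial

variable {K S : Type*} [Field K] {ε : A →+* K} {t : S → A} {f : S → ℕ}

/-- If the letters commute with each other and with all elements modulo terms of higher degree, then
so do any two elements, because the words generate each term of the filtration modulo the next. -/
theorem commAt_of_mem (hone : ∀ x, x ∈ D.F 1 ↔ ε x = 0) (ht : ∀ s, t s ∈ D.F (f s))
    (hcomm : ∀ s r, t s * t r - t r * t s ∈ D.F (f s + f r + 1))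
    (hcomm' : ∀ c s, c * t s - t s * c ∈ D.F (f s + 1))
    (hspan : ∀ j, D.F j ≤ wordSpan D.F t f j) {i j : ℕ} {x y : A} (hx : x ∈ D.F i) (hy : y ∈ D.F j) :
    D.CommAt i j x y := by
  have hcc : ∀ c c' : A, D.CommAt 0 0 c c' := fun c c' =>
    ⟨D.mem_zero _, D.mem_zero _, by rw [zero_add, zero_add, hone]; simp [mul_comm]⟩
  have hct : ∀ c s, D.CommAt 0 (f s) c (t s) := fun c s =>
    ⟨D.mem_zero _, ht s, by simpa using hcomm' c s⟩
  have htt : ∀ s r, D.CommAt (f s) (f r) (t s) (t r) := fun s r => ⟨ht s, ht r, hcomm s r⟩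
  have hww : ∀ (c c' : A) (l l' : List S), D.CommAt (l.map f).sum (l'.map f).sum
      (c * (l.map t).prod) (c' * (l'.map t).prod) := by
    intro c c' l l'
    have h1 : ∀ s, D.CommAt (l'.map f).sum (f s) (c' * (l'.map t).prod) (t s) := fun s => by
      have := (hct c' s).mul_left (CommAt.prod_left (ht s) (fun r => htt r s) l')
      simpa using this
    have h2 : D.CommAt (l'.map f).sum 0 (c' * (l'.map t).prod) c := by
      have := (hcc c' c).mul_left (CommAt.prod_left (D.mem_zero c) (fun r => (hct c r).symm) l')
      simpa using this
    have h3 := h2.symm.mul_left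
      (CommAt.prod_left (D.mul_prod_map_mem ht c' l') (fun s => (h1 s).symm) l)
    simpa using h3
  have hwF : ∀ (c : A) (l : List S) (j : ℕ) (y : A), y ∈ D.F j →
      D.CommAt (l.map f).sum j (c * (l.map t).prod) y := by
    intro c l j y hy
    refine ⟨D.mul_prod_map_mem ht c l, hy, ?_⟩
    have h := hspan j hy
    obtain ⟨y1, hy1, y2, hy2, rfl⟩ := AddSubgroup.mem_sup.1 h
    rw [mul_add, add_mul, add_sub_add_comm]
    refine add_mem ?_ (sub_mem ?_ ?_)
    · clear hy h
      induction hy1 using AddSubgroup.closure_induction with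
      | mem y hy => obtain ⟨c', l', rfl, rfl⟩ := hy; exact (hww c c' l l').2.2
      | zero => simp
      | add y y' _ _ h1 h2 =>
        rw [mul_add, add_mul, add_sub_add_comm]; exact add_mem h1 h2
      | neg y _ h1 => rw [mul_neg, neg_mul, ← neg_sub']; exact neg_mem h1
    · exact D.anti (by omega) (D.mul (D.mul_prod_map_mem ht c l) hy2)
    · exact D.anti (by omega) (D.mul hy2 (D.mul_prod_map_mem ht c l))
  refine ⟨hx, hy, ?_⟩
  obtain ⟨x1, hx1, x2, hx2, rfl⟩ := AddSubgroup.mem_sup.1 (hspan i hx)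
  rw [mul_add, add_mul, add_sub_add_comm]
  refine add_mem ?_ (sub_mem ?_ ?_)
  · clear hx
    induction hx1 using AddSubgroup.closure_induction with
    | mem x hx => obtain ⟨c', l', rfl, rfl⟩ := hx; exact (hwF c' l' j y hy).2.2
    | zero => simp
    | add y y' _ _ h1 h2 =>
      rw [mul_add, add_mul, add_sub_add_comm]; exact add_mem h1 h2
    | neg y _ h1 => rw [mul_neg, neg_mul, ← neg_sub']; exact neg_mem h1
  · exact D.anti (by omega) (D.mul hx2 hy)
  · exact D.anti (by omega) (D.mul hy hx2)

/-- Commutation modulo terms of higher degree means that the graded ring is commutative. -/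
theorem gr_mul_comm (h : ∀ {i j : ℕ} {x y : A}, x ∈ D.F i → y ∈ D.F j → D.CommAt i j x y)
    (a b : D.val.gr) : a * b = b * a := by
  have key : ∀ (i j : ℤ) (x y : A) (hx : (i : WithTop ℤ) ≤ D.val x)
      (hy : (j : WithTop ℤ) ≤ D.val y),
      D.val.cls i x hx * D.val.cls j y hy = D.val.cls j y hy * D.val.cls i x hx := by
    intro i j x y hx hy
    have neg : ∀ (i : ℤ) (x : A) (hx : (i : WithTop ℤ) ≤ D.val x), i < 0 →
        D.val.cls i x hx = 0 := fun i x hx hi => by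
      rw [D.val.cls_eq_zero_iff, D.le_val_iff, Int.toNat_of_nonpos (by omega)]
      exact D.mem_zero x
    rcases lt_or_ge i 0 with hi | hi
    · rw [neg i x hx hi]; simp
    rcases lt_or_ge j 0 with hj | hj
    · rw [neg j y hy hj]; simp
    have h1 := (h ((D.le_val_iff _ _).1 hx) ((D.le_val_iff _ _).1 hy)).2.2
    rw [D.val.cls_mul, D.val.cls_mul, D.val.cls_congr (add_comm j i) rfl _
      (by rw [add_comm i j]; exact D.val.le_mul hy hx), D.val.cls_eq_iff, D.le_val_iff]
    exact D.anti (by omega) h1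
  induction a using DirectSum.induction_on with
  | zero => simp
  | add a b h1 h2 => rw [mul_add, add_mul, h1, h2]
  | of i a =>
    induction b using DirectSum.induction_on with
    | zero => simp
    | add a b h1 h2 => rw [mul_add, add_mul, h1, h2]
    | of j b =>
      induction a using PseudoValuation.piece_ind with
      | h x hx =>
        induction b using PseudoValuation.piece_ind with
        | h y hy => exact key i j x y hx hy

end Polynomial
end RingFiltration

namespace PseudoValuation

section MapWord

variable {A B K S : Type*} [Ring A] [Ring B] [Field K] (w : PseudoValuation B)
  {ψ : MvPolynomial S K →+* w.gr} {ε : A →+* K} {g : A →+* B} {t : S → A} {f : S → ℕ}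

/-- A ring homomorphism from the polynomial ring to a graded ring, given on constants and variables
by the classes of the elements `g x` and `g (t s)`, is given on words by the classes of words. -/
theorem map_word (hC : ∀ x, ∃ hx : ((0 : ℤ) : WithTop ℤ) ≤ w (g x),
      ψ (MvPolynomial.C (ε x)) = w.cls 0 (g x) hx)
    (hX : ∀ s, ∃ hs : (((f s : ℕ) : ℤ) : WithTop ℤ) ≤ w (g (t s)),
      ψ (MvPolynomial.X s) = w.cls (f s : ℕ) (g (t s)) hs) (c : A) (l : List S) :
    ∃ h : ((((l.map f).sum : ℕ) : ℤ) : WithTop ℤ) ≤ w (g (c * (l.map t).prod)),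
      ψ (MvPolynomial.C (ε c) * (l.map MvPolynomial.X).prod) =
        w.cls ((l.map f).sum : ℕ) (g (c * (l.map t).prod)) h := by
  have hl : ∃ h : ((((l.map f).sum : ℕ) : ℤ) : WithTop ℤ) ≤ w (g (l.map t).prod),
      ψ ((l.map MvPolynomial.X).prod) = w.cls ((l.map f).sum : ℕ) (g (l.map t).prod) h := by
    induction l with
    | nil =>
      refine ⟨by simpa using w.one_nonneg', ?_⟩
      simp only [List.map_nil, List.prod_nil, map_one]
      exact (w.cls_one).symm.trans (w.cls_congr (by simp) (by simp) _ _)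
    | cons s l ih =>
      obtain ⟨h1, e1⟩ := ih
      obtain ⟨h2, e2⟩ := hX s
      have h3 := w.le_mul h2 h1
      have e3 : ((f s : ℕ) : ℤ) + ((l.map f).sum : ℕ) = (((s :: l).map f).sum : ℕ) := by simp
      have e4 : g (t s) * g (l.map t).prod = g ((s :: l).map t).prod := by simp
      refine ⟨by rw [← e3, ← e4]; exact h3, ?_⟩
      rw [List.map_cons, List.prod_cons, map_mul, e1, e2, w.cls_mul]
      exact w.cls_congr e3 e4 _ _
  obtain ⟨h1, e1⟩ := hl
  obtain ⟨h2, e2⟩ := hC c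
  have h3 := w.le_mul h2 h1
  rw [← map_mul, zero_add] at h3
  refine ⟨h3, ?_⟩
  rw [map_mul, e1, e2, w.cls_mul]
  exact w.cls_congr (by simp) (by simp) _ _

end MapWord

end PseudoValuation

theorem prod_map_X_toMultiset {S K : Type*} [Field K] (α : S →₀ ℕ) :
    (α.toMultiset.map (MvPolynomial.X : S → MvPolynomial S K)).prod =
      MvPolynomial.monomial α 1 := by
  induction α using Finsupp.induction_linear with
  | zero => simp
  | add a b ha hb => simp [ha, hb, MvPolynomial.monomial_mul]
  | single a n =>
    simp [Multiset.map_nsmul, Multiset.prod_nsmul, MvPolynomial.X_pow_eq_monomial]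

namespace RingFiltration

variable {A : Type*} [Ring A] (D : RingFiltration A)
variable {K S : Type*} [Field K] {ε : A →+* K} {t : S → A} {f : S → ℕ}

/-- The projection of the graded ring onto its component of degree `j`. -/
noncomputable def grProj {A : Type*} [Ring A] (v : PseudoValuation A) (j : ℤ) : v.gr →+ v.gr :=
  (DirectSum.of v.piece j).comp (DFinsupp.evalAddMonoidHom j)

theorem grProj_cls (v : PseudoValuation A) (i j : ℤ) (x : A) (hx : (i : WithTop ℤ) ≤ v x) :
    grProj v j (v.cls i x hx) = if i = j then v.cls i x hx else 0 := by
  unfold grProj PseudoValuation.cls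
  change DirectSum.of v.piece j ((DirectSum.of v.piece i (v.pieceMk i x hx)) j) = _
  split_ifs with h
  · subst h
    rw [DirectSum.of_eq_same]
  · rw [DirectSum.of_eq_of_ne _ _ _ (Ne.symm h), map_zero]

/-- The ring homomorphism `ψ` from the polynomial ring to the graded ring of `w` is compatible with
`g : A → B`: constants and variables go to the classes of their images under `g`, and `g` does not
lower degrees. -/
structure IsClassMap {B : Type*} [Ring B] (w : PseudoValuation B) (g : A →+* B) (ε : A →+* K)
    (t : S → A) (f : S → ℕ) (ψ : MvPolynomial S K →+* w.gr) : Prop where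
  le : ∀ (j : ℤ) (x : A), (j : WithTop ℤ) ≤ D.val x → (j : WithTop ℤ) ≤ w (g x)
  const : ∀ x, ∃ hx : ((0 : ℤ) : WithTop ℤ) ≤ w (g x),
    ψ (MvPolynomial.C (ε x)) = w.cls 0 (g x) hx
  var : ∀ s, ∃ hs : (((f s : ℕ) : ℤ) : WithTop ℤ) ≤ w (g (t s)),
    ψ (MvPolynomial.X s) = w.cls (f s : ℕ) (g (t s)) hs

/-- Since the graded ring is generated by the classes of words, two compatible homomorphisms give
the class of an element through one and the same polynomial. -/
theorem IsClassMap.exists_eq_cls {D : RingFiltration A} {B₁ B₂ : Type*} [Ring B₁] [Ring B₂]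
    {w₁ : PseudoValuation B₁} {w₂ : PseudoValuation B₂} {g₁ : A →+* B₁} {g₂ : A →+* B₂}
    {ψ₁ : MvPolynomial S K →+* w₁.gr} {ψ₂ : MvPolynomial S K →+* w₂.gr}
    (h₁ : D.IsClassMap w₁ g₁ ε t f ψ₁) (h₂ : D.IsClassMap w₂ g₂ ε t f ψ₂)
    (hspan : ∀ j, D.F j ≤ wordSpan D.F t f j) (j : ℤ) (x : A) (hx : (j : WithTop ℤ) ≤ D.val x) :
    ∃ q, ψ₁ q = w₁.cls j (g₁ x) (h₁.le j x hx) ∧ ψ₂ q = w₂.cls j (g₂ x) (h₂.le j x hx) := by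
  rcases lt_or_ge j 0 with hi | hi
  · have h0 : ((j + 1 : ℤ) : WithTop ℤ) ≤ D.val x := by
      rw [D.le_val_iff, Int.toNat_of_nonpos (by omega)]
      exact D.mem_zero x
    refine ⟨0, ?_, ?_⟩
    · rw [map_zero, eq_comm, w₁.cls_eq_zero_iff]
      exact h₁.le _ _ h0
    · rw [map_zero, eq_comm, w₂.cls_eq_zero_iff]
      exact h₂.le _ _ h0
  obtain ⟨j, rfl⟩ := Int.eq_ofNat_of_zero_le hi
  have hxj : x ∈ D.F j := (D.natCast_le_val_iff x j).1 hx
  obtain ⟨x1, hx1, x2, hx2, rfl⟩ := AddSubgroup.mem_sup.1 (hspan j hxj)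
  have key : ∃ (k₁ : ((j : ℤ) : WithTop ℤ) ≤ w₁ (g₁ x1))
      (k₂ : ((j : ℤ) : WithTop ℤ) ≤ w₂ (g₂ x1)) (q : _),
      ψ₁ q = w₁.cls j (g₁ x1) k₁ ∧ ψ₂ q = w₂.cls j (g₂ x1) k₂ := by
    clear hx hxj
    induction hx1 using AddSubgroup.closure_induction with
    | mem y hy =>
      obtain ⟨c, l, rfl, rfl⟩ := hy
      obtain ⟨k₁, e₁⟩ := w₁.map_word h₁.const h₁.var c l
      obtain ⟨k₂, e₂⟩ := w₂.map_word h₂.const h₂.var c l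
      exact ⟨k₁, k₂, _, e₁, e₂⟩
    | zero =>
      refine ⟨by rw [map_zero]; exact w₁.le_zero j, by rw [map_zero]; exact w₂.le_zero j, 0, ?_, ?_⟩
      · rw [map_zero, w₁.cls_congr rfl (map_zero g₁) _ (w₁.le_zero _), w₁.cls_zero]
      · rw [map_zero, w₂.cls_congr rfl (map_zero g₂) _ (w₂.le_zero _), w₂.cls_zero]
    | add y y' _ _ ih ih' =>
      obtain ⟨k₁, k₂, q, e₁, e₂⟩ := ih
      obtain ⟨k₁', k₂', q', e₁', e₂'⟩ := ih'
      refine ⟨by rw [map_add]; exact w₁.le_add k₁ k₁', by rw [map_add]; exact w₂.le_add k₂ k₂',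
        q + q', ?_, ?_⟩
      · rw [map_add, e₁, e₁', ← w₁.cls_add k₁ k₁' (w₁.le_add k₁ k₁')]
        exact w₁.cls_congr rfl (map_add g₁ y y').symm _ _
      · rw [map_add, e₂, e₂', ← w₂.cls_add k₂ k₂' (w₂.le_add k₂ k₂')]
        exact w₂.cls_congr rfl (map_add g₂ y y').symm _ _
    | neg y _ ih =>
      obtain ⟨k₁, k₂, q, e₁, e₂⟩ := ih
      refine ⟨by rw [map_neg]; exact w₁.le_neg k₁, by rw [map_neg]; exact w₂.le_neg k₂, -q, ?_, ?_⟩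
      · rw [map_neg, e₁, ← w₁.cls_neg k₁]
        exact w₁.cls_congr rfl (map_neg g₁ y).symm _ _
      · rw [map_neg, e₂, ← w₂.cls_neg k₂]
        exact w₂.cls_congr rfl (map_neg g₂ y).symm _ _
  obtain ⟨k₁, k₂, q, e₁, e₂⟩ := key
  have h7 : ((((j : ℕ) : ℤ) + 1 : ℤ) : WithTop ℤ) ≤ D.val (-x2) := by
    have := (D.natCast_le_val_iff _ (j + 1)).2 (neg_mem hx2)
    exact_mod_cast this
  have e7 : x1 - (x1 + x2) = -x2 := by abel
  refine ⟨q, e₁.trans ((w₁.cls_eq_iff _ _).2 ?_), e₂.trans ((w₂.cls_eq_iff _ _).2 ?_)⟩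
  · rw [← map_sub, e7]; exact h₁.le _ _ h7
  · rw [← map_sub, e7]; exact h₂.le _ _ h7

/-- A filtration whose classes of given degree are generated by the words in commuting symbols
`t s`, without relations, has a polynomial graded ring. -/
theorem exists_isPolynomialGr (hε : Function.Surjective ε)
    (hone : ∀ x, x ∈ D.F 1 ↔ ε x = 0) (ht : ∀ s, t s ∈ D.F (f s))
    (hcomm : ∀ s r, t s * t r - t r * t s ∈ D.F (f s + f r + 1))
    (hcomm' : ∀ c s, c * t s - t s * c ∈ D.F (f s + 1))
    (hspan : ∀ j, D.F j ≤ wordSpan D.F t f j)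
    (hind : ∀ (j : ℕ) (B : Finset (S →₀ ℕ)), (∀ α ∈ B, Finsupp.weight f α = j) →
      ∀ c : (S →₀ ℕ) → A, ∑ α ∈ B, c α * wordOf t α ∈ D.F (j + 1) → ∀ α ∈ B, ε (c α) = 0) :
    (∀ s, D.val (t s) = ((f s : ℤ) : WithTop ℤ)) ∧
      ∃ Φ : MvPolynomial S K ≃+* D.val.gr, D.val.IsPolynomialGr ε t Φ := by
  have hval : ∀ s, D.val (t s) = ((f s : ℤ) : WithTop ℤ) := fun s => by
    rw [D.val_eq_iff]
    refine ⟨ht s, fun h => ?_⟩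
    have := hind (f s) {Finsupp.single s 1} (by simp [Finsupp.weight_single]) (fun _ => 1)
      (by simpa [wordOf] using h) _ (Finset.mem_singleton_self _)
    simp at this
  refine ⟨hval, ?_⟩
  let _ : CommRing D.val.gr :=
    { (inferInstance : Ring D.val.gr) with
      mul_comm := D.gr_mul_comm (D.commAt_of_mem hone ht hcomm hcomm' hspan) }
  have h0 : ∀ x, ((0 : ℤ) : WithTop ℤ) ≤ D.val x := fun x => by
    rw [D.le_val_iff]; exact D.mem_zero x
  let κ0 : A →+* D.val.gr :=
    { toFun := fun x => D.val.cls 0 x (h0 x)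
      map_one' := rfl
      map_zero' := D.val.cls_zero 0
      map_add' := fun x y => D.val.cls_add (h0 x) (h0 y) (h0 (x + y))
      map_mul' := fun x y => by
        rw [D.val.cls_mul]; exact D.val.cls_congr (by simp) rfl _ _ }
  -- as `F 1` is the kernel of `ε`, the classes of degree zero form a copy of `K`
  have hκ0 : RingHom.ker ε ≤ RingHom.ker κ0 := fun x hx => by
    have h1 : x ∈ D.F 1 := (hone x).2 hx
    change D.val.cls 0 x (h0 x) = 0
    rw [D.val.cls_eq_zero_iff, D.le_val_iff]
    exact h1
  let κ : K →+* D.val.gr := RingHom.liftOfSurjective ε hε ⟨κ0, hκ0⟩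
  have hκ : ∀ x, κ (ε x) = D.val.cls 0 x (h0 x) := fun x =>
    RingHom.liftOfRightInverse_comp_apply ε _ (Function.rightInverse_surjInv hε) ⟨κ0, hκ0⟩ x
  let Φ : MvPolynomial S K →+* D.val.gr :=
    MvPolynomial.eval₂Hom κ (fun s => D.val.cls (f s : ℕ) (t s) (hval s).ge)
  have hC : ∀ x, Φ (MvPolynomial.C (ε x)) = D.val.cls 0 x (h0 x) := fun x => by
    rw [← hκ]; exact MvPolynomial.eval₂Hom_C _ _ _
  have hX : ∀ s, Φ (MvPolynomial.X s) = D.val.cls (f s : ℕ) (t s) (hval s).ge := fun s =>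
    MvPolynomial.eval₂Hom_X' _ _ _
  have hword := fun (c : A) (l : List S) =>
    PseudoValuation.map_word (g := RingHom.id A) D.val (ψ := Φ) (ε := ε) (t := t) (f := f)
      (fun x => ⟨h0 x, hC x⟩) (fun s => ⟨(hval s).ge, hX s⟩) c l
  have hmon : ∀ (α : S →₀ ℕ) (c : A), ∃ h : (((Finsupp.weight f α : ℕ) : ℤ) : WithTop ℤ) ≤
      D.val (c * wordOf t α), Φ (MvPolynomial.monomial α (ε c)) =
        D.val.cls (Finsupp.weight f α : ℕ) (c * wordOf t α) h := by
    intro α c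
    obtain ⟨h, e⟩ := hword c α.toMultiset.toList
    have e1 : MvPolynomial.monomial α (ε c) = MvPolynomial.C (ε c) *
        (α.toMultiset.toList.map (MvPolynomial.X : S → MvPolynomial S K)).prod := by
      rw [← Multiset.prod_coe, ← Multiset.map_coe, Multiset.coe_toList,
        prod_map_X_toMultiset, MvPolynomial.C_mul_monomial, mul_one]
    have e2 := sum_map_toList_toMultiset f α
    refine ⟨by rw [← e2]; exact h, ?_⟩
    rw [e1, e]
    exact D.val.cls_congr (by rw [e2]) rfl _ _
  have hsum : ∀ (j : ℕ) (c : (S →₀ ℕ) → A) (B : Finset (S →₀ ℕ)),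
      (∀ α ∈ B, Finsupp.weight f α = j) →
      ∃ h : ((j : ℤ) : WithTop ℤ) ≤ D.val (∑ α ∈ B, c α * wordOf t α),
        Φ (∑ α ∈ B, MvPolynomial.monomial α (ε (c α))) =
          D.val.cls j (∑ α ∈ B, c α * wordOf t α) h := by
    classical
    intro j c B
    induction B using Finset.induction_on with
    | empty =>
      intro _
      exact ⟨by simpa using D.val.le_zero j, by simpa using (D.val.cls_zero j).symm⟩
    | insert a B ha ih =>
      intro hB
      obtain ⟨h1, e1⟩ := ih fun α hα => hB α (Finset.mem_insert_of_mem hα)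
      obtain ⟨h2, e2⟩ := hmon a (c a)
      have e3 := hB a (Finset.mem_insert_self a B)
      rw [e3] at h2
      refine ⟨by rw [Finset.sum_insert ha]; exact D.val.le_add h2 h1, ?_⟩
      simp only [Finset.sum_insert ha]
      rw [map_add, e1, e2, D.val.cls_add h2 h1]
      congr 1
      exact D.val.cls_congr (by rw [e3]) rfl _ _
  have hinj : Function.Injective Φ := by
    rw [injective_iff_map_eq_zero]
    intro q hq
    by_contra hne
    obtain ⟨c, hc⟩ : ∃ c : (S →₀ ℕ) → A, ∀ α, ε (c α) = q.coeff α :=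
      ⟨fun α => (hε (q.coeff α)).choose, fun α => (hε (q.coeff α)).choose_spec⟩
    obtain ⟨α0, hα0⟩ := MvPolynomial.support_nonempty.2 hne
    have hq' : q = ∑ α ∈ q.support, MvPolynomial.monomial α (ε (c α)) := by
      simp only [hc]; exact q.as_sum
    -- a homogeneous component of a relation is a relation
    have h1 : Φ (∑ α ∈ q.support with Finsupp.weight f α = Finsupp.weight f α0,
        MvPolynomial.monomial α (ε (c α))) = 0 := by
      have h2 : grProj D.val (Finsupp.weight f α0 : ℕ) (Φ q) = 0 := by rw [hq, map_zero]
      rw [hq', map_sum, map_sum] at h2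
      rw [map_sum, Finset.sum_filter]
      refine Eq.trans (Finset.sum_congr rfl fun α _ => ?_) h2
      obtain ⟨h, e⟩ := hmon α (c α)
      rw [e, grProj_cls]
      simp only [Nat.cast_inj]
    obtain ⟨h3, e3⟩ := hsum (Finsupp.weight f α0) c
      (q.support.filter fun α => Finsupp.weight f α = Finsupp.weight f α0)
      (fun α hα => (Finset.mem_filter.1 hα).2)
    rw [h1] at e3
    have h4 := (D.val.cls_eq_zero_iff h3).1 e3.symm
    have h5 := hind (Finsupp.weight f α0) _ (fun α hα => (Finset.mem_filter.1 hα).2) c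
      ((D.natCast_le_val_iff _ _).1 (by exact_mod_cast h4)) α0 (by simp [hα0])
    rw [hc] at h5
    exact MvPolynomial.mem_support_iff.1 hα0 h5
  have hsurj : Function.Surjective Φ := by
    intro a
    induction a using DirectSum.induction_on with
    | zero => exact ⟨0, map_zero _⟩
    | add a b h1 h2 =>
      obtain ⟨x, rfl⟩ := h1
      obtain ⟨y, rfl⟩ := h2
      exact ⟨x + y, map_add _ _ _⟩
    | of i a =>
      induction a using PseudoValuation.piece_ind with
      | h x hx =>
        change (i : WithTop ℤ) ≤ D.val x at hx
        change ∃ q, Φ q = D.val.cls i x hx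
        have hΦ : D.IsClassMap D.val (RingHom.id A) ε t f Φ :=
          ⟨fun _ _ h => h, fun x => ⟨h0 x, hC x⟩, fun s => ⟨(hval s).ge, hX s⟩⟩
        obtain ⟨q, e, -⟩ := hΦ.exists_eq_cls hΦ hspan i x hx
        exact ⟨q, e⟩
  refine ⟨RingEquiv.ofBijective Φ ⟨hinj, hsurj⟩, fun x => ⟨h0 x, hC x⟩, fun s => ?_⟩
  rw [D.val.homComp_eq_cls (hval s)]
  exact hX s

theorem isClassMap_of_isPolynomialGr {Φ : MvPolynomial S K ≃+* D.val.gr}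
    (hval : ∀ s, D.val (t s) = ((f s : ℤ) : WithTop ℤ)) (hΦ : D.val.IsPolynomialGr ε t Φ) :
    D.IsClassMap D.val (RingHom.id A) ε t f (Φ : MvPolynomial S K →+* D.val.gr) where
  le _ _ h := h
  const := hΦ.const
  var s := ⟨(hval s).ge, (hΦ.var s).trans (D.val.homComp_eq_cls (hval s))⟩

/-- Two pseudovaluations with the same polynomial description of their graded rings are equal if one
of them defines a topology finer than that of the powers of the kernel of the augmentation. -/
theorem eq_val_of_isPolynomialGr {Φ : MvPolynomial S K ≃+* D.val.gr}
    (hval : ∀ s, D.val (t s) = ((f s : ℤ) : WithTop ℤ)) (hΦ : D.val.IsPolynomialGr ε t Φ)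
    (hspan : ∀ j, D.F j ≤ wordSpan D.F t f j)
    (hadic : ∀ n : ℕ, ∃ j : ℕ, ∀ x ∈ D.F j, x ∈ RingHom.ker ε ^ n)
    (w : PseudoValuation A) (Φ' : MvPolynomial S K ≃+* w.gr)
    (hw : ∀ s, w (t s) = ((f s : ℤ) : WithTop ℤ)) (hΦ' : w.IsPolynomialGr ε t Φ') :
    w = D.val := by
  have h0 : ∀ x, ((0 : ℤ) : WithTop ℤ) ≤ w x := fun x => (hΦ'.const x).1
  have hI : ∀ (n : ℕ) (x : A), x ∈ RingHom.ker ε ^ n → ((n : ℤ) : WithTop ℤ) ≤ w x := by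
    intro n
    induction n with
    | zero => intro x _; exact h0 x
    | succ n ih =>
      intro x hx
      rw [Submodule.pow_succ] at hx
      induction hx using Submodule.mul_induction_on' with
      | mem_mul_mem a ha b hb =>
        obtain ⟨h1, e1⟩ := hΦ'.const b
        rw [RingHom.mem_ker.1 hb, map_zero, map_zero, eq_comm, w.cls_eq_zero_iff] at e1
        exact_mod_cast w.le_mul (ih a ha) e1
      | add a _ b _ h1 h2 => exact w.le_add h1 h2
  have hword : ∀ (c : A) (l : List S),
      ((((l.map f).sum : ℕ) : ℤ) : WithTop ℤ) ≤ w (c * (l.map t).prod) := fun c l =>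
    (w.map_word (g := RingHom.id A) (ψ := (Φ' : MvPolynomial S K →+* w.gr)) hΦ'.const
      (fun s => ⟨(hw s).ge, (hΦ'.var s).trans (w.homComp_eq_cls (hw s))⟩) c l).1
  -- up to terms of arbitrarily high degree, an element of `F j` is a sum of words of weight at
  -- least `j`, and `w` is at least `j` on these
  have hle' : ∀ (N j : ℕ), ∀ x ∈ D.F j,
      ∃ y ∈ w.filt j, x - y ∈ D.F (j + N) := by
    intro N
    induction N with
    | zero => intro j x hx; exact ⟨0, zero_mem _, by simpa using hx⟩
    | succ N ih =>
      intro j x hx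
      obtain ⟨x1, hx1, x2, hx2, rfl⟩ := AddSubgroup.mem_sup.1 (hspan j hx)
      obtain ⟨y, hy, hy'⟩ := ih (j + 1) x2 hx2
      refine ⟨x1 + y, add_mem ?_ (w.filt_succ_le j (by exact_mod_cast hy)), ?_⟩
      · refine (AddSubgroup.closure_le _).2 ?_ hx1
        rintro _ ⟨c, l, rfl, rfl⟩
        exact hword c l
      · have e1 : x1 + x2 - (x1 + y) = x2 - y := by abel
        rw [e1]
        exact D.anti (by omega) hy'
  -- the remaining term lies in a high power of the kernel of `ε`, where `w` is large
  have hle : ∀ (j : ℤ) (x : A), (j : WithTop ℤ) ≤ D.val x → (j : WithTop ℤ) ≤ w x := by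
    intro j x hx
    rcases lt_or_ge j 0 with hi | hi
    · exact le_trans (WithTop.coe_le_coe.2 hi.le) (h0 x)
    obtain ⟨j, rfl⟩ := Int.eq_ofNat_of_zero_le hi
    obtain ⟨N, hN⟩ := hadic j
    obtain ⟨y, hy, hy'⟩ := hle' N j x ((D.natCast_le_val_iff _ _).1 hx)
    have h1 := hI j _ (hN _ (D.anti (by omega) hy'))
    have h2 := w.le_add h1 hy
    rwa [sub_add_cancel] at h2
  have h1 := D.isClassMap_of_isPolynomialGr hval hΦ
  have h2 : D.IsClassMap w (RingHom.id A) ε t f (Φ' : MvPolynomial S K →+* w.gr) :=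
    ⟨hle, hΦ'.const, fun s => ⟨(hw s).ge, (hΦ'.var s).trans (w.homComp_eq_cls (hw s))⟩⟩
  -- the classes of `x` in the two graded rings are given by the same polynomial, which vanishes if
  -- the class for `w` does, since `Φ'` is injective
  have hge : ∀ (x : A) (i j : ℕ), ((j : ℤ) : WithTop ℤ) ≤ w x → i ≤ j → x ∈ D.F i := by
    intro x i j hj
    induction i with
    | zero => intro _; exact D.mem_zero x
    | succ i ih =>
      intro hij
      have hx := (D.natCast_le_val_iff _ _).2 (ih (by omega))
      obtain ⟨q, e1, e2⟩ := h1.exists_eq_cls h2 hspan i x hx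
      have h3 : w.cls (i : ℤ) (RingHom.id A x) (h2.le i x hx) = 0 := by
        rw [w.cls_eq_zero_iff]
        exact le_trans (WithTop.coe_le_coe.2 (by omega)) hj
      have h4 : q = 0 := by
        refine Φ'.injective ?_
        rw [map_zero, ← h3]
        exact e2
      rw [h4, map_zero] at e1
      have h5 := (D.val.cls_eq_zero_iff _).1 e1.symm
      exact (D.natCast_le_val_iff _ _).1 (by exact_mod_cast h5)
  have : w.toFun = D.val.toFun := by
    funext x
    refine le_antisymm (WithTop.le_of_forall_int_le fun j hj => ?_)
      (WithTop.le_of_forall_int_le fun j hj => hle j x hj)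
    rw [D.le_val_iff]
    rcases lt_or_ge j 0 with hi | hi
    · rw [Int.toNat_of_nonpos hi.le]; exact D.mem_zero x
    · obtain ⟨j, rfl⟩ := Int.eq_ofNat_of_zero_le hi
      exact hge x j j hj le_rfl
  cases w
  cases h : D.val
  rw [h] at this
  cases this
  rfl

/-- The homomorphism of graded rings induced by a homomorphism of rings, when the graded rings are
polynomial rings. -/
theorem exists_grMap {Φ : MvPolynomial S K ≃+* D.val.gr}
    (hval : ∀ s, D.val (t s) = ((f s : ℤ) : WithTop ℤ)) (hΦ : D.val.IsPolynomialGr ε t Φ)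
    (hspan : ∀ j, D.F j ≤ wordSpan D.F t f j) {B : Type*} [Ring B] {w : PseudoValuation B}
    {g : A →+* B} {ψ : MvPolynomial S K →+* w.gr} (hψ : D.IsClassMap w g ε t f ψ) :
    ∃ θ : D.val.gr →+* w.gr,
      (∀ (j : ℤ) (x : A) (hx : (j : WithTop ℤ) ≤ D.val x),
        θ (D.val.cls j x hx) = w.cls j (g x) (hψ.le j x hx)) ∧
      ∀ q, θ (Φ q) = ψ q := by
  refine ⟨ψ.comp (Φ.symm : D.val.gr →+* MvPolynomial S K), fun j x hx => ?_, fun q => by simp⟩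
  obtain ⟨q, e1, e2⟩ := (D.isClassMap_of_isPolynomialGr hval hΦ).exists_eq_cls hψ hspan j x hx
  have e3 : Φ q = D.val.cls j x hx := e1
  rw [← e3, ← e2]
  simp

end RingFiltration

/-! ### Filtrations defined by the weights of words -/

section WordFilt

variable {R A Λ : Type*} [Ring R] [Ring A]

/-- The additive subgroup generated by the multiples `ρ r * t s₁ * ⋯ * t sₖ` of the words of weight
at least `j`. -/
def wordFilt (ρ : R →+* A) (t : Λ → A) (wt : Λ → ℕ) (j : ℕ) : AddSubgroup A :=
  AddSubgroup.closure {x | ∃ (r : R) (l : List Λ), j ≤ (l.map wt).sum ∧ x = ρ r * (l.map t).prod}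

variable {ρ : R →+* A} {t : Λ → A} {wt : Λ → ℕ}

theorem word_mem_wordFilt (r : R) (l : List Λ) {j : ℕ} (h : j ≤ (l.map wt).sum) :
    ρ r * (l.map t).prod ∈ wordFilt ρ t wt j :=
  AddSubgroup.subset_closure ⟨r, l, h, rfl⟩

theorem prod_mem_wordFilt (l : List Λ) {j : ℕ} (h : j ≤ (l.map wt).sum) :
    (l.map t).prod ∈ wordFilt ρ t wt j := by
  simpa using word_mem_wordFilt (ρ := ρ) (t := t) 1 l h

theorem letter_mem_wordFilt (s : Λ) {j : ℕ} (h : j ≤ wt s) : t s ∈ wordFilt ρ t wt j := by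
  simpa using prod_mem_wordFilt (ρ := ρ) (t := t) (wt := wt) [s] (by simpa using h)

theorem scalar_mem_wordFilt (r : R) : ρ r ∈ wordFilt ρ t wt 0 := by
  simpa using word_mem_wordFilt (ρ := ρ) (t := t) (wt := wt) r [] (j := 0) (by simp)

theorem wordFilt_antitone : Antitone (wordFilt ρ t wt) := by
  intro i j hij
  refine (AddSubgroup.closure_le _).2 ?_
  rintro _ ⟨r, l, h, rfl⟩
  exact word_mem_wordFilt r l (hij.trans h)

theorem commute_prod_map (hc : ∀ r s, Commute (ρ r) (t s)) (r : R) (l : List Λ) :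
    Commute (ρ r) (l.map t).prod := by
  refine Commute.list_prod_right _ _ fun x hx => ?_
  obtain ⟨s, -, rfl⟩ := List.mem_map.1 hx
  exact hc r s

theorem mul_mem_wordFilt (hc : ∀ r s, Commute (ρ r) (t s)) {i j : ℕ} {x y : A}
    (hx : x ∈ wordFilt ρ t wt i) (hy : y ∈ wordFilt ρ t wt j) :
    x * y ∈ wordFilt ρ t wt (i + j) := by
  induction hx using AddSubgroup.closure_induction with
  | zero => simp
  | add a b _ _ h1 h2 => rw [add_mul]; exact add_mem h1 h2
  | neg a _ h1 => rw [neg_mul]; exact neg_mem h1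
  | mem a ha =>
    obtain ⟨r, l, h, rfl⟩ := ha
    induction hy using AddSubgroup.closure_induction with
    | zero => simp
    | add a b _ _ h1 h2 => rw [mul_add]; exact add_mem h1 h2
    | neg a _ h1 => rw [mul_neg]; exact neg_mem h1
    | mem b hb =>
      obtain ⟨r', l', h', rfl⟩ := hb
      have e : ρ r * (l.map t).prod * (ρ r' * (l'.map t).prod) =
          ρ (r * r') * ((l ++ l').map t).prod := by
        rw [List.map_append, List.prod_append, map_mul, mul_assoc, mul_assoc,
          ← mul_assoc (l.map t).prod, ← (commute_prod_map hc r' l).eq, mul_assoc]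
      rw [e]
      refine word_mem_wordFilt _ _ ?_
      simp only [List.map_append, List.sum_append]
      omega

theorem scalar_mul_mem_wordFilt (r : R) {j : ℕ} {x : A} (hx : x ∈ wordFilt ρ t wt j) :
    ρ r * x ∈ wordFilt ρ t wt j := by
  induction hx using AddSubgroup.closure_induction with
  | zero => simp
  | add a b _ _ h1 h2 => rw [mul_add]; exact add_mem h1 h2
  | neg a _ h1 => rw [mul_neg]; exact neg_mem h1
  | mem a ha =>
    obtain ⟨r', l, h, rfl⟩ := ha
    rw [← mul_assoc, ← map_mul]
    exact word_mem_wordFilt _ l h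

/-- If commutators of letters have higher weight than expected, then permuting the letters of a word
does not change it modulo terms of higher weight. -/
theorem prod_sub_prod_mem_of_perm_of_mul_mem {F : ℕ → AddSubgroup A} (hanti : Antitone F)
    (hone : 1 ∈ F 0) (hmul : ∀ {i j : ℕ} {x y : A}, x ∈ F i → y ∈ F j → x * y ∈ F (i + j))
    (ht : ∀ s, t s ∈ F (wt s)) (hcomm : ∀ s s', t s * t s' - t s' * t s ∈ F (wt s + wt s' + 1))
    {l l' : List Λ} (h : l.Perm l') :
    (l.map t).prod - (l'.map t).prod ∈ F ((l.map wt).sum + 1) := by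
  have hprod : ∀ l : List Λ, (l.map t).prod ∈ F (l.map wt).sum := fun l => by
    induction l with
    | nil => exact hone
    | cons s l ih => simpa using hmul (ht s) ih
  induction h with
  | nil => simp
  | cons s _ ih =>
    simp only [List.map_cons, List.prod_cons, List.sum_cons]
    rw [← mul_sub, add_assoc]
    exact hmul (ht s) ih
  | swap s s' l =>
    simp only [List.map_cons, List.prod_cons, List.sum_cons]
    rw [← mul_assoc, ← mul_assoc, ← sub_mul]
    exact hanti (by omega) (hmul (hcomm s' s) (hprod l))
  | trans h1 h2 ih1 ih2 =>
    have e := (h1.map wt).sum_eq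
    rw [← e] at ih2
    have := add_mem ih1 ih2
    rwa [sub_add_sub_cancel] at this

theorem prod_sub_prod_mem_of_perm (hc : ∀ r s, Commute (ρ r) (t s))
    (hcomm : ∀ s s', t s * t s' - t s' * t s ∈ wordFilt ρ t wt (wt s + wt s' + 1))
    {l l' : List Λ} (h : l.Perm l') :
    (l.map t).prod - (l'.map t).prod ∈ wordFilt ρ t wt ((l.map wt).sum + 1) :=
  prod_sub_prod_mem_of_perm_of_mul_mem wordFilt_antitone (prod_mem_wordFilt [] le_rfl)
    (mul_mem_wordFilt hc) (fun s => letter_mem_wordFilt s le_rfl) hcomm h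

end WordFilt

theorem list_prod_mem_ideal_pow {A : Type*} [Ring A] (J : Ideal A) (l : List A)
    (h : ∀ x ∈ l, x ∈ J) : l.prod ∈ J ^ l.length := by
  induction l using List.reverseRecOn with
  | nil => simp [Submodule.pow_zero]
  | append_singleton l x ih =>
    rw [List.prod_append, List.prod_singleton, List.length_append, List.length_singleton,
      Submodule.pow_succ]
    exact Submodule.mul_mem_mul (ih fun y hy => h y (by simp [hy])) (h x (by simp))

/-! ### The augmentation ideal of a finite `p`-group -/

/-- Over the field with `p` elements the augmentation ideal of a finite `p`-group is nilpotent: a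
`p`-group fixes a nonzero vector of every simple module, hence acts trivially on it, so that the
elements `g - 1` lie in the Jacobson radical. -/
theorem exists_prod_groupSubOne_eq_zero {p : ℕ} [Fact p.Prime] {G : Type*} [Group G] [Finite G]
    (hG : IsPGroup p G) :
    ∃ N : ℕ, ∀ l : List G, l.length = N → (l.map (groupSubOne (ZMod p))).prod = 0 := by
  have : Finite (MonoidAlgebra (ZMod p) G) :=
    Finite.of_equiv (G → ZMod p) (Finsupp.equivFunOnFinite.symm.trans MonoidAlgebra.coeffEquiv.symm)
  have : IsArtinianRing (MonoidAlgebra (ZMod p) G) := inferInstance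
  have hJ : ∀ g : G, groupSubOne (ZMod p) g ∈ Ring.jacobson (MonoidAlgebra (ZMod p) G) := by
    intro g
    rw [Ring.jacobson_eq_sInf_isMaximal, Submodule.mem_sInf]
    intro m hm
    have hm' : Ideal.IsMaximal m := hm
    have : IsSimpleModule (MonoidAlgebra (ZMod p) G) (MonoidAlgebra (ZMod p) G ⧸ m) :=
      isSimpleModule_iff_isCoatom.2 hm'.out
    have : Nontrivial (MonoidAlgebra (ZMod p) G ⧸ m) :=
      IsSimpleModule.nontrivial (MonoidAlgebra (ZMod p) G) _
    let _ : MulAction G (MonoidAlgebra (ZMod p) G ⧸ m) :=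
      MulAction.compHom _ (MonoidAlgebra.of (ZMod p) G)
    have hsmul : ∀ (h : G) (x : MonoidAlgebra (ZMod p) G ⧸ m),
        h • x = (MonoidAlgebra.single h 1 : MonoidAlgebra (ZMod p) G) • x := fun _ _ => rfl
    have hp : p ∣ Nat.card (MonoidAlgebra (ZMod p) G ⧸ m) := by
      obtain ⟨x, hx⟩ := exists_ne (0 : MonoidAlgebra (ZMod p) G ⧸ m)
      have h1 : p • x = 0 := by
        have : (p : MonoidAlgebra (ZMod p) G) • x = 0 := by
          have h0 : (p : MonoidAlgebra (ZMod p) G) = 0 := by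
            rw [← map_natCast (MonoidAlgebra.singleOneRingHom (R := ZMod p) (M := G)),
              CharP.cast_eq_zero, map_zero]
          rw [h0, zero_smul]
        rwa [Nat.cast_smul_eq_nsmul] at this
      have h2 := addOrderOf_dvd_natCard x
      rwa [addOrderOf_eq_prime h1 hx] at h2
    have : Finite (MonoidAlgebra (ZMod p) G ⧸ m) :=
      Finite.of_surjective _ (Submodule.Quotient.mk_surjective m)
    obtain ⟨b, hb, hb0⟩ := hG.exists_fixed_point_of_prime_dvd_card_of_fixed_point
      (MonoidAlgebra (ZMod p) G ⧸ m) hp (a := 0) (fun h => by rw [hsmul, smul_zero])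
    have hb' : ∀ h : G, (MonoidAlgebra.single h 1 : MonoidAlgebra (ZMod p) G) • b = b := hb
    have hfix : ∀ a : MonoidAlgebra (ZMod p) G,
        (MonoidAlgebra.single g 1 : MonoidAlgebra (ZMod p) G) • (a • b) = a • b := by
      intro a
      induction a using MonoidAlgebra.induction_on with
      | of h => rw [MonoidAlgebra.of_apply, hb', hb']
      | add x y h1 h2 => rw [add_smul, smul_add, h1, h2]
      | smul r x h1 =>
        have e : r • x = MonoidAlgebra.single 1 r * x := by
          ext; simp
        have e' : (MonoidAlgebra.single g 1 : MonoidAlgebra (ZMod p) G) *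
            MonoidAlgebra.single 1 r = MonoidAlgebra.single 1 r * MonoidAlgebra.single g 1 := by
          simp [MonoidAlgebra.single_mul_single]
        rw [e, mul_smul, ← mul_smul (MonoidAlgebra.single g 1), e', mul_smul, h1]
    obtain ⟨a, ha⟩ := IsSimpleModule.toSpanSingleton_surjective (MonoidAlgebra (ZMod p) G)
      (Ne.symm hb0) (Submodule.Quotient.mk 1)
    have h1 := hfix a
    rw [LinearMap.toSpanSingleton_apply] at ha
    rw [ha, ← Submodule.Quotient.mk_smul, Submodule.Quotient.eq] at h1
    simpa [groupSubOne] using h1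
  obtain ⟨N, hN⟩ := IsSemiprimaryRing.isNilpotent (R := MonoidAlgebra (ZMod p) G)
  refine ⟨N, fun l hl => ?_⟩
  have := list_prod_mem_ideal_pow (Ring.jacobson (MonoidAlgebra (ZMod p) G))
    (l.map (groupSubOne (ZMod p))) (fun x hx => by
      obtain ⟨g, -, rfl⟩ := List.mem_map.1 hx
      exact hJ g)
  rw [List.length_map, hl, hN] at this
  simpa using this

/-! ### Ordered monomials in a group ring -/

section MonoSpan

variable {R G σ : Type*} [Ring R] [Group G]

/-- The system consisting of `π` (for `none`) and the elements `e s - 1` (for `some s`). -/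
noncomputable def letterPi (π : R) (e : σ → G) : Option σ → MonoidAlgebra R G
  | none => MonoidAlgebra.single 1 π
  | some s => groupSubOne R (e s)

theorem commute_single_one_groupSubOne (r : R) (g : G) :
    Commute (MonoidAlgebra.singleOneRingHom r : MonoidAlgebra R G) (groupSubOne R g) := by
  unfold groupSubOne
  refine Commute.sub_right ?_ (Commute.one_right _)
  simp [Commute, SemiconjBy, MonoidAlgebra.single_mul_single]

theorem commute_single_one_letterPi {π : R} (hπ : ∀ r, π * r = r * π) (e : σ → G) (r : R)
    (s : Option σ) : Commute (MonoidAlgebra.singleOneRingHom r) (letterPi π e s) := by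
  cases s with
  | none => simp [Commute, SemiconjBy, MonoidAlgebra.single_mul_single, letterPi, hπ]
  | some s => exact commute_single_one_groupSubOne r (e s)

/-- The additive subgroup generated by the multiples `r * π ^ i * ∏ (e s - 1) ^ a s` of weight at
least `j`, the product being taken over the list `l` in its order, with exponents `a s < u s`. -/
noncomputable def monoSpan (π : R) (e : σ → G) (c : ℕ) (f : σ → ℕ) (u : σ → ℕ) (l : List σ)
    (j : ℕ) : AddSubgroup (MonoidAlgebra R G) :=
  AddSubgroup.closure {x | ∃ (r : R) (i : ℕ) (a : σ → ℕ), (∀ s ∈ l, a s < u s) ∧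
    j ≤ i * c + (l.map fun s => a s * f s).sum ∧
    x = MonoidAlgebra.singleOneRingHom (r * π ^ i) *
      (l.map fun s => groupSubOne R (e s) ^ a s).prod}

variable {π : R} {e : σ → G} {c : ℕ} {f u : σ → ℕ}

theorem mono_mem_monoSpan {l : List σ} {j : ℕ} (r : R) (i : ℕ) (a : σ → ℕ)
    (ha : ∀ s ∈ l, a s < u s) (hj : j ≤ i * c + (l.map fun s => a s * f s).sum) :
    MonoidAlgebra.singleOneRingHom (r * π ^ i) *
      (l.map fun s => groupSubOne R (e s) ^ a s).prod ∈ monoSpan π e c f u l j :=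
  AddSubgroup.subset_closure ⟨r, i, a, ha, hj, rfl⟩

theorem monoSpan_antitone (l : List σ) : Antitone (monoSpan π e c f u l) := by
  intro i j hij
  refine (AddSubgroup.closure_le _).2 ?_
  rintro _ ⟨r, k, a, ha, h, rfl⟩
  exact mono_mem_monoSpan r k a ha (hij.trans h)

theorem scalar_mul_mem_monoSpan (hπ : ∀ r, π * r = r * π) (r : R) (i : ℕ) {l : List σ} {j : ℕ}
    {y : MonoidAlgebra R G} (hy : y ∈ monoSpan π e c f u l j) :
    MonoidAlgebra.singleOneRingHom (r * π ^ i) * y ∈ monoSpan π e c f u l (i * c + j) := by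
  induction hy using AddSubgroup.closure_induction with
  | zero => simp
  | add a b _ _ h1 h2 => rw [mul_add]; exact add_mem h1 h2
  | neg a _ h1 => rw [mul_neg]; exact neg_mem h1
  | mem y hy =>
    obtain ⟨r', i', a, ha, h, rfl⟩ := hy
    rw [← mul_assoc, ← map_mul]
    have e1 : r * π ^ i * (r' * π ^ i') = r * r' * π ^ (i + i') := by
      have : π ^ i * r' = r' * π ^ i := (Commute.pow_left (hπ r') i).eq
      rw [mul_assoc, ← mul_assoc (π ^ i), this, pow_add]
      noncomm_ring
    rw [e1]
    refine mono_mem_monoSpan _ _ a ha ?_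
    rw [add_mul]; omega

/-- Prepending a power of a new letter to ordered monomials. -/
theorem pow_mul_mem_monoSpan (s : σ) {l : List σ} (hs : s ∉ l) (b : ℕ) (hb : b < u s) {j : ℕ}
    {y : MonoidAlgebra R G} (hy : y ∈ monoSpan π e c f u l j) :
    groupSubOne R (e s) ^ b * y ∈ monoSpan π e c f u (s :: l) (b * f s + j) := by
  classical
  induction hy using AddSubgroup.closure_induction with
  | zero => simp
  | add a b _ _ h1 h2 => rw [mul_add]; exact add_mem h1 h2
  | neg a _ h1 => rw [mul_neg]; exact neg_mem h1
  | mem y hy =>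
    obtain ⟨r', i', a, ha, h, rfl⟩ := hy
    have e1 : ∀ r ∈ l, Function.update a s b r = a r := fun r hr =>
      Function.update_of_ne (fun h => hs (by rw [← h]; exact hr)) _ _
    have e2 : (l.map fun r => groupSubOne R (e r) ^ a r) =
        (l.map fun r => groupSubOne R (e r) ^ (Function.update a s b r)) :=
      List.map_congr_left fun r hr => by rw [e1 r hr]
    have e3 : (l.map fun r => a r * f r) = (l.map fun r => Function.update a s b r * f r) :=
      List.map_congr_left fun r hr => by rw [e1 r hr]
    rw [← mul_assoc, ← ((commute_single_one_groupSubOne _ _).pow_right b).eq, mul_assoc, e2]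
    have := mono_mem_monoSpan (π := π) (e := e) (c := c) (f := f) (u := u) (l := s :: l)
      (j := b * f s + j) r' i' (Function.update a s b) (fun r hr => ?_) ?_
    · simpa using this
    · rcases List.mem_cons.1 hr with rfl | hr
      · simpa using hb
      · rw [e1 r hr]; exact ha r hr
    · rw [e3] at h
      simp only [List.map_cons, List.sum_cons, Function.update_self]
      omega

theorem pow_eq_sum_groupSubOne (g : G) (k : ℕ) :
    (MonoidAlgebra.single (g ^ k) 1 : MonoidAlgebra R G) =
      ∑ b ∈ Finset.range (k + 1), MonoidAlgebra.singleOneRingHom (k.choose b : R) *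
        groupSubOne R g ^ b := by
  have h1 : (MonoidAlgebra.single (g ^ k) 1 : MonoidAlgebra R G) = (groupSubOne R g + 1) ^ k := by
    unfold groupSubOne
    rw [sub_add_cancel, MonoidAlgebra.single_pow, one_pow]
  rw [h1, (Commute.one_right _).add_pow]
  refine Finset.sum_congr rfl fun b _ => ?_
  rw [one_pow, mul_one, map_natCast, (Nat.cast_commute _ _).eq]

/-- An ordered product of powers of the `e s` is a combination of ordered monomials in the `e s - 1`
with exponents which are not larger. -/
theorem single_prod_pow_mem_monoSpan (hπ : ∀ r, π * r = r * π) {l : List σ} (hl : l.Nodup)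
    (a : σ → ℕ) (ha : ∀ s ∈ l, a s < u s) :
    MonoidAlgebra.single (l.map fun s => e s ^ a s).prod 1 ∈ monoSpan π e c f u l 0 := by
  induction l with
  | nil =>
    have := mono_mem_monoSpan (π := π) (e := e) (c := c) (f := f) (u := u) (l := []) (j := 0)
      1 0 a (by simp) (by simp)
    simpa [MonoidAlgebra.one_def] using this
  | cons s l ih =>
    rw [List.nodup_cons] at hl
    have h1 := ih hl.2 fun r hr => ha r (List.mem_cons_of_mem _ hr)
    have e1 : (MonoidAlgebra.single ((s :: l).map fun s => e s ^ a s).prod 1 : MonoidAlgebra R G) =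
        MonoidAlgebra.single (e s ^ a s) 1 *
          MonoidAlgebra.single (l.map fun s => e s ^ a s).prod 1 := by
      rw [MonoidAlgebra.single_mul_single]; simp
    rw [e1, pow_eq_sum_groupSubOne, Finset.sum_mul]
    refine sum_mem fun b hb => ?_
    have hbs : b < u s := lt_of_lt_of_le (Finset.mem_range.1 hb) (ha s (by simp))
    have h2 := pow_mul_mem_monoSpan s hl.1 b hbs h1
    have h3 := scalar_mul_mem_monoSpan hπ ((a s).choose b : R) 0 h2
    rw [pow_zero, mul_one, ← mul_assoc] at h3
    exact monoSpan_antitone _ (Nat.zero_le _) h3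

theorem natCast_eq_mul_pow {p : ℕ} (hπ : ∀ r, π * r = r * π) (hp : π ∣ (p : R)) {k i : ℕ}
    (h : p ^ i ∣ k) : ∃ r : R, (k : R) = r * π ^ i := by
  obtain ⟨x, hx⟩ := hp
  obtain ⟨y, rfl⟩ := h
  refine ⟨y * x ^ i, ?_⟩
  push_cast
  rw [hx, (show Commute π x from hπ x).mul_pow]
  have h1 : Commute (π ^ i) (x ^ i * y) := Commute.pow_left (hπ _) i
  rw [mul_assoc, h1.eq, (Nat.cast_commute y (x ^ i)).eq]

/-- If `g ^ (p ^ m) = 1`, then a high power of `g - 1` is a combination of terms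
`π ^ i * (g - 1) ^ b` of large weight with `b < p ^ m`. -/
theorem reduce_pow_mem {p : ℕ} (hπ : ∀ r, π * r = r * π) (hp : π ∣ (p : R)) {s : σ} {m L : ℕ}
    (hm : e s ^ p ^ m = 1) (hu : u s = p ^ m) (hpos : 0 < p)
    (hL : ∀ k, 0 < k → k < p ^ m → ∃ i, p ^ i ∣ (p ^ m).choose k ∧ L ≤ i * c + k * f s)
    (r : R) (i b : ℕ) {j : ℕ} (hj : j ≤ L) (hb : j ≤ i * c + b * f s) :
    MonoidAlgebra.singleOneRingHom (r * π ^ i) * groupSubOne R (e s) ^ b ∈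
      monoSpan π e c f u [s] j := by
  have hbase : ∀ (r : R) (i b : ℕ), b < p ^ m → j ≤ i * c + b * f s →
      MonoidAlgebra.singleOneRingHom (r * π ^ i) * groupSubOne R (e s) ^ b ∈
        monoSpan π e c f u [s] j := by
    intro r i b hb hb'
    have := mono_mem_monoSpan (π := π) (e := e) (c := c) (f := f) (u := u) (l := [s]) (j := j)
      r i (fun _ => b) (by simpa [hu] using hb) (by simpa using hb')
    simpa using this
  induction b using Nat.strong_induction_on generalizing r i with
  | _ b ih =>
    rcases lt_or_ge b (p ^ m) with hlt | hge
    · exact hbase r i b hlt hb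
    have hq : 0 < p ^ m := pow_pos hpos m
    have h1 := pow_eq_sum_groupSubOne (R := R) (e s) (p ^ m)
    rw [hm, ← MonoidAlgebra.one_def, Finset.sum_range_succ, ← Nat.succ_pred_eq_of_pos hq,
      Finset.sum_range_succ'] at h1
    simp only [Nat.succ_eq_add_one, Nat.sub_add_cancel hq, Nat.pred_eq_sub_one] at h1
    simp only [Nat.choose_self, Nat.choose_zero_right, Nat.cast_one, map_one, one_mul, pow_zero]
      at h1
    have h2 : groupSubOne R (e s) ^ p ^ m = -∑ k ∈ Finset.range (p ^ m - 1),
        MonoidAlgebra.singleOneRingHom ((p ^ m).choose (k + 1) : R) *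
          groupSubOne R (e s) ^ (k + 1) := by
      rw [eq_neg_iff_add_eq_zero, add_comm]
      have := h1.symm
      rw [add_right_comm] at this
      simpa using this
    have h3 : groupSubOne R (e s) ^ b =
        groupSubOne R (e s) ^ p ^ m * groupSubOne R (e s) ^ (b - p ^ m) := by
      rw [← pow_add]; congr 1; omega
    rw [h3, h2, neg_mul, mul_neg, Finset.sum_mul, Finset.mul_sum]
    refine neg_mem (sum_mem fun k hk => ?_)
    have hk' := Finset.mem_range.1 hk
    obtain ⟨i', hi', hL'⟩ := hL (k + 1) (by omega) (by omega)
    obtain ⟨r', hr'⟩ := natCast_eq_mul_pow hπ hp hi'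
    have e1 : r * π ^ i * (r' * π ^ i') = r * r' * π ^ (i + i') := by
      have : π ^ i * r' = r' * π ^ i := (Commute.pow_left (hπ r') i).eq
      rw [mul_assoc, ← mul_assoc (π ^ i), this, pow_add]
      noncomm_ring
    rw [hr', ← mul_assoc, ← mul_assoc, ← map_mul, e1, mul_assoc, ← pow_add]
    refine ih _ (by omega) _ _ ?_
    have : (k + 1) * f s ≤ (k + 1 + (b - p ^ m)) * f s := Nat.mul_le_mul_right _ (by omega)
    rw [add_mul]
    omega

/-- Ordered monomials with arbitrary exponents reduce to ordered monomials with exponents below the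
orders of the `e s`, the weight being kept up to the bound `L`. -/
theorem mono_mem_monoSpan_of_pow {p : ℕ} {m : σ → ℕ} {L : ℕ} (hπ : ∀ r, π * r = r * π)
    (hp : π ∣ (p : R)) (hpos : 0 < p) {l : List σ} (hl : l.Nodup)
    (hm : ∀ s ∈ l, e s ^ p ^ m s = 1)
    (hL : ∀ s ∈ l, ∀ k, 0 < k → k < p ^ m s →
      ∃ i, p ^ i ∣ (p ^ m s).choose k ∧ L ≤ i * c + k * f s)
    (a : σ → ℕ) {j : ℕ} (hj : j ≤ L) (hja : j ≤ (l.map fun s => a s * f s).sum) :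
    (l.map fun s => groupSubOne R (e s) ^ a s).prod ∈
      monoSpan π e c f (fun s => p ^ m s) l j := by
  induction l generalizing j with
  | nil =>
    have := mono_mem_monoSpan (π := π) (e := e) (c := c) (f := f) (u := fun s => p ^ m s)
      (l := []) (j := j) 1 0 a (by simp) (by simpa using hja)
    simpa [MonoidAlgebra.one_def] using this
  | cons s l ih =>
    rw [List.nodup_cons] at hl
    simp only [List.map_cons, List.sum_cons, List.prod_cons] at hja ⊢
    have h1 := ih hl.2 (fun r hr => hm r (List.mem_cons_of_mem _ hr))
      (fun r hr => hL r (List.mem_cons_of_mem _ hr)) (j := min L (l.map fun s => a s * f s).sum)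
      (min_le_left _ _) (min_le_right _ _)
    have h2 := reduce_pow_mem (u := fun s => p ^ m s) hπ hp (hm s (by simp)) rfl hpos
      (hL s (by simp)) 1 0 (a s) (j := min L (a s * f s)) (min_le_left _ _)
      (by rw [zero_mul, zero_add]; exact min_le_right _ _)
    rw [pow_zero, mul_one, map_one, one_mul] at h2
    have h3 : groupSubOne R (e s) ^ a s * (l.map fun s => groupSubOne R (e s) ^ a s).prod ∈
        monoSpan π e c f (fun s => p ^ m s) (s :: l)
          (min L (a s * f s) + min L (l.map fun s => a s * f s).sum) := by
      generalize min L (l.map fun s => a s * f s).sum = k at h1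
      generalize min L (a s * f s) = k' at h2
      generalize groupSubOne R (e s) ^ a s = x at h2
      induction h2 using AddSubgroup.closure_induction with
      | zero => simp
      | add a b _ _ h1 h2 => rw [add_mul]; exact add_mem h1 h2
      | neg a _ h1 => rw [neg_mul]; exact neg_mem h1
      | mem x hx =>
        obtain ⟨r, i, b, hb, hw, rfl⟩ := hx
        simp only [List.map_cons, List.map_nil, List.sum_cons, List.sum_nil, List.prod_cons,
          List.prod_nil, mul_one, add_zero] at hw ⊢
        rw [mul_assoc]
        refine monoSpan_antitone _ ?_
          (scalar_mul_mem_monoSpan hπ r i (pow_mul_mem_monoSpan s hl.1 (b s) (hb s (by simp)) h1))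
        omega
    exact monoSpan_antitone _ (by omega) h3

end MonoSpan

section Coordinates

variable {R G σ : Type*} [Ring R] [Group G]

/-- The exponents `b` of reduced ordered monomials over the list `l`, bounded by `q`. -/
def IsReducedExp (q : σ → ℕ) (l : List σ) (b : σ → ℕ) : Prop :=
  (∀ s ∈ l, b s < q s) ∧ ∀ s ∉ l, b s = 0

variable {e : σ → G} {q : σ → ℕ} {l : List σ}

theorem exists_isReducedExp (b : σ → ℕ) (hb : ∀ s ∈ l, b s < q s) :
    ∃ b', IsReducedExp q l b' ∧ ∀ s ∈ l, b' s = b s := by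
  classical
  refine ⟨fun s => if s ∈ l then b s else 0, ⟨fun s hs => ?_, fun s hs => by simp [hs]⟩,
    fun s hs => by simp [hs]⟩
  simpa [hs] using hb s hs

/-- If each element of the finite group `G` has a unique reduced expression as an ordered product of
powers of the `e s`, then the reduced ordered monomials in the `e s - 1` form a basis of `ℤ[G]`: they
generate, and their number is the rank. -/
theorem exists_int_basis [Finite G] (hl : l.Nodup)
    (hbij : Function.Bijective
      fun b : {b : σ → ℕ // IsReducedExp q l b} => (l.map fun s => e s ^ b.1 s).prod) :
    ∃ B : Module.Basis {b : σ → ℕ // IsReducedExp q l b} ℤ (MonoidAlgebra ℤ G),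
      ∀ b, B b = (l.map fun s => groupSubOne ℤ (e s) ^ b.1 s).prod := by
  have : Fintype G := Fintype.ofFinite G
  have : Fintype {b : σ → ℕ // IsReducedExp q l b} :=
    Fintype.ofEquiv G (Equiv.ofBijective _ hbij).symm
  have B0 : Module.Basis G ℤ (MonoidAlgebra ℤ G) :=
    ⟨MonoidAlgebra.coeffLinearEquiv ℤ⟩
  have hcard : Fintype.card {b : σ → ℕ // IsReducedExp q l b} =
      Module.finrank ℤ (MonoidAlgebra ℤ G) := by
    rw [Module.finrank_eq_card_basis B0]
    exact Fintype.card_congr (Equiv.ofBijective _ hbij)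
  have hspan : ⊤ ≤ Submodule.span ℤ (Set.range fun b : {b : σ → ℕ // IsReducedExp q l b} =>
      (l.map fun s => groupSubOne ℤ (e s) ^ b.1 s).prod) := by
    have hmono : ∀ x ∈ monoSpan (0 : ℤ) e 0 (fun _ => 0) q l 0,
        x ∈ Submodule.span ℤ (Set.range fun b : {b : σ → ℕ // IsReducedExp q l b} =>
          (l.map fun s => groupSubOne ℤ (e s) ^ b.1 s).prod) := by
      intro x hx
      induction hx using AddSubgroup.closure_induction with
      | zero => exact zero_mem _
      | add a b _ _ h1 h2 => exact add_mem h1 h2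
      | neg a _ h1 => exact neg_mem h1
      | mem x hx =>
        obtain ⟨r, i, a, ha, -, rfl⟩ := hx
        obtain ⟨a', ha', h⟩ := exists_isReducedExp a ha
        have e1 : (l.map fun s => groupSubOne ℤ (e s) ^ a s) =
            l.map fun s => groupSubOne ℤ (e s) ^ a' s :=
          List.map_congr_left fun r hr => by rw [h r hr]
        have e2 : ∀ (k : ℤ) (y : MonoidAlgebra ℤ G),
            MonoidAlgebra.singleOneRingHom k * y = k • y := fun k y => by ext; simp
        rw [e1, e2]
        exact Submodule.smul_mem _ _ (Submodule.subset_span ⟨⟨a', ha'⟩, rfl⟩)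
    intro x _
    induction x using MonoidAlgebra.induction_on with
    | of g =>
      obtain ⟨b, rfl⟩ := hbij.surjective g
      exact hmono _ (single_prod_pow_mem_monoSpan (by simp) hl _ b.2.1)
    | add x y h1 h2 => exact add_mem (h1 trivial) (h2 trivial)
    | smul r x h1 => exact Submodule.smul_mem _ _ (h1 trivial)
  exact ⟨basisOfTopLeSpanOfCardEqFinrank _ hspan hcard, fun b => by simp⟩

theorem mapRingHom_groupSubOne {S : Type*} [Ring S] (φ : R →+* S) (g : G) :
    MonoidAlgebra.mapRingHom G φ (groupSubOne R g) = groupSubOne S g := by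
  simp [groupSubOne]

/-- The coordinates of the elements of `R[G]` with respect to the reduced ordered monomials. -/
theorem exists_coordinates (R : Type*) [Ring R] [Finite G] (hl : l.Nodup)
    (hbij : Function.Bijective
      fun b : {b : σ → ℕ // IsReducedExp q l b} => (l.map fun s => e s ^ b.1 s).prod) :
    ∃ C : {b : σ → ℕ // IsReducedExp q l b} → (MonoidAlgebra R G →+ R),
      (∀ a r, C a (MonoidAlgebra.singleOneRingHom r *
        (l.map fun s => groupSubOne R (e s) ^ a.1 s).prod) = r) ∧
      (∀ a b r, a ≠ b → C a (MonoidAlgebra.singleOneRingHom r *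
        (l.map fun s => groupSubOne R (e s) ^ b.1 s).prod) = 0) ∧
      (∀ a r x, C a (MonoidAlgebra.singleOneRingHom r * x) = r * C a x) ∧
      ∀ (T : AddSubgroup (MonoidAlgebra R G)) (x : MonoidAlgebra R G),
        (∀ a, MonoidAlgebra.singleOneRingHom (C a x) *
          (l.map fun s => groupSubOne R (e s) ^ a.1 s).prod ∈ T) → x ∈ T := by
  obtain ⟨B, hB⟩ := exists_int_basis hl hbij
  let C : {b : σ → ℕ // IsReducedExp q l b} → (MonoidAlgebra R G →+ R) := fun a =>
    MonoidAlgebra.liftNC (AddMonoidHom.id R)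
      (fun g => ((B.coord a (MonoidAlgebra.single g 1) : ℤ) : R))
  have key : ∀ (a : {b : σ → ℕ // IsReducedExp q l b}) (r : R) (y : MonoidAlgebra ℤ G),
      C a (MonoidAlgebra.singleOneRingHom r *
        MonoidAlgebra.mapRingHom G (Int.castRingHom R) y) = r * ((B.coord a y : ℤ) : R) := by
    intro a r y
    induction y using MonoidAlgebra.induction_on with
    | of g =>
      simp [C, MonoidAlgebra.single_mul_single, MonoidAlgebra.liftNC_single]
    | add x y h1 h2 => simp only [map_add, mul_add, h1, h2, Int.cast_add]
    | smul k x h1 =>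
      have e2 : MonoidAlgebra.mapRingHom G (Int.castRingHom R) (k • x) =
          k • MonoidAlgebra.mapRingHom G (Int.castRingHom R) x := map_zsmul _ _ _
      rw [e2, mul_smul_comm, map_zsmul, h1, map_smul, smul_eq_mul, Int.cast_mul, zsmul_eq_mul,
        ← mul_assoc, ← mul_assoc, (Int.cast_commute k r).eq]
  have hmap : ∀ b : {b : σ → ℕ // IsReducedExp q l b},
      (l.map fun s => groupSubOne R (e s) ^ b.1 s).prod =
        MonoidAlgebra.mapRingHom G (Int.castRingHom R) (B b) := by
    intro b
    rw [hB, map_list_prod, List.map_map]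
    congr 1
    refine List.map_congr_left fun s _ => ?_
    simp [mapRingHom_groupSubOne]
  refine ⟨C, fun a r => ?_, fun a b r hab => ?_, fun a r x => ?_, fun T x hT => ?_⟩
  · rw [hmap, key]; simp
  · rw [hmap, key]; simp [hab.symm]
  · induction x using MonoidAlgebra.induction_linear with
    | zero => simp
    | add x y h1 h2 => rw [mul_add, map_add, h1, h2, map_add, mul_add]
    | single g r' =>
      simp [C, MonoidAlgebra.single_mul_single, MonoidAlgebra.liftNC_single, mul_assoc]
  · have : Finite {b : σ → ℕ // IsReducedExp q l b} :=
      Finite.of_equiv G (Equiv.ofBijective _ hbij).symm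
    have : Fintype {b : σ → ℕ // IsReducedExp q l b} := Fintype.ofFinite _
    have hx : x = ∑ a, MonoidAlgebra.singleOneRingHom (C a x) *
        (l.map fun s => groupSubOne R (e s) ^ a.1 s).prod := by
      clear hT
      induction x using MonoidAlgebra.induction_linear with
      | zero => simp
      | add x y h1 h2 =>
        conv_lhs => rw [h1, h2]
        rw [← Finset.sum_add_distrib]
        exact Finset.sum_congr rfl fun a _ => by rw [map_add, map_add, add_mul]
      | single g r =>
        have e1 : (MonoidAlgebra.single g r : MonoidAlgebra R G) =
            MonoidAlgebra.singleOneRingHom r * MonoidAlgebra.mapRingHom G (Int.castRingHom R)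
              (MonoidAlgebra.single g 1) := by
          simp [MonoidAlgebra.single_mul_single]
        rw [e1]
        simp only [key, hmap]
        conv_lhs => rw [← B.sum_repr (MonoidAlgebra.single g 1)]
        rw [map_sum, Finset.mul_sum]
        refine Finset.sum_congr rfl fun a _ => ?_
        rw [map_zsmul, map_mul, map_intCast, mul_assoc, zsmul_eq_mul, Module.Basis.coord_apply]
    rw [hx]
    exact sum_mem fun a _ => hT a

end Coordinates

/-! ### Words in the group ring of a finite `p`-group -/

section Words

variable {R G σ : Type*} [Ring R] [Group G] {π : R} {e : σ → G} {c : ℕ} {f : σ → ℕ} {l : List σ}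

theorem sum_map_ite_eq_of_nodup [DecidableEq σ] (hl : l.Nodup) (s : σ) (g : σ → ℕ) :
    (l.map fun s' => if s' = s then g s' else 0).sum = if s ∈ l then g s else 0 := by
  induction l with
  | nil => simp
  | cons r l ih =>
    rw [List.nodup_cons] at hl
    rw [List.map_cons, List.sum_cons, ih hl.2]
    by_cases h : r = s
    · subst h; simp [hl.1]
    · simp [h, Ne.symm h]

/-- A word in letters from `l` is a rearrangement of an ordered word. -/
theorem perm_canonical [DecidableEq σ] (w : List (Option σ)) (hw : ∀ s, some s ∈ w → s ∈ l)
    (hl : l.Nodup) : w.Perm (List.replicate (w.count none) none ++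
      l.flatMap fun s => List.replicate (w.count (some s)) (some s)) := by
  rw [List.perm_iff_count]
  intro o
  rw [List.count_append, List.count_replicate, List.count_flatMap]
  cases o with
  | none =>
    have : (l.map (List.count none ∘ fun s =>
        List.replicate (w.count (some s)) (some s))).sum = 0 := by
      refine List.sum_eq_zero fun x hx => ?_
      obtain ⟨s, -, rfl⟩ := List.mem_map.1 hx
      simp [List.count_replicate]
    rw [this]; simp
  | some s =>
    have e1 : (l.map (List.count (some s) ∘ fun s => List.replicate (w.count (some s)) (some s))) =
        l.map fun s' => if s' = s then w.count (some s') else 0 := by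
      refine List.map_congr_left fun s' _ => ?_
      simp [List.count_replicate]
    rw [e1, sum_map_ite_eq_of_nodup hl]
    by_cases hs : s ∈ l
    · simp [hs]
    · have : w.count (some s) = 0 := List.count_eq_zero.2 fun h => hs (hw s h)
      simp [this, hs]

theorem prod_map_canonical (i : ℕ) (a : σ → ℕ) (l : List σ) :
    ((List.replicate i none ++ l.flatMap fun s => List.replicate (a s) (some s)).map
      (letterPi π e)).prod =
      MonoidAlgebra.singleOneRingHom (π ^ i) *
        (l.map fun s => groupSubOne R (e s) ^ a s).prod := by
  rw [List.map_append, List.prod_append, List.map_replicate, List.prod_replicate, map_pow]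
  congr 1
  induction l with
  | nil => simp
  | cons s l ih => simp [ih, letterPi]

theorem sum_map_canonical (i : ℕ) (a : σ → ℕ) (l : List σ) :
    ((List.replicate i none ++ l.flatMap fun s => List.replicate (a s) (some s)).map
      (fun o : Option σ => o.elim c f)).sum = i * c + (l.map fun s => a s * f s).sum := by
  rw [List.map_append, List.sum_append, List.map_replicate, List.sum_replicate]
  congr 1
  induction l with
  | nil => simp
  | cons s l ih => simp [ih]

variable {p : ℕ} [Fact p.Prime]

/-- Long products of elements `g - 1` are divisible by `π`: they vanish modulo `p`, as the
augmentation ideal of the group ring over the field with `p` elements is nilpotent. -/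
theorem exists_eq_scalar_mul_of_prod [Finite G] (hG : IsPGroup p G) (hp : π ∣ (p : R)) :
    ∃ N : ℕ, ∀ w : List G, w.length = N →
      ∃ y : MonoidAlgebra R G,
        (w.map (groupSubOne R)).prod = MonoidAlgebra.singleOneRingHom π * y := by
  obtain ⟨N, hN⟩ := exists_prod_groupSubOne_eq_zero hG
  refine ⟨N, fun w hw => ?_⟩
  have h1 : MonoidAlgebra.mapRingHom G (Int.castRingHom (ZMod p))
      (w.map (groupSubOne ℤ)).prod = 0 := by
    rw [map_list_prod, List.map_map, ← hN w hw]
    congr 1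
    exact List.map_congr_left fun g _ => mapRingHom_groupSubOne _ g
  have h2 : ∀ z : MonoidAlgebra ℤ G, MonoidAlgebra.mapRingHom G (Int.castRingHom (ZMod p)) z = 0 →
      ∃ z', z = (p : ℤ) • z' := by
    intro z hz
    have hd : ∀ g, (p : ℤ) ∣ z.coeff g := fun g => by
      rw [← ZMod.intCast_zmod_eq_zero_iff_dvd]
      have := congrArg (fun x => x.coeff g) hz
      simpa using this
    refine ⟨MonoidAlgebra.ofCoeff (z.coeff.mapRange (fun k => k / (p : ℤ)) (by simp)), ?_⟩
    ext g
    change z.coeff g = (p : ℤ) • (z.coeff g / (p : ℤ))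
    exact (Int.mul_ediv_cancel' (hd g)).symm
  obtain ⟨z', hz'⟩ := h2 _ h1
  obtain ⟨x, hx⟩ := hp
  refine ⟨MonoidAlgebra.singleOneRingHom x * MonoidAlgebra.mapRingHom G (Int.castRingHom R) z', ?_⟩
  have h3 := congrArg (MonoidAlgebra.mapRingHom G (Int.castRingHom R)) hz'
  rw [map_list_prod, List.map_map] at h3
  have h4 : (w.map (groupSubOne R)) =
      w.map (MonoidAlgebra.mapRingHom G (Int.castRingHom R) ∘ groupSubOne ℤ) :=
    List.map_congr_left fun g _ => (mapRingHom_groupSubOne _ g).symm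
  rw [h4, h3, map_zsmul, ← mul_assoc, ← map_mul, ← hx, map_natCast]
  simp

/-- Long words in `π` and the `e s - 1` are divisible by high powers of `π`. -/
theorem exists_word_eq_scalar_mul [Finite G] (hG : IsPGroup p G) (hπ : ∀ r, π * r = r * π)
    (hp : π ∣ (p : R)) (e : σ → G) (L : ℕ) :
    ∃ N : ℕ, ∀ w : List (Option σ), N ≤ w.length →
      ∃ y, (w.map (letterPi π e)).prod = MonoidAlgebra.singleOneRingHom (π ^ L) * y := by
  have hcπ : ∀ x : MonoidAlgebra R G, Commute (MonoidAlgebra.singleOneRingHom π) x := by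
    intro x
    induction x using MonoidAlgebra.induction_on with
    | of g => simp [Commute, SemiconjBy, MonoidAlgebra.single_mul_single]
    | add x y h1 h2 => exact h1.add_right h2
    | smul r x h1 =>
      have : r • x = MonoidAlgebra.singleOneRingHom r * x := by ext; simp
      rw [this]
      refine Commute.mul_right ?_ h1
      simp [Commute, SemiconjBy, MonoidAlgebra.single_mul_single, hπ]
  obtain ⟨N, hN⟩ := exists_eq_scalar_mul_of_prod hG hp
  have hblock : ∀ w : List (Option σ), w.length = N →
      ∃ y, (w.map (letterPi π e)).prod = MonoidAlgebra.singleOneRingHom π * y := by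
    intro w hw
    by_cases hn : none ∈ w
    · obtain ⟨w1, w2, rfl⟩ := List.append_of_mem hn
      refine ⟨(w1.map (letterPi π e)).prod * (w2.map (letterPi π e)).prod, ?_⟩
      rw [← mul_assoc, (hcπ _).eq, List.map_append, List.prod_append, mul_assoc]
      rfl
    · obtain ⟨w', rfl⟩ : ∃ w' : List σ, w = w'.map some := by
        clear hw
        induction w with
        | nil => exact ⟨[], rfl⟩
        | cons o w ih =>
          obtain ⟨w', hw'⟩ := ih fun h => hn (List.mem_cons_of_mem _ h)
          cases o with
          | none => exact absurd List.mem_cons_self hn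
          | some s => exact ⟨s :: w', by rw [hw', List.map_cons]⟩
      obtain ⟨y, hy⟩ := hN (w'.map e) (by simpa using hw)
      refine ⟨y, ?_⟩
      rw [← hy, List.map_map, List.map_map]
      rfl
  induction L with
  | zero => exact ⟨0, fun w _ => ⟨_, by rw [pow_zero, map_one, one_mul]⟩⟩
  | succ L ih =>
    obtain ⟨M, hM⟩ := ih
    refine ⟨M + N, fun w hw => ?_⟩
    obtain ⟨y, hy⟩ := hblock (w.take N) (by rw [List.length_take]; omega)
    obtain ⟨z, hz⟩ := hM (w.drop N) (by rw [List.length_drop]; omega)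
    refine ⟨y * z, ?_⟩
    rw [← List.take_append_drop N w, List.map_append, List.prod_append, hy, hz, map_pow, map_pow,
      pow_succ', mul_assoc, mul_assoc, ← mul_assoc y, (((hcπ y).pow_left L).eq).symm, mul_assoc]

/-- In the group ring of a finite `p`-group, an element given by words of weight at least `j` is a
combination of reduced ordered monomials of weight at least `j`, if `j` is not larger than the bound
`L` up to which exponents can be reduced.  Words are sorted modulo words of higher weight, and words
of very high weight are multiples of `π ^ L`. -/
theorem wordFilt_le_monoSpan [Finite G] (hG : IsPGroup p G) (hπ : ∀ r, π * r = r * π)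
    (hp : π ∣ (p : R)) {m : σ → ℕ} {L : ℕ} (hc : 0 < c) {M : ℕ} (hf : ∀ s, f s ≤ M)
    (hl : l.Nodup) (hout : ∀ s ∉ l, e s = 1) (hm : ∀ s ∈ l, e s ^ p ^ m s = 1)
    (hsurj : ∀ g, ∃ b : σ → ℕ, (∀ s ∈ l, b s < p ^ m s) ∧ (l.map fun s => e s ^ b s).prod = g)
    (hL : ∀ s ∈ l, ∀ k, 0 < k → k < p ^ m s →
      ∃ i, p ^ i ∣ (p ^ m s).choose k ∧ L ≤ i * c + k * f s)
    (hcomm : ∀ s s', groupSubOne R (e s) * groupSubOne R (e s') -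
      groupSubOne R (e s') * groupSubOne R (e s) ∈
        wordFilt MonoidAlgebra.singleOneRingHom (letterPi π e) (fun o => o.elim c f)
          (f s + f s' + 1)) {j : ℕ} (hj : j ≤ L) :
    wordFilt MonoidAlgebra.singleOneRingHom (letterPi π e) (fun o => o.elim c f) j ≤
      monoSpan π e c f (fun s => p ^ m s) l j := by
  have hpos : 0 < p := (Fact.out : p.Prime).pos
  have hcL := commute_single_one_letterPi hπ e
  have hcomm' : ∀ o o' : Option σ, letterPi π e o * letterPi π e o' -
      letterPi π e o' * letterPi π e o ∈ wordFilt MonoidAlgebra.singleOneRingHom (letterPi π e)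
        (fun o => o.elim c f) (o.elim c f + o'.elim c f + 1) := by
    intro o o'
    cases o with
    | none =>
      have := (hcL π o').eq
      have e1 : letterPi π e none = MonoidAlgebra.singleOneRingHom π := rfl
      rw [e1, this, sub_self]; exact zero_mem _
    | some s =>
      cases o' with
      | none =>
        have := (hcL π (some s)).eq
        have e1 : letterPi π e none = MonoidAlgebra.singleOneRingHom π := rfl
        rw [e1, this, sub_self]; exact zero_mem _
      | some s' => exact hcomm s s'
  -- sorting a word produces terms of higher weight; the sorted word reduces to monomials
  have hstep : ∀ j, wordFilt MonoidAlgebra.singleOneRingHom (letterPi π e) (fun o => o.elim c f) j ≤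
      monoSpan π e c f (fun s => p ^ m s) l (min L j) ⊔
        wordFilt MonoidAlgebra.singleOneRingHom (letterPi π e) (fun o => o.elim c f) (j + 1) := by
    intro j
    refine (AddSubgroup.closure_le _).2 ?_
    rintro _ ⟨r, w, hw, rfl⟩
    by_cases hwl : ∃ s, some s ∈ w ∧ s ∉ l
    · obtain ⟨s, hs, hsl⟩ := hwl
      have h0 : (w.map (letterPi π e)).prod = 0 := by
        refine List.prod_eq_zero (List.mem_map.2 ⟨some s, hs, ?_⟩)
        simp [letterPi, groupSubOne, hout s hsl, MonoidAlgebra.one_def]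
      rw [h0, mul_zero]; exact zero_mem _
    push Not at hwl
    obtain ⟨i, a, hperm⟩ : ∃ (i : ℕ) (a : σ → ℕ), w.Perm (List.replicate i none ++
        l.flatMap fun s => List.replicate (a s) (some s)) := by
      classical
      exact ⟨_, _, perm_canonical w hwl hl⟩
    have h1 := prod_sub_prod_mem_of_perm hcL hcomm' hperm
    have hwt := (hperm.map (fun o : Option σ => o.elim c f)).sum_eq
    rw [sum_map_canonical] at hwt
    rw [prod_map_canonical] at h1
    have h2 := mono_mem_monoSpan_of_pow (R := R) (π := π) (c := c) (f := f) hπ hp hpos hl hm hL a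
      (j := min L (l.map fun s => a s * f s).sum) (min_le_left _ _) (min_le_right _ _)
    have h3 := scalar_mul_mem_monoSpan hπ r i h2
    refine AddSubgroup.mem_sup.2 ⟨_, monoSpan_antitone _ ?_ h3, _,
      wordFilt_antitone ?_ (mul_mem_wordFilt hcL (scalar_mem_wordFilt r) h1), ?_⟩
    · omega
    · omega
    · rw [mul_sub, map_mul, mul_assoc]; abel
  have hiter : ∀ N j, wordFilt MonoidAlgebra.singleOneRingHom (letterPi π e)
      (fun o => o.elim c f) j ≤ monoSpan π e c f (fun s => p ^ m s) l (min L j) ⊔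
        wordFilt MonoidAlgebra.singleOneRingHom (letterPi π e) (fun o => o.elim c f) (j + N) := by
    intro N
    induction N with
    | zero => intro j; exact le_sup_right
    | succ N ih =>
      intro j
      refine (ih j).trans (sup_le le_sup_left ((hstep (j + N)).trans (sup_le ?_ le_sup_right)))
      exact le_sup_of_le_left (monoSpan_antitone _ (by omega))
  have htop : ∀ x : MonoidAlgebra R G, x ∈ monoSpan π e c f (fun s => p ^ m s) l 0 := by
    intro x
    induction x using MonoidAlgebra.induction_on with
    | of g =>
      obtain ⟨b, hb, rfl⟩ := hsurj g
      exact single_prod_pow_mem_monoSpan hπ hl b hb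
    | add x y h1 h2 => exact add_mem h1 h2
    | smul r x h1 =>
      have e1 : r • x = MonoidAlgebra.singleOneRingHom (r * π ^ 0) * x := by ext; simp
      rw [e1]
      exact monoSpan_antitone _ (Nat.zero_le _) (scalar_mul_mem_monoSpan hπ r 0 h1)
  -- iteration ends with words of very high weight; these are long, as the weights of the letters are
  -- bounded, and hence multiples of `π ^ L`
  obtain ⟨N, hN⟩ := exists_word_eq_scalar_mul hG hπ hp e L
  have hlen : ∀ w : List (Option σ),
      (w.map (fun o : Option σ => o.elim c f)).sum ≤ w.length * (c + M) := by
    intro w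
    have := List.sum_le_card_nsmul (w.map (fun o : Option σ => o.elim c f)) (c + M) (by
      intro x hx
      obtain ⟨o, -, rfl⟩ := List.mem_map.1 hx
      cases o with
      | none => simp
      | some s => exact (hf s).trans (Nat.le_add_left _ _))
    simpa using this
  have hhigh : wordFilt MonoidAlgebra.singleOneRingHom (letterPi π e) (fun o => o.elim c f)
      (N * (c + M)) ≤ monoSpan π e c f (fun s => p ^ m s) l L := by
    refine (AddSubgroup.closure_le _).2 ?_
    rintro _ ⟨r, w, hw, rfl⟩
    obtain ⟨y, hy⟩ := hN w (by
      have h1 := hw.trans (hlen w)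
      exact Nat.le_of_mul_le_mul_right h1 (by omega))
    rw [hy, ← mul_assoc, ← map_mul]
    have := scalar_mul_mem_monoSpan hπ r L (htop y)
    refine monoSpan_antitone _ ?_ this
    rw [add_zero]; exact Nat.le_mul_of_pos_right L hc
  have h1 := hiter (N * (c + M)) j
  rw [min_eq_right hj] at h1
  refine h1.trans (sup_le le_rfl ?_)
  exact (wordFilt_antitone (by omega)).trans (hhigh.trans (monoSpan_antitone _ hj))

/-- The coordinates of elements of given weight. -/
theorem dvd_coordinate_of_mem_monoSpan (hπ : ∀ r, π * r = r * π) {q : σ → ℕ}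
    {C : {b : σ → ℕ // IsReducedExp q l b} → (MonoidAlgebra R G →+ R)}
    (hC : ∀ a r, C a (MonoidAlgebra.singleOneRingHom r *
        (l.map fun s => groupSubOne R (e s) ^ a.1 s).prod) = r)
    (hC' : ∀ a b r, a ≠ b → C a (MonoidAlgebra.singleOneRingHom r *
        (l.map fun s => groupSubOne R (e s) ^ b.1 s).prod) = 0) {j : ℕ} {x : MonoidAlgebra R G}
    (hx : x ∈ monoSpan π e c f q l j) (a : {b : σ → ℕ // IsReducedExp q l b}) (i : ℕ)
    (hi : i * c + (l.map fun s => a.1 s * f s).sum < j) : π ^ (i + 1) ∣ C a x := by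
  induction hx using AddSubgroup.closure_induction with
  | zero => simp
  | add a b _ _ h1 h2 => rw [map_add]; exact dvd_add h1 h2
  | neg a _ h1 => rw [map_neg]; exact (dvd_neg).2 h1
  | mem x hx =>
    obtain ⟨r, i', b, hb, hw, rfl⟩ := hx
    obtain ⟨b', hb', h⟩ := exists_isReducedExp b hb
    have e1 : (l.map fun s => groupSubOne R (e s) ^ b s) =
        l.map fun s => groupSubOne R (e s) ^ b' s :=
      List.map_congr_left fun r hr => by rw [h r hr]
    rw [e1]
    by_cases hab : a = ⟨b', hb'⟩
    · subst hab
      rw [hC]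
      have e2 : (l.map fun s => b s * f s) = l.map fun s => b' s * f s :=
        List.map_congr_left fun r hr => by rw [h r hr]
      rw [e2] at hw
      have hlt : i * c < i' * c := by
        simp only at hi
        omega
      have hii : i + 1 ≤ i' := Nat.lt_of_mul_lt_mul_right hlt
      have h1 : Commute (π ^ i') r := Commute.pow_left (hπ r) i'
      rw [← h1.eq]
      exact Dvd.dvd.mul_right (pow_dvd_pow π hii) r
    · rw [hC' _ _ _ hab]; exact dvd_zero _

end Words

/-! ### Coordinates modulo powers of `p` -/

section AbelianCoordinates

open Finsupp

/-- In a `p`-torsion free abelian group, a basis modulo `p` is a basis modulo every power of `p`. -/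
theorem exists_coordinates_mod_pow {A ι : Type*} [AddCommGroup A] (p : ℕ) [Fact p.Prime] (e : ι → A)
    (htf : ∀ x : A, (p : ℤ) • x = 0 → x = 0)
    (hspan : ∀ x : A, ∃ (c : ι →₀ ℤ) (y : A), x = linearCombination ℤ e c + (p : ℤ) • y)
    (hind : ∀ (c : ι →₀ ℤ) (y : A), linearCombination ℤ e c = (p : ℤ) • y → ∀ a, (p : ℤ) ∣ c a)
    (m : ℕ) :
    ∃ β : A → (ι →₀ ZMod (p ^ m)), (∀ x y, β (x + y) = β x + β y) ∧
      (∀ x, β x = 0 ↔ ∃ y, x = (p ^ m : ℤ) • y) ∧ ∀ a, β (e a) = single a 1 := by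
  -- the elements `e a` generate modulo `p ^ m`, and are independent modulo `p ^ m`
  have hspan' : ∀ (m : ℕ) (x : A), ∃ (c : ι →₀ ℤ) (y : A),
      x = linearCombination ℤ e c + (p ^ m : ℤ) • y := by
    intro m
    induction m with
    | zero => exact fun x => ⟨0, x, by simp⟩
    | succ m ih =>
      intro x
      obtain ⟨c, y, rfl⟩ := ih x
      obtain ⟨c', y', rfl⟩ := hspan y
      refine ⟨c + (p ^ m : ℤ) • c', y', ?_⟩
      rw [map_add, map_smul, smul_add, smul_smul, pow_succ, add_assoc]
  have hdiv : ∀ (k : ℤ) (c : ι →₀ ℤ), (∀ a, k ∣ c a) → ∃ c' : ι →₀ ℤ, c = k • c' := by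
    intro k c hc
    refine ⟨c.mapRange (fun x => x / k) (by simp), ?_⟩
    ext a
    simpa using (Int.mul_ediv_cancel' (hc a)).symm
  have hind' : ∀ (m : ℕ) (c : ι →₀ ℤ) (y : A),
      linearCombination ℤ e c = (p ^ m : ℤ) • y → ∀ a, (p ^ m : ℤ) ∣ c a := by
    intro m
    induction m with
    | zero => intro c y _ a; simp
    | succ m ih =>
      intro c y h a
      rw [pow_succ', mul_smul] at h
      obtain ⟨c', rfl⟩ := hdiv _ c (hind c _ h)
      rw [map_smul, ← sub_eq_zero, ← smul_sub] at h
      have := ih c' y (sub_eq_zero.1 (htf _ h)) a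
      rw [pow_succ', Finsupp.smul_apply, smul_eq_mul]
      exact mul_dvd_mul_left _ this
  choose c y hcy using hspan' m
  let r : (ι →₀ ℤ) → (ι →₀ ZMod (p ^ m)) := fun c => c.mapRange (Int.castRingHom _) (map_zero _)
  have hr : ∀ c c', r (c - c') = r c - r c' := fun c c' => by ext a; simp [r]
  have hr' : ∀ c c', r (c + c') = r c + r c' := fun c c' => by ext a; simp [r]
  have hr0 : ∀ c : ι →₀ ℤ, r c = 0 ↔ ∀ a, (p ^ m : ℤ) ∣ c a := by
    intro c
    rw [Finsupp.ext_iff]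
    refine forall_congr' fun a => ?_
    have := ZMod.intCast_zmod_eq_zero_iff_dvd (c a) (p ^ m)
    push_cast at this
    simpa [r] using this
  -- the coefficients of `x` modulo `p ^ m` do not depend on the representation
  have key : ∀ (x : A) (d : ι →₀ ℤ) (z : A), x = linearCombination ℤ e d + (p ^ m : ℤ) • z →
      r (c x) = r d := by
    intro x d z h
    rw [← sub_eq_zero, ← hr, hr0]
    refine hind' m _ (z - y x) ?_
    rw [map_sub, smul_sub, sub_eq_sub_iff_add_eq_add, ← hcy x, h]
    abel
  refine ⟨fun x => r (c x), fun x x' => ?_, fun x => ⟨fun h => ?_, ?_⟩, fun a => ?_⟩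
  · rw [← hr']
    refine key _ _ (y x + y x') ?_
    conv_lhs => rw [hcy x, hcy x']
    rw [map_add, smul_add]; abel
  · obtain ⟨c', hc'⟩ := hdiv _ _ ((hr0 _).1 h)
    refine ⟨linearCombination ℤ e c' + y x, ?_⟩
    conv_lhs => rw [hcy x, hc', map_smul]
    rw [smul_add]
  · rintro ⟨z, rfl⟩
    beta_reduce
    rw [key _ 0 z (by simp)]
    simp [r]
  · beta_reduce
    rw [key _ (single a 1) 0 (by simp)]
    simp [r]

end AbelianCoordinates

section SubgroupCoordinates

variable {H : Type*} [Group H] {U V : Subgroup H} {p : ℕ} [Fact p.Prime] {ι : Type*} {e : ι → H}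

/-- A basis of `U / U ^ p V` gives coordinates modulo `p ^ m` on `U`, whose kernel consists of the
`p ^ m`-th powers modulo `V`. -/
theorem IsBasisModPow.exists_coordinates (hVU : V ≤ U) [V.Normal] (hUV : ⁅U, U⁆ ≤ V)
    (htf : FactorTorsionFree U V) (he : IsBasisModPow p U V e) (m : ℕ) :
    ∃ β : H → (ι →₀ ZMod (p ^ m)), (∀ x ∈ U, ∀ y ∈ U, β (x * y) = β x + β y) ∧
      (∀ x ∈ U, β x = 0 ↔ ∃ w ∈ U, (w ^ p ^ m)⁻¹ * x ∈ V) ∧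
      ∀ a, β (e a) = Finsupp.single a 1 := by
  classical
  obtain ⟨heU, β₁, -, hker, hβe⟩ := he
  let Q := U ⧸ V.subgroupOf U
  have hQ : ∀ x y : Q, x * y = y * x := by
    intro x y
    induction x using QuotientGroup.induction_on with
    | H x =>
      induction y using QuotientGroup.induction_on with
      | H y =>
        rw [← QuotientGroup.mk_mul, ← QuotientGroup.mk_mul, eq_comm, QuotientGroup.eq,
          Subgroup.mem_subgroupOf]
        have := hUV (Subgroup.commutator_mem_commutator (inv_mem x.2) (inv_mem y.2))
        rw [commutatorElement_def] at this
        simpa [mul_assoc] using this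
  let _ : CommGroup Q := { (inferInstance : Group Q) with mul_comm := hQ }
  let A := Additive Q
  let mk : U → A := fun u => Additive.ofMul (QuotientGroup.mk u)
  have hmk_mul : ∀ u v, mk (u * v) = mk u + mk v := fun _ _ => rfl
  have hmk_surj : ∀ x : A, ∃ u, mk u = x := fun x =>
    QuotientGroup.mk_surjective (s := V.subgroupOf U) x.toMul
  have hmk_zpow : ∀ (u : U) (k : ℤ), mk (u ^ k) = k • mk u := fun _ _ => rfl
  have hmk_zero : ∀ u : U, mk u = 0 ↔ (u : H) ∈ V := fun u =>
    (QuotientGroup.eq_one_iff (N := V.subgroupOf U) u).trans Subgroup.mem_subgroupOf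
  have hβV : ∀ u : U, (u : H) ∈ V → β₁ u = 1 := fun u hu => (hker u).2 (Subgroup.mem_sup_right hu)
  let β₂ : A →+ (ι →₀ ZMod p) := MonoidHom.toAdditiveLeft
    (QuotientGroup.lift (V.subgroupOf U) β₁ fun u hu => hβV u (Subgroup.mem_subgroupOf.1 hu))
  have hβ₂ : ∀ u, β₂ (mk u) = (β₁ u).toAdd := fun u => rfl
  have hβe' : ∀ a, β₂ (mk ⟨e a, heU a⟩) = Finsupp.single a 1 := fun a => by rw [hβ₂, hβe]; rfl
  have hlin : ∀ c : ι →₀ ℤ, β₂ (Finsupp.linearCombination ℤ (fun a => mk ⟨e a, heU a⟩) c) =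
      c.mapRange (Int.castRingHom (ZMod p)) (map_zero _) := by
    intro c
    induction c using Finsupp.induction_linear with
    | zero => simp
    | add a b ha hb => rw [map_add, map_add, ha, hb, Finsupp.mapRange_add (by simp)]
    | single a k =>
      rw [Finsupp.linearCombination_single, map_zsmul, hβe']
      simp
  have hpow : ∀ u : U, β₁ u = 1 → ∃ y, mk u = (p : ℤ) • y := by
    intro u hu
    have h1 := (hker u).1 hu
    let B : Subgroup U :=
      { carrier := {u | ∃ y, mk u = (p : ℤ) • y}
        one_mem' := ⟨0, by rw [smul_zero]; rfl⟩
        mul_mem' := by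
          rintro a b ⟨y, hy⟩ ⟨z, hz⟩
          exact ⟨y + z, by rw [hmk_mul, hy, hz, smul_add]⟩
        inv_mem' := by
          rintro a ⟨y, hy⟩
          refine ⟨-y, ?_⟩
          have : mk a⁻¹ = -mk a := rfl
          rw [this, hy, smul_neg] }
    have h2 : Subgroup.closure {y | ∃ x ∈ U, y = x ^ p} ⊔ V ≤ B.map U.subtype := by
      refine sup_le ((Subgroup.closure_le _).2 ?_) ?_
      · rintro _ ⟨x, hx, rfl⟩
        refine ⟨⟨x, hx⟩ ^ p, ⟨mk ⟨x, hx⟩, ?_⟩, rfl⟩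
        rw [← hmk_zpow, zpow_natCast]
      · intro v hv
        exact ⟨⟨v, hVU hv⟩, ⟨0, by rw [smul_zero]; exact (hmk_zero _).2 hv⟩, rfl⟩
    obtain ⟨u', hu', h3⟩ := h2 h1
    have : u' = u := Subtype.ext h3
    rw [← this]; exact hu'
  obtain ⟨β, hadd, hzero, hsingle⟩ := exists_coordinates_mod_pow p
    (fun a => mk ⟨e a, heU a⟩) (fun x hx => by
      obtain ⟨u, rfl⟩ := hmk_surj x
      rw [← hmk_zpow, zpow_natCast, hmk_zero] at hx
      rw [hmk_zero]
      exact htf u u.2 p (Fact.out : p.Prime).pos hx)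
    (fun x => by
      obtain ⟨u, rfl⟩ := hmk_surj x
      let c : ι →₀ ℤ := (β₂ (mk u)).mapRange (fun z => (z.val : ℤ)) (by simp)
      obtain ⟨w, hw⟩ := hmk_surj (mk u - Finsupp.linearCombination ℤ (fun a => mk ⟨e a, heU a⟩) c)
      obtain ⟨y, hy⟩ := hpow w (by
        have h1 : β₂ (mk w) = 0 := by
          rw [hw, map_sub, hlin, sub_eq_zero]
          ext a
          simp [c]
        rw [hβ₂] at h1
        exact h1)
      refine ⟨c, y, ?_⟩
      rw [← hy, hw]; abel)
    (fun c y h a => by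
      have h1 := congrArg β₂ h
      rw [hlin, map_zsmul] at h1
      have h2 := DFunLike.congr_fun h1 a
      rw [← ZMod.intCast_zmod_eq_zero_iff_dvd]
      simpa using h2) m
  refine ⟨fun h => if hh : h ∈ U then β (mk ⟨h, hh⟩) else 0, fun x hx y hy => ?_, fun x hx => ?_,
    fun a => ?_⟩
  · beta_reduce
    rw [dif_pos hx, dif_pos hy, dif_pos (mul_mem hx hy), ← hadd]; rfl
  · beta_reduce
    rw [dif_pos hx, hzero]
    constructor
    · rintro ⟨y, hy⟩
      obtain ⟨w, rfl⟩ := hmk_surj y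
      refine ⟨w, w.2, ?_⟩
      have h1 : mk ((w ^ p ^ m)⁻¹ * ⟨x, hx⟩) = 0 := by
        have e1 : mk (w ^ p ^ m)⁻¹ = -((p ^ m : ℤ) • mk w) := by
          have := hmk_zpow w ((p ^ m : ℕ) : ℤ)
          rw [zpow_natCast] at this
          push_cast at this
          rw [← this]; rfl
        rw [hmk_mul, e1, hy, neg_add_cancel]
      exact (hmk_zero _).1 h1
    · rintro ⟨w, hw, h⟩
      refine ⟨mk ⟨w, hw⟩, ?_⟩
      have h1 : mk ((⟨w, hw⟩ ^ p ^ m)⁻¹ * ⟨x, hx⟩) = 0 := (hmk_zero _).2 h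
      have e1 : mk (⟨w, hw⟩ ^ p ^ m)⁻¹ = -((p ^ m : ℤ) • mk ⟨w, hw⟩) := by
        have := hmk_zpow ⟨w, hw⟩ ((p ^ m : ℕ) : ℤ)
        rw [zpow_natCast] at this
        push_cast at this
        rw [← this]; rfl
      rw [hmk_mul, e1, neg_add_eq_zero] at h1
      exact h1.symm
  · beta_reduce
    rw [dif_pos (heU a), hsingle]

end SubgroupCoordinates

/-! ### Subgroups of large `p`-power index -/

section Powers

theorem Subgroup.normal_of_commutator_mem {G : Type*} [Group G] {V : Subgroup G}
    (h : ∀ x ∈ V, ∀ g, ⁅x, g⁆ ∈ V) : V.Normal := ⟨fun x hx g => by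
  have h1 := mul_mem (inv_mem (h x hx g)) hx
  rw [commutatorElement_def] at h1
  have e : (x * g * x⁻¹ * g⁻¹)⁻¹ * x = g * x * g⁻¹ := by group
  rwa [e] at h1⟩

/-- If the commutator `c` of `x` and `g` is central, then the commutator of `x ^ k` and `g` is
`c ^ k`. -/
theorem pow_mul_eq_of_mul_eq {Q : Type*} [Group Q] {x g c : Q} (hc : ∀ y, Commute c y)
    (h : x * g = c * (g * x)) (k : ℕ) : x ^ k * g = c ^ k * (g * x ^ k) := by
  induction k with
  | zero => simp
  | succ k ih =>
    rw [pow_succ, mul_assoc, h, ← mul_assoc, ((hc (x ^ k)).eq).symm, mul_assoc, ← mul_assoc (x ^ k),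
      ih, pow_succ' c]
    simp only [mul_assoc]

/-- If the commutator `c` of `y` and `x` is central, then `x * y` is raised to powers with the
correction `c ^ (k choose 2)`. -/
theorem mul_pow_eq_of_mul_eq {Q : Type*} [Group Q] {x y c : Q} (hc : ∀ z, Commute c z)
    (h : y * x = c * (x * y)) (k : ℕ) : (x * y) ^ k = c ^ k.choose 2 * (x ^ k * y ^ k) := by
  induction k with
  | zero => simp
  | succ k ih =>
    have e1 : (k + 1).choose 2 = k.choose 2 + k := by
      rw [Nat.choose_succ_succ' k 1, Nat.choose_one_right, add_comm]
    have e2 := pow_mul_eq_of_mul_eq hc h k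
    have e3 : x ^ k * c ^ k = c ^ k * x ^ k := ((hc (x ^ k)).pow_left k).eq.symm
    calc (x * y) ^ (k + 1) = c ^ k.choose 2 * (x ^ k * (y ^ k * x) * y) := by
          rw [pow_succ, ih]; simp only [mul_assoc]
      _ = c ^ k.choose 2 * ((x ^ k * c ^ k) * (x * y ^ k) * y) := by
          rw [e2]; simp only [mul_assoc]
      _ = c ^ (k + 1).choose 2 * (x ^ (k + 1) * y ^ (k + 1)) := by
          rw [e3, e1, pow_add, pow_succ, pow_succ]; simp only [mul_assoc]

theorem pow_dvd_choose_two {p : ℕ} (hp : p.Prime) (q : ℕ) : p ^ q ∣ (p ^ (q + 1)).choose 2 := by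
  have hpar : 2 ∣ p * (p ^ (q + 1) - 1) := by
    rcases hp.eq_two_or_odd' with rfl | hodd
    · exact dvd_mul_right _ _
    · refine Dvd.dvd.mul_left (even_iff_two_dvd.1 ?_) _
      exact (hodd.pow).tsub_odd odd_one
  obtain ⟨t, ht⟩ := hpar
  refine ⟨t, ?_⟩
  rw [Nat.choose_two_right, pow_succ, mul_assoc, ← pow_succ, ht]
  rw [mul_left_comm, Nat.mul_div_cancel_left _ (by norm_num)]

/-- Let `V` be a descending series with central factors such that `p ^ q`-th powers of elements of
`V 0` lie in every `V s`.  On a subgroup `W` which is central modulo `V 0`, taking powers with a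
sufficiently high power of `p` is multiplicative modulo `V s`. -/
theorem mul_pow_mem_of_central_series {G : Type*} [Group G] {p : ℕ} (hp : p.Prime) {q : ℕ}
    {V : ℕ → Subgroup G} (hV : ∀ s, ∀ x ∈ V s, ∀ g, ⁅x, g⁆ ∈ V (s + 1))
    (hanti : ∀ s, V (s + 1) ≤ V s) (hexp : ∀ x ∈ V 0, ∀ s, x ^ p ^ q ∈ V s) {W : Subgroup G}
    (hW : ∀ x ∈ W, ∀ g, ⁅x, g⁆ ∈ V 0) (s : ℕ) :
    (∀ x ∈ W, ∀ g, ⁅x ^ p ^ ((q + 1) * s), g⁆ ∈ V s) ∧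
      ∀ x ∈ W, ∀ y ∈ W, ((x * y) ^ p ^ ((q + 1) * s))⁻¹ *
        (x ^ p ^ ((q + 1) * s) * y ^ p ^ ((q + 1) * s)) ∈ V s := by
  have hnorm : ∀ s, (V s).Normal := fun s =>
    Subgroup.normal_of_commutator_mem fun x hx g => hanti s (hV s x hx g)
  have hV0 : ∀ s, V s ≤ V 0 := fun s => by
    induction s with
    | zero => exact le_rfl
    | succ s ih => exact (hanti s).trans ih
  -- modulo `V (s + 1)` the commutators in question are central of exponent `p ^ q`
  induction s with
  | zero =>
    refine ⟨fun x hx g => by simpa using hW x hx g, fun x _ y _ => by simp⟩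
  | succ s ih =>
    obtain ⟨ih1, ih2⟩ := ih
    have := hnorm (s + 1)
    let φ : G →* G ⧸ V (s + 1) := QuotientGroup.mk' _
    have hφ : ∀ x, φ x = 1 ↔ x ∈ V (s + 1) := fun x => QuotientGroup.eq_one_iff x
    have hφs : Function.Surjective φ := QuotientGroup.mk'_surjective _
    have hcen : ∀ v ∈ V s, ∀ z, Commute (φ v) z := by
      intro v hv z
      obtain ⟨g, rfl⟩ := hφs z
      rw [← commutatorElement_eq_one_iff_commute, ← map_commutatorElement, hφ]
      exact hV s v hv g
    have hone : ∀ v ∈ V s, φ v ^ p ^ q = 1 := fun v hv => by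
      rw [← map_pow, hφ]; exact hexp v (hV0 s hv) _
    have hone' : ∀ v ∈ V s, φ v ^ p ^ (q + 1) = 1 := fun v hv => by
      rw [pow_succ, pow_mul, hone v hv, one_pow]
    have epow : ∀ z : G ⧸ V (s + 1), z ^ p ^ ((q + 1) * (s + 1)) =
        (z ^ p ^ ((q + 1) * s)) ^ p ^ (q + 1) := fun z => by
      rw [← pow_mul, ← pow_add]; rfl
    have hcomm : ∀ x y : G, φ x * φ y = φ ⁅x, y⁆ * (φ y * φ x) := fun x y => by
      rw [← map_mul, ← map_mul, ← map_mul]; congr 1; rw [commutatorElement_def]; group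
    refine ⟨fun x hx g => ?_, fun x hx y hy => ?_⟩
    · have h1 := pow_mul_eq_of_mul_eq (hcen _ (ih1 x hx g)) (hcomm (x ^ p ^ ((q + 1) * s)) g)
        (p ^ (q + 1))
      rw [hone' _ (ih1 x hx g), one_mul, map_pow, ← epow] at h1
      rw [← hφ, map_commutatorElement, commutatorElement_eq_one_iff_mul_comm, map_pow]
      exact h1
    · have h1 := mul_pow_eq_of_mul_eq (hcen _ (ih1 y hy (x ^ p ^ ((q + 1) * s))))
        (hcomm (y ^ p ^ ((q + 1) * s)) (x ^ p ^ ((q + 1) * s))) (p ^ (q + 1))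
      obtain ⟨t, ht⟩ := pow_dvd_choose_two hp q
      have hch : ∀ v ∈ V s, φ v ^ (p ^ (q + 1)).choose 2 = 1 := fun v hv => by
        rw [ht, pow_mul, hone v hv, one_pow]
      rw [hch _ (ih1 y hy _), one_mul] at h1
      have h2 := ih2 x hx y hy
      have h3 : φ (x ^ p ^ ((q + 1) * s)) * φ (y ^ p ^ ((q + 1) * s)) =
          φ ((x * y) ^ p ^ ((q + 1) * s)) * φ (((x * y) ^ p ^ ((q + 1) * s))⁻¹ *
            (x ^ p ^ ((q + 1) * s) * y ^ p ^ ((q + 1) * s))) := by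
        rw [← map_mul, ← map_mul]; congr 1; group
      rw [h3, ((hcen _ h2 _).symm).mul_pow, hone' _ h2, mul_one, map_pow, map_pow, map_pow,
        ← epow, ← epow, ← epow] at h1
      rw [← hφ, map_mul, map_inv, map_mul, map_pow, map_pow, map_pow, inv_mul_eq_one]
      exact h1

end Powers

section CongruenceSubgroup

variable {H : Type*} [Group H]

/-- For a central series with torsion free factors there are normal subgroups `N` which meet each
factor `U k / U (k + 1)` in the subgroup of `p ^ m k`-th powers, with exponents as large as desired,
and which contain the `p ^ m k`-th powers of the elements of `U k`. -/
theorem exists_congruence_subgroup {p : ℕ} (hp : p.Prime) {U : ℕ → Subgroup H} {n : ℕ}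
    (hanti : Antitone U) (hbot : U n = ⊥) (hcen : ∀ k, ∀ x ∈ U k, ∀ g, ⁅x, g⁆ ∈ U (k + 1))
    (htf : ∀ k, FactorTorsionFree (U k) (U (k + 1))) (L : ℕ) :
    ∃ (N : Subgroup H) (m : ℕ → ℕ), N.Normal ∧ (∀ k, L ≤ m k) ∧
      (∀ k, ∀ u ∈ U k, u ^ p ^ m k ∈ N) ∧
      ∀ k, ∀ x ∈ N, x ∈ U k → ∃ u ∈ U k, (u ^ p ^ m k)⁻¹ * x ∈ U (k + 1) := by
  have hnormal : ∀ k, (U k).Normal := fun k =>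
    Subgroup.normal_of_commutator_mem fun x hx g => hanti (Nat.le_succ k) (hcen k x hx g)
  -- construction from the bottom of the series upwards: `N` is found in `U (n - d)`
  have main : ∀ d, d ≤ n → ∃ (N : Subgroup H) (m : ℕ → ℕ), N.Normal ∧ N ≤ U (n - d) ∧
      (∀ k, L ≤ m k) ∧ (∀ k, n - d ≤ k → ∀ u ∈ U k, u ^ p ^ m k ∈ N) ∧
      ∀ k, n - d ≤ k → ∀ x ∈ N, x ∈ U k → ∃ u ∈ U k, (u ^ p ^ m k)⁻¹ * x ∈ U (k + 1) := by
    intro d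
    induction d with
    | zero =>
      intro _
      refine ⟨⊥, fun _ => L, inferInstance, bot_le, fun _ => le_rfl, fun k hk u hu => ?_,
        fun k hk x hx _ => ⟨1, one_mem _, ?_⟩⟩
      · have : u ∈ U n := hanti hk hu
        rw [hbot] at this
        rw [Subgroup.mem_bot.1 this, one_pow]; exact one_mem _
      · rw [Subgroup.mem_bot.1 hx]; simp
    | succ d ih =>
      intro hd
      obtain ⟨N, m, hN, hNU, hmL, hpow, hcap⟩ := ih (by omega)
      obtain ⟨k, hk⟩ : ∃ k, n - (d + 1) = k := ⟨_, rfl⟩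
      have hk1 : n - d = k + 1 := by omega
      rw [hk1] at hNU hpow hcap
      rw [hk]
      let q := m (k + 1)
      -- modulo `N` the series below `U k` has at most `n` further steps, each of which requires the
      -- exponent `q + 1`, until taking `p ^ M`-th powers is multiplicative on `U k`; the summand `L`
      -- makes the exponent large
      let M := (q + 1) * (n + L + 1)
      have hML : L ≤ M := by
        have : 1 * (n + L + 1) ≤ (q + 1) * (n + L + 1) := Nat.mul_le_mul_right _ (by omega)
        omega
      have hMq : q ≤ M := by
        have : (q + 1) * 1 ≤ (q + 1) * (n + L + 1) := Nat.mul_le_mul_left _ (by omega)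
        omega
      have hMN : ∀ u ∈ U (k + 1), u ^ p ^ M ∈ N := fun u hu => by
        obtain ⟨r, hr⟩ := Nat.exists_eq_add_of_le hMq
        rw [hr, pow_add, pow_mul]
        exact pow_mem (hpow (k + 1) le_rfl u hu) _
      have hmul : ∀ x ∈ U k, ∀ y ∈ U k, ((x * y) ^ p ^ M)⁻¹ * (x ^ p ^ M * y ^ p ^ M) ∈ N := by
        have h1 := (mul_pow_mem_of_central_series hp (q := q)
          (V := fun s => U (k + 1 + s) ⊔ N) (W := U k) ?_ ?_ ?_ ?_ (n + L + 1)).2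
        · have e : U (k + 1 + (n + L + 1)) ⊔ N = N := by
            rw [sup_eq_right]
            refine (hanti (by omega : n ≤ k + 1 + (n + L + 1))).trans ?_
            rw [hbot]; exact bot_le
          simp only [e] at h1
          exact h1
        · intro s x hx g
          have h2 : ⁅U (k + 1 + s) ⊔ N, (⊤ : Subgroup H)⁆ ≤ U (k + 1 + (s + 1)) ⊔ N := by
            have := hnormal (k + 1 + s)
            have := hnormal (k + 1 + (s + 1))
            rw [Subgroup.commutator_le]
            intro a ha b _
            obtain ⟨y, hy, z, hz, rfl⟩ := Subgroup.mem_sup_of_normal_right.1 ha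
            have e : ⁅y * z, b⁆ = y * ⁅z, b⁆ * y⁻¹ * ⁅y, b⁆ := by
              simp only [commutatorElement_def]; group
            rw [e]
            refine mul_mem (Subgroup.mem_sup_right (hN.conj_mem _ ?_ y))
              (Subgroup.mem_sup_left (hcen _ y hy b))
            rw [commutatorElement_def, mul_assoc, mul_assoc, ← mul_assoc b]
            exact mul_mem hz (hN.conj_mem _ (inv_mem hz) b)
          exact h2 (Subgroup.commutator_mem_commutator hx trivial)
        · exact fun s => sup_le_sup_right (hanti (by omega)) N
        · intro x hx s
          refine Subgroup.mem_sup_right (hpow (k + 1) le_rfl x ?_)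
          exact (sup_le le_rfl hNU) hx
        · exact fun x hx g => Subgroup.mem_sup_left (hcen k x hx g)
      -- the new subgroup consists of the `p ^ M`-th powers of elements of `U k`, modulo `N`
      let N' : Subgroup H :=
        { carrier := {x | ∃ u ∈ U k, (u ^ p ^ M)⁻¹ * x ∈ N}
          one_mem' := ⟨1, one_mem _, by simp⟩
          mul_mem' := by
            rintro x y ⟨u, hu, hx⟩ ⟨w, hw, hy⟩
            refine ⟨u * w, mul_mem hu hw, ?_⟩
            have h1 := mul_mem (mul_mem (hmul u hu w hw) (hN.conj_mem' _ hx (w ^ p ^ M))) hy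
            convert h1 using 1
            group
          inv_mem' := by
            rintro x ⟨u, hu, hx⟩
            refine ⟨u⁻¹, inv_mem hu, ?_⟩
            have h1 := hN.conj_mem _ (inv_mem hx) (u ^ p ^ M)
            convert h1 using 1
            rw [inv_pow]; group }
      have hN' : N'.Normal := ⟨by
        rintro x ⟨u, hu, hx⟩ g
        refine ⟨g * u * g⁻¹, (hnormal k).conj_mem u hu g, ?_⟩
        have h1 := hN.conj_mem _ hx g
        convert h1 using 1
        rw [conj_pow]; group⟩
      have hNN' : N ≤ N' := fun x hx => ⟨1, one_mem _, by simpa using hx⟩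
      refine ⟨N', Function.update m k M, hN', ?_, fun j => ?_, fun j hj u hu => ?_,
        fun j hj x hx hxj => ?_⟩
      · rintro x ⟨u, hu, hx⟩
        have := mul_mem (pow_mem hu (p ^ M)) (hanti (Nat.le_succ k) (hNU hx))
        simpa using this
      · rcases eq_or_ne j k with rfl | h
        · simpa using hML
        · simpa [h] using hmL j
      · rcases eq_or_ne j k with rfl | h
        · rw [Function.update_self]
          exact ⟨u, hu, by simp⟩
        · rw [Function.update_of_ne h]
          exact hNN' (hpow j (by omega) u hu)
      · rcases eq_or_ne j k with rfl | h
        · rw [Function.update_self]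
          obtain ⟨u, hu, hx⟩ := hx
          exact ⟨u, hu, hNU hx⟩
        · rw [Function.update_of_ne h]
          refine hcap j (by omega) x ?_ hxj
          obtain ⟨u, hu, hx⟩ := hx
          have hu1 : u ^ p ^ M ∈ U (k + 1) := by
            have h1 := mul_mem (hanti (by omega : k + 1 ≤ j) hxj) (inv_mem (hNU hx))
            convert h1 using 1
            group
          have hu2 := htf k u hu _ (pow_pos hp.pos M) hu1
          have := mul_mem (hMN u hu2) hx
          simpa using this
  obtain ⟨N, m, h1, -, h3, h4, h5⟩ := main n le_rfl
  exact ⟨N, m, h1, h3, fun k => h4 k (by omega), fun k => h5 k (by omega)⟩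

end CongruenceSubgroup

/-! ### Normal forms in a group with coordinates along a central series -/

section CoordSystem

/-- A finite central series `Γ` of `G` together with elements `e s` of `Γ (lv s)` and coordinates
`χ s`, additive on `Γ (lv s)` with values modulo `q s = p ^ m s`, which for each `k` identify the
factor `Γ k / Γ (k + 1)` with a direct sum of cyclic groups generated by the classes of the `e s` with
`lv s = k`. -/
structure CoordSystem (p : ℕ) (G σ : Type*) [Group G] [LinearOrder σ] where
  lv : σ → ℕ
  mono : Monotone lv
  m : σ → ℕ
  one_lt : ∀ s, 1 < p ^ m s
  Γ : ℕ → Subgroup G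
  n : ℕ
  anti : Antitone Γ
  top : Γ 0 = ⊤
  bot : Γ n = ⊥
  central : ∀ k, ∀ x ∈ Γ k, ∀ g, ⁅x, g⁆ ∈ Γ (k + 1)
  e : σ → G
  e_mem : ∀ s, e s ∈ Γ (lv s)
  χ : ∀ s, G → ZMod (p ^ m s)
  e_pow : ∀ s, e s ^ p ^ m s = 1
  isPGroup : IsPGroup p G
  χ_mul : ∀ s, ∀ x ∈ Γ (lv s), ∀ y ∈ Γ (lv s), χ s (x * y) = χ s x + χ s y
  χ_self : ∀ s, χ s (e s) = 1
  χ_ne : ∀ s t, lv s = lv t → s ≠ t → χ s (e t) = 0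
  finite : ∀ k, ∀ x ∈ Γ k, {s | lv s = k ∧ χ s x ≠ 0}.Finite
  χ_succ : ∀ s, ∀ x ∈ Γ (lv s + 1), χ s x = 0
  mem_succ : ∀ k, ∀ x ∈ Γ k, (∀ s, lv s = k → χ s x = 0) → x ∈ Γ (k + 1)

namespace CoordSystem

variable {p : ℕ} {G σ : Type*} [Group G] [LinearOrder σ] (S : CoordSystem p G σ)

/-- The order of `e s` modulo `Γ (lv s + 1)`. -/
abbrev q (s : σ) : ℕ := p ^ S.m s

theorem q_pos (s : σ) : 0 < S.q s := zero_lt_one.trans (S.one_lt s)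

theorem χ_one (s : σ) : S.χ s 1 = 0 := S.χ_succ s 1 (one_mem _)

theorem χ_pow (s : σ) {x : G} (hx : x ∈ S.Γ (S.lv s)) (k : ℕ) : S.χ s (x ^ k) = k * S.χ s x := by
  induction k with
  | zero => simp [S.χ_one]
  | succ k ih => rw [pow_succ, S.χ_mul s _ (pow_mem hx k) _ hx, ih]; push_cast; ring

theorem χ_inv (s : σ) {x : G} (hx : x ∈ S.Γ (S.lv s)) : S.χ s x⁻¹ = - S.χ s x := by
  have h := S.χ_mul s _ (inv_mem hx) _ hx
  rw [inv_mul_cancel, S.χ_one] at h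
  exact (neg_eq_of_add_eq_zero_left h.symm).symm

theorem normal (k : ℕ) : (S.Γ k).Normal :=
  Subgroup.normal_of_commutator_mem fun x hx g => S.anti (Nat.le_succ k) (S.central k x hx g)

/-- The ordered product of the powers `e s ^ c s`. -/
noncomputable def nf (c : σ →₀ ℕ) : G := ((c.support.sort (· ≤ ·)).map fun s => S.e s ^ c s).prod

/-- The exponents `c s` are less than `q s`. -/
def Reduced (c : σ →₀ ℕ) : Prop := ∀ s, c s < S.q s

theorem prod_map_filter_of_eq_one {α M : Type*} [Monoid M] (g : α → M) (P : α → Prop)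
    [DecidablePred P] (l : List α) (h : ∀ x ∈ l, ¬ P x → g x = 1) :
    ((l.filter P).map g).prod = (l.map g).prod := by
  induction l with
  | nil => simp
  | cons a l ih =>
    have ih' := ih fun x hx => h x (by simp [hx])
    by_cases ha : P a
    · simp [ha, ih']
    · simp [ha, ih', h a (by simp) ha]

theorem prod_map_pow_eq_nf {l : List σ} (hl : l.Pairwise (· < ·)) {c : σ →₀ ℕ}
    (hc : ∀ s ∈ c.support, s ∈ l) : (l.map fun s => S.e s ^ c s).prod = S.nf c := by
  classical
  unfold nf
  rw [← prod_map_filter_of_eq_one (fun s => S.e s ^ c s) (fun s => s ∈ c.support) l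
    (fun s _ hs => by simp [Finsupp.notMem_support_iff.1 hs])]
  have : l.filter (fun s => s ∈ c.support) = c.support.sort (· ≤ ·) := by
    refine List.Perm.eq_of_pairwise' (r := (· < ·)) (hl.filter _) (Finset.sortedLT_sort _).pairwise ?_
    refine (List.perm_ext_iff_of_nodup ((hl.imp fun h => ne_of_lt h).filter _)
      (Finset.sort_nodup _ _)).2 fun s => ?_
    simp only [List.mem_filter, Finset.mem_sort, decide_eq_true_eq]
    exact ⟨fun h => h.2, fun h => ⟨hc s h, h⟩⟩
  rw [this]

theorem nf_zero : S.nf 0 = 1 := by simp [nf]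

theorem nf_single (s : σ) (k : ℕ) : S.nf (Finsupp.single s k) = S.e s ^ k := by
  rw [← S.prod_map_pow_eq_nf (l := [s]) (by simp) (fun t ht => by
    simpa using Finsupp.support_single_subset ht)]
  simp

theorem nf_add {c d : σ →₀ ℕ} (h : ∀ s ∈ c.support, ∀ t ∈ d.support, s < t) :
    S.nf (c + d) = S.nf c * S.nf d := by
  have hl : (c.support.sort (· ≤ ·) ++ d.support.sort (· ≤ ·)).Pairwise (· < ·) := by
    rw [List.pairwise_append]
    exact ⟨(Finset.sortedLT_sort _).pairwise, (Finset.sortedLT_sort _).pairwise,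
      fun s hs t ht => h s (by simpa using hs) t (by simpa using ht)⟩
  rw [← S.prod_map_pow_eq_nf hl (fun s hs => by
    have := Finsupp.support_add hs
    simpa [-Finsupp.mem_support_iff] using this), List.map_append, List.prod_append]
  unfold nf
  congr 2
  · refine List.map_congr_left fun s hs => ?_
    have hs' : s ∈ c.support := by simpa using hs
    have : d s = 0 := by
      by_contra hd
      exact lt_irrefl s (h s hs' s (Finsupp.mem_support_iff.2 hd))
    rw [Finsupp.add_apply, this, add_zero]
  · refine List.map_congr_left fun s hs => ?_
    have hs' : s ∈ d.support := by simpa using hs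
    have : c s = 0 := by
      by_contra hd
      exact lt_irrefl s (h s (Finsupp.mem_support_iff.2 hd) s hs')
    rw [Finsupp.add_apply, this, zero_add]

/-- A normal form without factors of level less than `k` lies in `Γ k`, and its exponents of level
`k` are its coordinates there. -/
theorem nf_mem_and_χ (k : ℕ) (c : σ →₀ ℕ) (hc : ∀ s, S.lv s < k → c s = 0) :
    S.nf c ∈ S.Γ k ∧ ∀ s, S.lv s = k → S.χ s (S.nf c) = c s := by
  have main : ∀ l : List σ, l.Nodup → (l.map fun s => S.e s ^ c s).prod ∈ S.Γ k ∧
      ∀ s, S.lv s = k → S.χ s (l.map fun s => S.e s ^ c s).prod = if s ∈ l then (c s : ZMod (S.q s))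
        else 0 := by
    intro l hl
    induction l with
    | nil => exact ⟨by simp, fun s _ => by simp [S.χ_one]⟩
    | cons t l ih =>
      rw [List.nodup_cons] at hl
      obtain ⟨ih1, ih2⟩ := ih hl.2
      have ht : S.e t ^ c t ∈ S.Γ k := by
        by_cases h : S.lv t < k
        · rw [hc t h, pow_zero]; exact one_mem _
        · exact pow_mem (S.anti (not_lt.1 h) (S.e_mem t)) _
      rw [List.map_cons, List.prod_cons]
      refine ⟨mul_mem ht ih1, fun s hs => ?_⟩
      subst hs
      rw [S.χ_mul s _ ht _ ih1, ih2 s rfl]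
      by_cases hts : s = t
      · subst hts
        rw [if_neg hl.1, S.χ_pow s (S.e_mem s), S.χ_self]
        simp
      · have : S.χ s (S.e t ^ c t) = 0 := by
          rcases lt_trichotomy (S.lv t) (S.lv s) with h | h | h
          · rw [hc t h, pow_zero, S.χ_one]
          · rw [S.χ_pow s (h ▸ S.e_mem t), S.χ_ne s t h.symm hts, mul_zero]
          · exact S.χ_succ s _ (S.anti h (pow_mem (S.e_mem t) _))
        rw [this, zero_add]
        simp [hts]
  obtain ⟨h1, h2⟩ := main (c.support.sort (· ≤ ·)) (Finset.sort_nodup _ _)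
  refine ⟨h1, fun s hs => ?_⟩
  rw [nf, h2 s hs]
  by_cases h : c s = 0 <;> simp [h]

/-- Splitting a normal form at a given level. -/
theorem nf_split (k : ℕ) (c : σ →₀ ℕ) :
    S.nf c = S.nf (c.filter fun s => S.lv s < k) * S.nf (c.filter fun s => ¬ S.lv s < k) := by
  rw [← S.nf_add, Finsupp.filter_add_filter_not]
  intro s hs t ht
  simp only [Finsupp.support_filter, Finset.mem_filter] at hs ht
  exact S.mono.reflect_lt (by omega)

/-- The exponents of a reduced normal form are determined level by level, as coordinates of what
remains after splitting off the lower levels. -/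
theorem nf_injective {c d : σ →₀ ℕ} (hc : S.Reduced c) (hd : S.Reduced d)
    (h : S.nf c = S.nf d) : c = d := by
  have main : ∀ k, ∀ s, S.lv s < k → c s = d s := by
    intro k
    induction k with
    | zero => exact fun s hs => absurd hs (Nat.not_lt_zero _)
    | succ k ih =>
      intro s hs
      rcases Nat.lt_succ_iff_lt_or_eq.1 hs with h' | h'
      · exact ih s h'
      · have e : c.filter (fun s => S.lv s < k) = d.filter (fun s => S.lv s < k) := by
          ext t
          rw [Finsupp.filter_apply, Finsupp.filter_apply]
          split_ifs with ht
          · exact ih t ht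
          · rfl
        rw [S.nf_split k c, S.nf_split k d, e, mul_right_inj] at h
        have key : ∀ c : σ →₀ ℕ, S.χ s (S.nf (c.filter fun s => ¬ S.lv s < k)) = c s := by
          intro c
          rw [(S.nf_mem_and_χ k (c.filter fun s => ¬ S.lv s < k)
            (fun t ht => Finsupp.filter_apply_neg _ _ (by simpa using ht))).2 s h',
            Finsupp.filter_apply_pos _ _ (by omega)]
        have h1 := key c
        rw [h, key d] at h1
        rw [ZMod.natCast_eq_natCast_iff', Nat.mod_eq_of_lt (hd s), Nat.mod_eq_of_lt (hc s)] at h1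
        exact h1.symm
  ext s
  exact main _ s (Nat.lt_succ_self _)

/-- The element `x` of `Γ k` agrees modulo `Γ (k + 1)` with the normal form given by its
coordinates. -/
theorem exists_nf_mul (k : ℕ) {x : G} (hx : x ∈ S.Γ k) :
    ∃ c : σ →₀ ℕ, S.Reduced c ∧ (∀ s, c s ≠ 0 → S.lv s = k ∧ S.χ s x ≠ 0) ∧
      (S.nf c)⁻¹ * x ∈ S.Γ (k + 1) := by
  classical
  have hq : ∀ s, NeZero (S.q s) := fun s => ⟨(S.q_pos s).ne'⟩
  let c : σ →₀ ℕ := Finsupp.ofSupportFinite (fun s => if S.lv s = k then (S.χ s x).val else 0) (by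
    refine (S.finite k x hx).subset fun s hs => ?_
    simp only [Function.mem_support, ne_eq, ite_eq_right_iff, ZMod.val_eq_zero,
      Classical.not_imp] at hs
    exact hs)
  have hcs : ∀ s, c s = if S.lv s = k then (S.χ s x).val else 0 := fun s => rfl
  have hc0 : ∀ s, S.lv s < k → c s = 0 := fun s hs => by rw [hcs, if_neg hs.ne]
  obtain ⟨h1, h2⟩ := S.nf_mem_and_χ k c hc0
  refine ⟨c, fun s => ?_, fun s hs => ?_, S.mem_succ k _ (mul_mem (inv_mem h1) hx) fun s hs => ?_⟩
  · rw [hcs]; split_ifs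
    · exact ZMod.val_lt _
    · exact S.q_pos s
  · rw [hcs] at hs
    simpa using hs
  · have h2' := h2 s hs
    subst hs
    rw [S.χ_mul s _ (inv_mem h1) _ hx, S.χ_inv s h1, h2', hcs, if_pos rfl, ZMod.natCast_zmod_val,
      neg_add_cancel]

/-- Every element of `Γ k` has a reduced normal form, which involves only levels from `k` on. -/
theorem exists_nf_eq_of_mem (k : ℕ) {x : G} (hx : x ∈ S.Γ k) :
    ∃ c, S.Reduced c ∧ (∀ s, S.lv s < k → c s = 0) ∧ S.nf c = x := by
  have main : ∀ d, ∀ k, S.n ≤ k + d → ∀ x ∈ S.Γ k,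
      ∃ c, S.Reduced c ∧ (∀ s, S.lv s < k → c s = 0) ∧ S.nf c = x := by
    intro d
    induction d with
    | zero =>
      intro k hk x hx
      have : x ∈ S.Γ S.n := S.anti (by omega) hx
      rw [S.bot, Subgroup.mem_bot] at this
      exact ⟨0, fun s => by simpa using S.q_pos s, fun _ _ => rfl, by rw [this, S.nf_zero]⟩
    | succ d ih =>
      intro k hk x hx
      obtain ⟨c, hc, hc', h⟩ := S.exists_nf_mul k hx
      obtain ⟨c', hr, hk', h'⟩ := ih (k + 1) (by omega) _ h
      have hs : ∀ s ∈ c.support, ∀ t ∈ c'.support, s < t := by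
        intro s hs t ht
        have h1 := (hc' s (by simpa using hs)).1
        have h2 : ¬ S.lv t < k + 1 := fun hlt => (Finsupp.mem_support_iff.1 ht) (hk' t hlt)
        exact S.mono.reflect_lt (by omega)
      refine ⟨c + c', fun s => ?_, fun s hs => ?_, by rw [S.nf_add hs, h', mul_inv_cancel_left]⟩
      · rw [Finsupp.add_apply]
        by_cases h0 : c s = 0
        · rw [h0, zero_add]; exact hr s
        · have : c' s = 0 := by
            by_contra h1
            exact lt_irrefl s (hs s (by simpa using h0) s (by simpa using h1))
          rw [this, add_zero]; exact hc s
      · rw [Finsupp.add_apply, hk' s (by omega), add_zero]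
        by_contra h0
        exact absurd (hc' s h0).1 hs.ne
  exact main S.n k (by omega) x hx

theorem exists_nf_eq (x : G) : ∃ c, S.Reduced c ∧ S.nf c = x := by
  obtain ⟨c, h1, -, h2⟩ := S.exists_nf_eq_of_mem 0 (x := x) (by rw [S.top]; trivial)
  exact ⟨c, h1, h2⟩

/-- The elements whose normal form involves only the `e s` with `s ∈ F`. -/
def box (F : Finset σ) : Set G := S.nf '' {c | S.Reduced c ∧ c.support ⊆ F}

theorem finite_box (F : Finset σ) : (S.box F).Finite := by
  classical
  refine Set.Finite.image _ ((F.finsupp fun s => Finset.range (S.q s)).finite_toSet.subset ?_)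
  rintro c ⟨h1, h2⟩
  rw [Finset.mem_coe, Finset.mem_finsupp_iff]
  exact ⟨h2, fun s _ => Finset.mem_range.2 (h1 s)⟩

/-- Every finite subset is contained in a box `S.box F` which is closed under multiplication: the
levels of `F` are chosen one after the other, such that the products of two elements and the given
elements are represented modulo higher and higher terms of the central series. -/
theorem exists_box_mul_mem (X : Set G) (hX : X.Finite) (F0 : Finset σ) :
    ∃ F : Finset σ, F0 ⊆ F ∧ X ⊆ S.box F ∧ ∀ x ∈ S.box F, ∀ y ∈ S.box F, x * y ∈ S.box F := by
  classical
  have main : ∀ k, ∃ F : Finset σ, F0.filter (fun s => S.lv s < k) ⊆ F ∧ (∀ s ∈ F, S.lv s < k) ∧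
      (∀ x ∈ X, ∃ t ∈ S.box F, t⁻¹ * x ∈ S.Γ k) ∧
      ∀ x ∈ S.box F, ∀ y ∈ S.box F, ∃ t ∈ S.box F, t⁻¹ * (x * y) ∈ S.Γ k := by
    intro k
    induction k with
    | zero =>
      have h1 : (1 : G) ∈ S.box ∅ :=
        ⟨0, ⟨fun s => by simpa using S.q_pos s, by simp⟩, S.nf_zero⟩
      exact ⟨∅, by simp, by simp, fun x _ => ⟨1, h1, by rw [S.top]; trivial⟩,
        fun x _ y _ => ⟨1, h1, by rw [S.top]; trivial⟩⟩
    | succ k ih =>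
      obtain ⟨F, hF0, hFk, hFX, hFm⟩ := ih
      choose! tx htx hx using hFX
      choose! tm htm hm using hFm
      let Y : Set G := (fun x => (tx x)⁻¹ * x) '' X ∪
        Set.image2 (fun x y => (tm x y)⁻¹ * (x * y)) (S.box F) (S.box F)
      have hY : Y.Finite := (hX.image _).union ((S.finite_box F).image2 _ (S.finite_box F))
      have hYΓ : ∀ z ∈ Y, z ∈ S.Γ k := by
        rintro z (⟨x, h, rfl⟩ | ⟨x, h, y, h', rfl⟩)
        · exact hx x h
        · exact hm x h y h'
      have hsupp : (⋃ z ∈ Y, {s | S.lv s = k ∧ S.χ s z ≠ 0}).Finite :=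
        hY.biUnion fun z hz => S.finite k z (hYΓ z hz)
      let D : Finset σ := hsupp.toFinset ∪ F0.filter fun s => S.lv s = k
      have hDk : ∀ s ∈ D, S.lv s = k := by
        intro s hs
        rcases Finset.mem_union.1 hs with h | h
        · rw [Set.Finite.mem_toFinset] at h
          simp only [Set.mem_iUnion] at h
          obtain ⟨z, -, hz⟩ := h
          exact hz.1
        · exact (Finset.mem_filter.1 h).2
      have hYD : ∀ z ∈ Y, ∀ s, S.lv s = k → s ∉ D → S.χ s z = 0 := by
        intro z hz s hs hsD
        by_contra h
        refine hsD (Finset.mem_union_left _ ?_)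
        rw [Set.Finite.mem_toFinset]
        exact Set.mem_biUnion hz ⟨hs, h⟩
      -- elements of `Γ k` with coordinates in `D` are represented modulo `Γ (k + 1)`
      have step : ∀ t ∈ S.box F, ∀ z ∈ S.Γ k, (∀ s, S.lv s = k → s ∉ D → S.χ s z = 0) →
          ∃ t' ∈ S.box (F ∪ D), t'⁻¹ * (t * z) ∈ S.Γ (k + 1) := by
        rintro _ ⟨c, ⟨hc, hcF⟩, rfl⟩ z hz hzD
        obtain ⟨d, hd, hd', h⟩ := S.exists_nf_mul k hz
        have hdD : d.support ⊆ D := fun s hs => by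
          have h1 := hd' s (by simpa using hs)
          by_contra h2
          exact h1.2 (hzD s h1.1 h2)
        have hcd : ∀ s ∈ c.support, ∀ t ∈ d.support, s < t := fun s hs t ht =>
          S.mono.reflect_lt (by rw [hDk t (hdD ht)]; exact hFk s (hcF hs))
        refine ⟨S.nf (c + d), ⟨c + d, ⟨fun s => ?_, fun s hs => ?_⟩, rfl⟩, ?_⟩
        · rw [Finsupp.add_apply]
          by_cases h0 : c s = 0
          · rw [h0, zero_add]; exact hd s
          · have : d s = 0 := by
              by_contra h1
              exact lt_irrefl s (hcd s (by simpa using h0) s (by simpa using h1))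
            rw [this, add_zero]; exact hc s
        · exact Finset.mem_union.2 ((Finset.mem_union.1 (Finsupp.support_add hs)).imp
            (fun h => hcF h) (fun h => hdD h))
        · rw [S.nf_add hcd]
          convert h using 1
          group
      have split : ∀ x ∈ S.box (F ∪ D), ∃ t ∈ S.box F, ∃ a ∈ S.Γ k,
          (∀ s, S.lv s = k → s ∉ D → S.χ s a = 0) ∧ x = t * a := by
        rintro _ ⟨c, ⟨hc, hcF⟩, rfl⟩
        obtain ⟨h1, h2⟩ := S.nf_mem_and_χ k (c.filter fun s => ¬ S.lv s < k)
            (fun t ht => Finsupp.filter_apply_neg _ _ (by simpa using ht))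
        refine ⟨_, ⟨c.filter fun s => S.lv s < k, ⟨fun s => ?_, fun s hs => ?_⟩, rfl⟩, _, h1,
          fun s hs hsD => ?_, S.nf_split k c⟩
        · rw [Finsupp.filter_apply]; split_ifs
          · exact hc s
          · exact S.q_pos s
        · simp only [Finsupp.support_filter, Finset.mem_filter] at hs
          rcases Finset.mem_union.1 (hcF hs.1) with h | h
          · exact h
          · have := hDk s h; omega
        · rw [h2 s hs, Finsupp.filter_apply_pos _ _ (by omega)]
          have : c s = 0 := by
            by_contra h
            rcases Finset.mem_union.1 (hcF (Finsupp.mem_support_iff.2 h)) with h | h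
            · have := hFk s h; omega
            · exact hsD h
          rw [this, Nat.cast_zero]
      refine ⟨F ∪ D, fun s hs => ?_, fun s hs => ?_, fun x hxX => ?_, fun x hxb y hyb => ?_⟩
      · obtain ⟨h1, h2⟩ := Finset.mem_filter.1 hs
        rcases Nat.lt_succ_iff_lt_or_eq.1 h2 with h | h
        · exact Finset.mem_union_left _ (hF0 (Finset.mem_filter.2 ⟨h1, h⟩))
        · exact Finset.mem_union_right _ (Finset.mem_union_right _ (Finset.mem_filter.2 ⟨h1, h⟩))
      · rcases Finset.mem_union.1 hs with h | h
        · have := hFk s h; omega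
        · have := hDk s h; omega
      · obtain ⟨t', ht', h⟩ := step (tx x) (htx x hxX) _ (hx x hxX)
          (hYD _ (Or.inl ⟨x, hxX, rfl⟩))
        exact ⟨t', ht', by simpa using h⟩
      · obtain ⟨t, ht, a, ha, haD, rfl⟩ := split x hxb
        obtain ⟨u, hu, b, hb, hbD, rfl⟩ := split y hyb
        have hz := hm t ht u hu
        have hzD := hYD _ (Or.inr ⟨t, ht, u, hu, rfl⟩)
        obtain ⟨t', ht', h⟩ := step (tm t u) (htm t ht u hu) ((tm t u)⁻¹ * (t * u) * a * b)
          (mul_mem (mul_mem hz ha) hb) (fun s hs hsD => by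
            have h1 := hzD s hs hsD
            have h2 := haD s hs hsD
            have h3 := hbD s hs hsD
            subst hs
            rw [S.χ_mul s _ (mul_mem hz ha) _ hb, S.χ_mul s _ hz _ ha, h1, h2, h3]; simp)
        refine ⟨t', ht', ?_⟩
        -- moving `a` past `u` introduces a commutator in `Γ (k + 1)`
        have h5 : b⁻¹ * ⁅a⁻¹, u⁻¹⁆ * b ∈ S.Γ (k + 1) :=
          (S.normal (k + 1)).conj_mem' _ (S.central k _ (inv_mem ha) u⁻¹) b
        have h10 := mul_mem h h5
        convert h10 using 1
        simp only [commutatorElement_def]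
        group
  obtain ⟨F, h1, h2, h3, h4⟩ := main (S.n + F0.sup (fun s => S.lv s + 1))
  have hbot : ∀ x ∈ S.Γ (S.n + F0.sup (fun s => S.lv s + 1)), x = 1 := fun x hx => by
    have := S.anti (Nat.le_add_right _ _) hx
    rwa [S.bot, Subgroup.mem_bot] at this
  refine ⟨F, fun s hs => h1 (Finset.mem_filter.2 ⟨hs, ?_⟩), fun x hx => ?_, fun x hx y hy => ?_⟩
  · have := Finset.le_sup (f := fun s => S.lv s + 1) hs
    omega
  · obtain ⟨t, ht, h⟩ := h3 x hx
    rwa [← inv_mul_eq_one.1 (hbot _ h)]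
  · obtain ⟨t, ht, h⟩ := h4 x hx y hy
    rwa [← inv_mul_eq_one.1 (hbot _ h)]

end CoordSystem

end CoordSystem

/-! ### Finite sections of a group with a central basis -/

section CentralBasis

namespace CoordSystem

variable {p : ℕ} {G σ : Type*} [Group G] [LinearOrder σ] (S : CoordSystem p G σ)

/-- A subgroup consisting of the elements whose normal forms involve only the `e s` with `s ∈ F`. -/
structure Box where
  F : Finset σ
  K : Subgroup G
  mem_iff : ∀ x, x ∈ K ↔ x ∈ S.box F

theorem exists_box (hp : 0 < p) (X : Set G) (hX : X.Finite) (F0 : Finset σ) :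
    ∃ B : S.Box, F0 ⊆ B.F ∧ X ⊆ B.K := by
  obtain ⟨F, h0, h1, h2⟩ := S.exists_box_mul_mem X hX F0
  have hone : (1 : G) ∈ S.box F := ⟨0, ⟨fun s => by simpa using S.q_pos s, by simp⟩, S.nf_zero⟩
  have hpow : ∀ x ∈ S.box F, ∀ k : ℕ, x ^ k ∈ S.box F := fun x hx k => by
    induction k with
    | zero => simpa using hone
    | succ k ih => rw [pow_succ]; exact h2 _ ih _ hx
  refine ⟨⟨F, ⟨⟨⟨S.box F, fun {x y} hx hy => h2 x hx y hy⟩, hone⟩, fun {x} hx => ?_⟩,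
    fun x => Iff.rfl⟩, h0, h1⟩
  obtain ⟨k, hk⟩ := S.isPGroup x
  have : x⁻¹ = x ^ (p ^ k - 1) := by
    rw [inv_eq_iff_mul_eq_one, ← pow_succ', Nat.sub_add_cancel (pow_pos hp k), hk]
  show x⁻¹ ∈ S.box F
  rw [this]; exact hpow x hx _

namespace Box

variable {S} (B : S.Box)

theorem finite : Finite B.K :=
  (S.finite_box B.F).subset fun x hx => (B.mem_iff x).1 hx

theorem e_mem {s : σ} (hs : s ∈ B.F) : S.e s ∈ B.K := by
  classical
  refine (B.mem_iff _).2 ⟨Finsupp.single s 1, ⟨fun t => ?_, ?_⟩, by rw [S.nf_single, pow_one]⟩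
  · rw [Finsupp.single_apply]; split_ifs
    · exact S.one_lt t
    · exact S.q_pos t
  · exact Finsupp.support_single_subset.trans (by simpa using hs)

open Classical in
/-- The generators of the box, extended by `1`. -/
noncomputable def gen (s : σ) : B.K := if h : s ∈ B.F then ⟨S.e s, B.e_mem h⟩ else 1

theorem gen_of_mem {s : σ} (h : s ∈ B.F) : (B.gen s : G) = S.e s := by simp [gen, h]

theorem gen_of_notMem {s : σ} (h : s ∉ B.F) : B.gen s = 1 := by simp [gen, h]

/-- The indices of the box in increasing order. -/
noncomputable def list : List σ := B.F.sort (· ≤ ·)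

theorem mem_list {s : σ} : s ∈ B.list ↔ s ∈ B.F := by simp [list]

theorem nodup_list : B.list.Nodup := Finset.sort_nodup _ _

theorem coe_prod_gen {c : σ →₀ ℕ} (hc : c.support ⊆ B.F) :
    (((B.list.map fun s => B.gen s ^ c s).prod : B.K) : G) = S.nf c := by
  rw [← S.prod_map_pow_eq_nf (l := B.list) (Finset.sortedLT_sort _).pairwise
    (fun s hs => B.mem_list.2 (hc hs)), ← Subgroup.coe_subtype, map_list_prod, List.map_map]
  congr 1
  refine List.map_congr_left fun s hs => ?_
  simp [B.gen_of_mem (B.mem_list.1 hs)]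

/-- The reduced normal form in `G` of an element of a box is an ordered product of generators of the
box. -/
theorem exists_prod_gen_eq (k : ℕ) (x : B.K) (hx : (x : G) ∈ S.Γ k) :
    ∃ c : σ →₀ ℕ, S.Reduced c ∧ c.support ⊆ B.F ∧ (∀ s, S.lv s < k → c s = 0) ∧ S.nf c = x ∧
      (B.list.map fun s => B.gen s ^ c s).prod = x := by
  obtain ⟨c, h1, h2, h3⟩ := S.exists_nf_eq_of_mem k hx
  obtain ⟨d, ⟨hd, hdF⟩, h4⟩ := (B.mem_iff _).1 x.2
  obtain rfl := S.nf_injective h1 hd (h3.trans h4.symm)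
  exact ⟨c, h1, hdF, h2, h3, Subtype.ext ((B.coe_prod_gen hdF).trans h3)⟩

/-- Every element of a box is a reduced ordered product of the generators in exactly one way. -/
theorem bijective_prod_gen : Function.Bijective
    fun b : {b : σ → ℕ // IsReducedExp S.q B.list b} =>
      (B.list.map fun s => B.gen s ^ b.1 s).prod := by
  have hfin : ∀ b : {b : σ → ℕ // IsReducedExp S.q B.list b},
      ∃ c : σ →₀ ℕ, S.Reduced c ∧ c.support ⊆ B.F ∧ ⇑c = b.1 := by
    rintro ⟨b, hb, hb'⟩
    refine ⟨Finsupp.onFinset B.F b fun s hs => ?_, fun s => ?_, Finsupp.support_onFinset_subset, rfl⟩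
    · by_contra h
      exact hs (hb' s (fun h' => h (B.mem_list.1 h')))
    · rw [Finsupp.onFinset_apply]
      by_cases h : s ∈ B.list
      · exact hb s h
      · rw [hb' s h]; exact S.q_pos s
  constructor
  · intro b b' h
    obtain ⟨c, hc, hcF, hcb⟩ := hfin b
    obtain ⟨c', hc', hcF', hcb'⟩ := hfin b'
    have h' := congrArg (fun x : B.K => (x : G)) h
    simp only [← hcb, ← hcb'] at h'
    rw [B.coe_prod_gen hcF, B.coe_prod_gen hcF'] at h'
    have := S.nf_injective hc hc' h'
    apply Subtype.ext
    rw [← hcb, ← hcb', this]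
  · intro x
    obtain ⟨c, hc, hcF, -, -, h⟩ := B.exists_prod_gen_eq 0 x (by rw [S.top]; trivial)
    refine ⟨⟨c, fun s _ => hc s, fun s hs => ?_⟩, h⟩
    by_contra h'
    exact hs (B.mem_list.2 (hcF (Finsupp.mem_support_iff.2 h')))

end Box

end CoordSystem

/-- A finite central series `U` of `H` with torsion free factors together with elements `e s` of
`U (lv s)` which, for each `k`, form a basis of `U k` modulo `U (k + 1)` and `p`-th powers. This is
expressed by coordinates `χ` on the factors, with values modulo any power of `p`. -/
structure CentralBasis (p : ℕ) (H σ : Type*) [Group H] [LinearOrder σ] where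
  lv : σ → ℕ
  mono : Monotone lv
  U : ℕ → Subgroup H
  n : ℕ
  anti : Antitone U
  top : U 0 = ⊤
  bot : U n = ⊥
  central : ∀ k, ∀ x ∈ U k, ∀ g, ⁅x, g⁆ ∈ U (k + 1)
  torsionFree : ∀ k, FactorTorsionFree (U k) (U (k + 1))
  height : ∀ k, FactorNoInfiniteHeight p (U k) (U (k + 1))
  e : σ → H
  e_mem : ∀ s, e s ∈ U (lv s)
  coords : ∀ m : ℕ, ∃ χ : σ → H → ZMod (p ^ m),
    (∀ s, ∀ x ∈ U (lv s), ∀ y ∈ U (lv s), χ s (x * y) = χ s x + χ s y) ∧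
    (∀ s, χ s (e s) = 1) ∧
    (∀ s t, lv s = lv t → s ≠ t → χ s (e t) = 0) ∧
    (∀ k, ∀ x ∈ U k, {s | lv s = k ∧ χ s x ≠ 0}.Finite) ∧
    ∀ k, ∀ x ∈ U k, (∀ s, lv s = k → χ s x = 0) ↔ ∃ w ∈ U k, (w ^ p ^ m)⁻¹ * x ∈ U (k + 1)

namespace CentralBasis

variable {p : ℕ} {H σ : Type*} [Group H] [LinearOrder σ] (P : CentralBasis p H σ)

/-- The quotients of `H` by congruence subgroups have coordinate systems. -/
theorem exists_coordSystem (hp : p.Prime) (L : ℕ) :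
    ∃ (N : Subgroup H) (_ : N.Normal) (S : CoordSystem p (H ⧸ N) σ),
      (∀ s, L ≤ S.m s) ∧ (∀ s, S.lv s = P.lv s) ∧ (∀ s, S.e s = P.e s) ∧
      (∀ k, S.Γ k = (P.U k).map (QuotientGroup.mk' N)) ∧
      ∀ k, ∀ x ∈ N, x ∈ P.U k → ∃ u ∈ P.U k, (u ^ p ^ L)⁻¹ * x ∈ P.U (k + 1) := by
  classical
  -- with `L + 1` in place of `L` the orders `p ^ m` exceed `1` also for `L = 0`
  obtain ⟨N, m, hN, hLm, hpow, hcap⟩ :=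
    exists_congruence_subgroup hp P.anti P.bot P.central P.torsionFree (L + 1)
  choose χ hmul hself hne hfin hzero using P.coords
  let ξ : ∀ s, H → ZMod (p ^ m (P.lv s)) := fun s => χ (m (P.lv s)) s
  have ξ_N : ∀ s, ∀ x ∈ P.U (P.lv s), x ∈ N → ξ s x = 0 := fun s x hx hxN =>
    ((hzero _ _ x hx).2 (hcap _ x hxN hx)) s rfl
  have ξ_congr : ∀ s, ∀ x ∈ P.U (P.lv s), ∀ y ∈ P.U (P.lv s), (x : H ⧸ N) = y → ξ s x = ξ s y := by
    intro s x hx y hy h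
    have h1 : x⁻¹ * y ∈ N := QuotientGroup.eq.1 h
    have h2 := hmul (m (P.lv s)) s x hx _ (mul_mem (inv_mem hx) hy)
    rw [mul_inv_cancel_left] at h2
    have h3 := ξ_N s _ (mul_mem (inv_mem hx) hy) h1
    show χ _ s x = χ _ s y
    rw [h2, show χ _ s (x⁻¹ * y) = 0 from h3, add_zero]
  -- the coordinates modulo `p ^ m` descend to the quotient by `N`, as they vanish on `N`
  let η : ∀ s, H ⧸ N → ZMod (p ^ m (P.lv s)) := fun s g =>
    if h : ∃ x ∈ P.U (P.lv s), (x : H ⧸ N) = g then ξ s h.choose else 0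
  have hη : ∀ s, ∀ x ∈ P.U (P.lv s), η s x = ξ s x := by
    intro s x hx
    have h : ∃ y ∈ P.U (P.lv s), (y : H ⧸ N) = x := ⟨x, hx, rfl⟩
    have : η s x = ξ s h.choose := dif_pos h
    rw [this]
    exact ξ_congr s _ h.choose_spec.1 x hx h.choose_spec.2
  let Γ : ℕ → Subgroup (H ⧸ N) := fun k => (P.U k).map (QuotientGroup.mk' N)
  have hΓ : ∀ k, ∀ g ∈ Γ k, ∃ x ∈ P.U k, (x : H ⧸ N) = g := fun k g hg => hg
  have hΓ' : ∀ k, ∀ x ∈ P.U k, (x : H ⧸ N) ∈ Γ k := fun k x hx => ⟨x, hx, rfl⟩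
  have hlvL : ∀ s, L ≤ m (P.lv s) := fun s => (Nat.le_succ L).trans (hLm _)
  refine ⟨N, hN, {
    lv := P.lv
    mono := P.mono
    m := fun s => m (P.lv s)
    one_lt := fun s => Nat.one_lt_pow (by have := hLm (P.lv s); omega) hp.one_lt
    Γ := Γ
    n := P.n
    anti := fun i j h => Subgroup.map_mono (P.anti h)
    top := by
      show (P.U 0).map _ = ⊤
      rw [P.top]
      exact Subgroup.map_top_of_surjective _ (QuotientGroup.mk'_surjective N)
    bot := by show (P.U P.n).map _ = ⊥; rw [P.bot, Subgroup.map_bot]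
    central := ?_
    e := fun s => P.e s
    e_mem := fun s => hΓ' _ _ (P.e_mem s)
    χ := η
    e_pow := fun s => by
      rw [← QuotientGroup.mk_pow]
      exact (QuotientGroup.eq_one_iff _).2 (hpow _ _ (P.e_mem s))
    isPGroup := ?_
    χ_mul := ?_
    χ_self := fun s => by rw [hη s _ (P.e_mem s)]; exact hself _ s
    χ_ne := fun s t hst h => by
      rw [hη s _ (hst ▸ P.e_mem t)]; exact hne _ s t hst h
    finite := ?_
    χ_succ := ?_
    mem_succ := ?_ }, hlvL, fun _ => rfl, fun _ => rfl, fun _ => rfl, ?_⟩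
  · intro k g hg g'
    obtain ⟨x, hx, rfl⟩ := hΓ k g hg
    obtain ⟨y, rfl⟩ := QuotientGroup.mk_surjective g'
    exact hΓ' _ _ (P.central k x hx y)
  · intro g
    obtain ⟨x, rfl⟩ := QuotientGroup.mk_surjective g
    refine ⟨m 0, ?_⟩
    rw [← QuotientGroup.mk_pow]
    exact (QuotientGroup.eq_one_iff _).2 (hpow 0 _ (by rw [P.top]; trivial))
  · intro s g hg g' hg'
    obtain ⟨x, hx, rfl⟩ := hΓ _ g hg
    obtain ⟨y, hy, rfl⟩ := hΓ _ g' hg'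
    rw [← QuotientGroup.mk_mul, hη s _ (mul_mem hx hy), hη s _ hx, hη s _ hy]
    exact hmul _ s x hx y hy
  · intro k g hg
    obtain ⟨x, hx, rfl⟩ := hΓ _ g hg
    refine (hfin (m k) k x hx).subset ?_
    rintro s ⟨rfl, hs⟩
    rw [hη s x hx] at hs
    exact ⟨rfl, hs⟩
  · intro s g hg
    obtain ⟨x, hx, rfl⟩ := hΓ _ g hg
    have hx' := P.anti (Nat.le_succ _) hx
    rw [hη s _ hx']
    exact (hzero _ _ x hx').2 ⟨1, one_mem _, by simpa using hx⟩ s rfl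
  · intro k g hg h
    obtain ⟨x, hx, rfl⟩ := hΓ _ g hg
    obtain ⟨w, hw, hwx⟩ := (hzero (m k) k x hx).1 (fun s hs => by
      have h1 := h s hs
      subst hs
      rwa [hη s x hx] at h1)
    have h2 := hΓ' _ _ hwx
    rwa [QuotientGroup.mk_mul, QuotientGroup.mk_inv,
      (QuotientGroup.eq_one_iff _).2 (hpow k w hw), inv_one, one_mul] at h2
  · intro k x hx hxU
    obtain ⟨u, hu, h⟩ := hcap k x hx hxU
    obtain ⟨r, hr⟩ := Nat.exists_eq_add_of_le ((Nat.le_succ L).trans (hLm k))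
    refine ⟨u ^ p ^ r, pow_mem hu _, ?_⟩
    rwa [← pow_mul, ← pow_add, add_comm r, ← hr]

/-- An element other than `1` survives in the quotients by sufficiently small congruence
subgroups. -/
theorem exists_forall_notMem {x : H} (hx : x ≠ 1) : ∃ L0, ∀ L, L0 ≤ L → ∀ N : Subgroup H,
    (∀ k, ∀ y ∈ N, y ∈ P.U k → ∃ u ∈ P.U k, (u ^ p ^ L)⁻¹ * y ∈ P.U (k + 1)) → x ∉ N := by
  classical
  have hex : ∃ k, x ∉ P.U k := ⟨P.n, by rwa [P.bot, Subgroup.mem_bot]⟩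
  have hk := Nat.find_spec hex
  obtain ⟨k, hk'⟩ : ∃ k, Nat.find hex = k + 1 := by
    refine Nat.exists_eq_succ_of_ne_zero fun h => ?_
    rw [h, P.top] at hk
    exact hk trivial
  have hxk : x ∈ P.U k := by
    by_contra h
    have := Nat.find_min' hex h
    omega
  rw [hk'] at hk
  have h1 : ¬ ∀ m : ℕ, ∃ u ∈ P.U k, (u ^ p ^ m)⁻¹ * x ∈ P.U (k + 1) :=
    fun h => hk (P.height k x hxk h)
  push Not at h1
  obtain ⟨L0, hL0⟩ := h1
  refine ⟨L0, fun L hL N hN hxN => ?_⟩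
  obtain ⟨u, hu, h⟩ := hN k x hxN hxk
  obtain ⟨r, hr⟩ := Nat.exists_eq_add_of_le hL
  refine hL0 (u ^ p ^ r) (pow_mem hu _) ?_
  rwa [← pow_mul, ← pow_add, add_comm r, ← hr]

end CentralBasis

end CentralBasis

/-! ### Weights, and the filtration of the group ring of a box -/

section BoxFiltration

/-- A weight function `f` on indices with levels `lv`, growing by more than a factor `2` with the
level. The number `W k` is a lower bound for the weights of level at least `k`, and `c` is the weight
of `π`. -/
structure IsWeight {σ : Type*} (lv : σ → ℕ) (c : ℕ) (f : σ → ℕ) (W : ℕ → ℕ) : Prop where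
  W_pos : ∀ k, 0 < W k
  W_mono : Monotone W
  W_le : ∀ s, W (lv s) ≤ f s
  two_mul_lt : ∀ s, 2 * f s < W (lv s + 1)
  le : ∀ k, W k ≤ c

namespace IsWeight

variable {σ : Type*} {lv : σ → ℕ} {c : ℕ} {f : σ → ℕ} {W : ℕ → ℕ}

theorem pos (h : IsWeight lv c f W) (s : σ) : 0 < f s := (h.W_pos _).trans_le (h.W_le s)

theorem c_pos (h : IsWeight lv c f W) : 0 < c := (h.W_pos 0).trans_le (h.le 0)

theorem f_le (h : IsWeight lv c f W) (s : σ) : f s ≤ c := by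
  have h1 := h.two_mul_lt s
  have h2 := h.le (lv s + 1)
  omega

theorem of_le (h : IsWeight lv c f W) {c' : ℕ} (hc : c ≤ c') : IsWeight lv c' f W :=
  { h with le := fun k => (h.le k).trans hc }

theorem add_lt (h : IsWeight lv c f W) (s t : σ) :
    f s + f t + 1 ≤ W (max (lv s) (lv t) + 1) := by
  have h1 := (h.two_mul_lt s).trans_le (h.W_mono (Nat.succ_le_succ (le_max_left (lv s) (lv t))))
  have h2 := (h.two_mul_lt t).trans_le (h.W_mono (Nat.succ_le_succ (le_max_right (lv s) (lv t))))
  simp only [Nat.succ_eq_add_one] at h1 h2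
  omega

end IsWeight

section GroupSubOne

variable {R G : Type*} [Ring R] [Group G]

theorem groupSubOne_one : groupSubOne R (1 : G) = 0 := by
  simp [groupSubOne, MonoidAlgebra.one_def]

theorem groupSubOne_mul (x y : G) :
    groupSubOne R (x * y) = groupSubOne R x * groupSubOne R y + groupSubOne R x +
      groupSubOne R y := by
  have : (MonoidAlgebra.single (x * y) 1 : MonoidAlgebra R G) =
      MonoidAlgebra.single x 1 * MonoidAlgebra.single y 1 := by
    simp [MonoidAlgebra.single_mul_single]
  unfold groupSubOne
  rw [this]; noncomm_ring

theorem single_eq_groupSubOne_add_one (x : G) :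
    (MonoidAlgebra.single x 1 : MonoidAlgebra R G) = groupSubOne R x + 1 := by
  simp [groupSubOne]

/-- The commutator of `x - 1` and `y - 1` in the group ring, expressed by that of `x` and `y`. -/
theorem groupSubOne_mul_sub_mul (x y : G) :
    groupSubOne R x * groupSubOne R y - groupSubOne R y * groupSubOne R x =
      groupSubOne R ⁅x, y⁆ * MonoidAlgebra.single (y * x) 1 := by
  have h1 : ∀ a b : G, (MonoidAlgebra.single (a * b) 1 : MonoidAlgebra R G) =
      MonoidAlgebra.single a 1 * MonoidAlgebra.single b 1 := fun a b => by
    simp [MonoidAlgebra.single_mul_single]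
  have h2 : (MonoidAlgebra.single ⁅x, y⁆ 1 : MonoidAlgebra R G) * MonoidAlgebra.single (y * x) 1 =
      MonoidAlgebra.single x 1 * MonoidAlgebra.single y 1 := by
    rw [← h1, ← h1]; congr 1; rw [commutatorElement_def]; group
  unfold groupSubOne
  rw [sub_mul (MonoidAlgebra.single ⁅x, y⁆ 1 : MonoidAlgebra R G), h2, h1]; noncomm_ring

end GroupSubOne

/-- Since `(p ^ m).choose k * k` is divisible by `p ^ m`, and `k < L` is not divisible by `p ^ L`. -/
theorem pow_dvd_choose {p : ℕ} (hp : p.Prime) {m L k : ℕ} (hm : 2 * L ≤ m) (hk : 0 < k)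
    (hkL : k < L) : p ^ L ∣ (p ^ m).choose k := by
  obtain ⟨v, k', hk', rfl⟩ := Nat.exists_eq_pow_mul_and_not_dvd hk.ne' p hp.one_lt.ne'
  have hv : v < L := by
    have h1 : v < p ^ v := Nat.lt_pow_self hp.one_lt
    have h2 : p ^ v * 1 ≤ p ^ v * k' := Nat.mul_le_mul_left _ (Nat.pos_of_ne_zero (by
      rintro rfl; simp at hk'))
    omega
  have h1 : p ^ m ∣ (p ^ m).choose (p ^ v * k') * (p ^ v * k') := by
    obtain ⟨r, hr⟩ := Nat.exists_eq_succ_of_ne_zero hk.ne'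
    obtain ⟨M, hM⟩ := Nat.exists_eq_succ_of_ne_zero (pow_pos hp.pos m).ne'
    rw [hr, hM]
    exact ⟨_, (Nat.add_one_mul_choose_eq M r).symm⟩
  have h2 : p ^ v * p ^ L ∣ p ^ v * ((p ^ m).choose (p ^ v * k') * k') := by
    rw [← pow_add, mul_left_comm]
    exact (pow_dvd_pow p (by omega)).trans h1
  have h3 := Nat.dvd_of_mul_dvd_mul_left (pow_pos hp.pos v) h2
  exact (Nat.Coprime.pow_left L ((Nat.Prime.coprime_iff_not_dvd hp).2 hk')).dvd_of_dvd_mul_right h3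

namespace CoordSystem.Box

variable {p : ℕ} {G σ : Type*} [Group G] [LinearOrder σ] {S : CoordSystem p G σ} (B : S.Box)
variable {R : Type*} [Ring R] {π : R} {c : ℕ} {f : σ → ℕ} {W : ℕ → ℕ}

/-- For `x` in `Γ k`, the element `x - 1` has weight at least `W k`: the normal form of `x` is a product
of generators of level at least `k`. -/
theorem groupSubOne_mem_wordFilt (hπ : ∀ r, π * r = r * π) (hw : IsWeight S.lv c f W) (k : ℕ)
    (x : B.K) (hx : (x : G) ∈ S.Γ k) : groupSubOne R x ∈
      wordFilt MonoidAlgebra.singleOneRingHom (letterPi π B.gen) (fun o => o.elim c f) (W k) := by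
  obtain ⟨a, -, haF, hak, -, hax⟩ := B.exists_prod_gen_eq k x hx
  have hadd : ∀ y z : B.K, groupSubOne R y ∈ wordFilt MonoidAlgebra.singleOneRingHom
      (letterPi π B.gen) (fun o => o.elim c f) (W k) → groupSubOne R z ∈ wordFilt
      MonoidAlgebra.singleOneRingHom (letterPi π B.gen) (fun o => o.elim c f) (W k) →
      groupSubOne R (y * z) ∈ wordFilt MonoidAlgebra.singleOneRingHom (letterPi π B.gen)
        (fun o => o.elim c f) (W k) := fun y z hy hz => by
    rw [groupSubOne_mul]
    refine add_mem (add_mem (wordFilt_antitone (Nat.le_add_left _ _)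
      (mul_mem_wordFilt (commute_single_one_letterPi hπ _) hy hz)) hy) hz
  have main : ∀ l : List σ, groupSubOne R (l.map fun s => B.gen s ^ a s).prod ∈
      wordFilt MonoidAlgebra.singleOneRingHom (letterPi π B.gen) (fun o => o.elim c f) (W k) := by
    intro l
    induction l with
    | nil => simp [groupSubOne_one]
    | cons s l ih =>
      rw [List.map_cons, List.prod_cons]
      refine hadd _ _ ?_ ih
      rcases lt_or_ge (S.lv s) k with h | h
      · rw [hak s h, pow_zero, groupSubOne_one]; exact zero_mem _
      · induction a s with
        | zero => rw [pow_zero, groupSubOne_one]; exact zero_mem _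
        | succ i ih =>
          rw [pow_succ]
          refine hadd _ _ ih ?_
          exact letter_mem_wordFilt (t := letterPi π B.gen) (some s)
            ((hw.W_mono h).trans (hw.W_le s))
  rw [← hax]
  exact main _

/-- The commutator of two generators has higher level than both, and the weights more than double
with the level. -/
theorem commutator_mem_wordFilt (hπ : ∀ r, π * r = r * π) (hw : IsWeight S.lv c f W) (s t : σ) :
    groupSubOne R (B.gen s) * groupSubOne R (B.gen t) -
      groupSubOne R (B.gen t) * groupSubOne R (B.gen s) ∈
        wordFilt MonoidAlgebra.singleOneRingHom (letterPi π B.gen) (fun o => o.elim c f)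
          (f s + f t + 1) := by
  have hgen : ∀ s, (B.gen s : G) ∈ S.Γ (S.lv s) := fun s => by
    by_cases h : s ∈ B.F
    · rw [B.gen_of_mem h]; exact S.e_mem s
    · rw [B.gen_of_notMem h]; exact one_mem _
  rw [groupSubOne_mul_sub_mul]
  have h1 : ((⁅B.gen s, B.gen t⁆ : B.K) : G) ∈ S.Γ (max (S.lv s) (S.lv t) + 1) := by
    have : ((⁅B.gen s, B.gen t⁆ : B.K) : G) = ⁅(B.gen s : G), (B.gen t : G)⁆ :=
      map_commutatorElement B.K.subtype _ _
    rw [this]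
    rcases le_total (S.lv s) (S.lv t) with h | h
    · rw [max_eq_right h, ← inv_mem_iff, commutatorElement_inv]
      exact S.central _ _ (hgen t) _
    · rw [max_eq_left h]
      exact S.central _ _ (hgen s) _
  have h2 : (MonoidAlgebra.single (B.gen t * B.gen s) 1 : MonoidAlgebra R B.K) ∈
      wordFilt MonoidAlgebra.singleOneRingHom (letterPi π B.gen) (fun o => o.elim c f) 0 := by
    rw [single_eq_groupSubOne_add_one]
    refine add_mem (wordFilt_antitone (Nat.zero_le _)
      (B.groupSubOne_mem_wordFilt hπ hw 0 _ (by rw [S.top]; trivial))) ?_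
    rw [← map_one (MonoidAlgebra.singleOneRingHom (R := R))]
    exact scalar_mem_wordFilt 1
  have h3 := mul_mem_wordFilt (commute_single_one_letterPi hπ _)
    (B.groupSubOne_mem_wordFilt hπ hw _ _ h1) h2
  rw [add_zero] at h3
  exact wordFilt_antitone (hw.add_lt s t) h3

/-- In the filtration of the group ring of a box, the terms of weight up to `L` are spanned by reduced
ordered monomials if the orders of the generators are large, or the weight of `π` is large. -/
theorem wordFilt_le [Fact p.Prime] (hπ : ∀ r, π * r = r * π) (hp : π ∣ (p : R))
    (hw : IsWeight S.lv c f W) {L : ℕ} (hL : (∀ s, 2 * L ≤ S.m s) ∨ L ≤ c) {j : ℕ} (hj : j ≤ L) :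
    wordFilt MonoidAlgebra.singleOneRingHom (letterPi π B.gen) (fun o => o.elim c f) j ≤
      monoSpan π B.gen c f S.q B.list j := by
  have hp' : p.Prime := Fact.out
  have := B.finite
  refine wordFilt_le_monoSpan (S.isPGroup.to_subgroup B.K) hπ hp hw.c_pos hw.f_le B.nodup_list
    (fun s hs => B.gen_of_notMem fun h => hs (B.mem_list.2 h)) (fun s hs => ?_) (fun g => ?_)
    (fun s _ k hk hkm => ?_) (B.commutator_mem_wordFilt hπ hw) hj
  · apply Subtype.ext
    rw [Subgroup.coe_pow, B.gen_of_mem (B.mem_list.1 hs), S.e_pow]; rfl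
  · obtain ⟨a, ha, -, -, -, h⟩ := B.exists_prod_gen_eq 0 g (by rw [S.top]; trivial)
    exact ⟨a, fun s _ => ha s, h⟩
  · rcases hL with hL | hL
    · rcases lt_or_ge k L with h | h
      · exact ⟨L, pow_dvd_choose hp' (hL s) hk h, by
          have := Nat.mul_le_mul_left L hw.c_pos
          omega⟩
      · exact ⟨0, by simp, by
          have := Nat.mul_le_mul h (hw.pos s)
          omega⟩
    · exact ⟨1, by simpa using hp'.dvd_choose_pow hk.ne' hkm.ne, by omega⟩

end CoordSystem.Box

end BoxFiltration

/-! ### The filtration of the group ring -/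

section GroupRingFiltration

/-- The group ring is generated additively by the multiples of group elements. -/
theorem mem_of_forall_single_mem {R G : Type*} [Ring R] [Group G]
    {T : AddSubgroup (MonoidAlgebra R G)}
    (h : ∀ r g, MonoidAlgebra.singleOneRingHom r * MonoidAlgebra.single g 1 ∈ T)
    (x : MonoidAlgebra R G) : x ∈ T := by
  induction x using MonoidAlgebra.induction_linear with
  | zero => exact zero_mem _
  | add x y hx hy => exact add_mem hx hy
  | single g r => simpa [MonoidAlgebra.single_mul_single] using h r g

theorem augHom_single {R K H : Type*} [Ring R] [Field K] [Group H] (φ : R →+* K) (h : H) (r : R) :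
    augHom H φ (MonoidAlgebra.single h r) = φ r := by
  simp [augHom]

theorem augHom_singleOneRingHom {R K H : Type*} [Ring R] [Field K] [Group H] (φ : R →+* K) (r : R) :
    augHom H φ (MonoidAlgebra.singleOneRingHom r) = φ r := by
  simp [augHom_single]

theorem augHom_groupSubOne {R K H : Type*} [Ring R] [Field K] [Group H] (φ : R →+* K) (h : H) :
    augHom H φ (groupSubOne R h) = 0 := by
  simp [groupSubOne, augHom_single]

namespace CentralBasis

variable {p : ℕ} {H σ : Type*} [Group H] [LinearOrder σ] (P : CentralBasis p H σ)

/-- The subgroup `U k` is generated by the elements `e s` of level `k`, by `p`-th powers, and by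
`U (k + 1)`. -/
theorem U_le_of_generators (hp : p.Prime) (k : ℕ) {Q : Subgroup H}
    (he : ∀ s, P.lv s = k → P.e s ∈ Q) (hpow : ∀ w ∈ P.U k, w ^ p ∈ Q) (hU : P.U (k + 1) ≤ Q) :
    P.U k ≤ Q := by
  classical
  have : NeZero (p ^ 1) := ⟨(pow_pos hp.pos 1).ne'⟩
  obtain ⟨χ, hmul, hself, hne, hfin, hzero⟩ := P.coords 1
  have hχ1 : ∀ s, χ s 1 = 0 := fun s => by
    have := hmul s 1 (one_mem _) 1 (one_mem _)
    simpa using this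
  have main : ∀ D : Finset σ, ∀ x ∈ P.U k, (∀ s, P.lv s = k → s ∉ D → χ s x = 0) → x ∈ Q := by
    intro D
    induction D using Finset.induction with
    | empty =>
      intro x hx h
      obtain ⟨w, hw, h1⟩ := (hzero k x hx).1 fun s hs => h s hs (by simp)
      have := mul_mem (hpow w hw) (hU h1)
      rwa [pow_one, mul_inv_cancel_left] at this
    | insert t D _ ih =>
      intro x hx h
      by_cases ht : P.lv t = k
      · let a := (-χ t x).val
        have htU : P.e t ∈ P.U k := ht ▸ P.e_mem t
        have hpowχ : ∀ s, P.lv s = k → ∀ i : ℕ, χ s (P.e t ^ i) = i * χ s (P.e t) := by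
          intro s hs i
          subst hs
          induction i with
          | zero => simp [hχ1]
          | succ i ih => rw [pow_succ (P.e t) i, hmul s _ (pow_mem htU i) _ htU, ih]; push_cast; ring
        have h1 : P.e t ^ a * x ∈ Q := by
          refine ih _ (mul_mem (pow_mem htU a) hx) fun s hs hsD => ?_
          have h2 : χ s (P.e t ^ a * x) = χ s (P.e t ^ a) + χ s x := by
            subst hs
            exact hmul s _ (pow_mem htU a) _ hx
          rw [h2, hpowχ s hs]
          by_cases hst : s = t
          · subst hst
            rw [hself, mul_one, ZMod.natCast_zmod_val, neg_add_cancel]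
          · rw [hne s t (hs.trans ht.symm) hst, mul_zero, zero_add]
            exact h s hs (by simp [hst, hsD])
        have := mul_mem (inv_mem (pow_mem (he t ht) a)) h1
        rwa [inv_mul_cancel_left] at this
      · refine ih x hx fun s hs hsD => h s hs ?_
        have : s ≠ t := fun h => ht (h ▸ hs)
        simp [this, hsD]
  intro x hx
  refine main (hfin k x hx).toFinset x hx fun s hs h => ?_
  by_contra h'
  exact h ((hfin k x hx).mem_toFinset.2 ⟨hs, h'⟩)

/-- The letters `π`, `e s - 1`, and `u - 1` for all `u ∈ U k`. -/
noncomputable def letter {R : Type*} [Ring R] (π : R) :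
    Option σ ⊕ (Σ k, P.U k) → MonoidAlgebra R H :=
  Sum.elim (letterPi π P.e) (fun u => groupSubOne R (u.2 : H))

/-- The weights of the letters: `u - 1` has the weight `W k` if `u` is taken as an element of
`U k`. -/
def letterWt (c : ℕ) (f : σ → ℕ) (W : ℕ → ℕ) : Option σ ⊕ (Σ k, P.U k) → ℕ :=
  Sum.elim (fun o => o.elim c f) (fun u => W u.1)

/-- The filtration of the group ring by the weights of words in all letters. -/
noncomputable def filt {R : Type*} [Ring R] (π : R) (c : ℕ) (f : σ → ℕ) (W : ℕ → ℕ) :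
    ℕ → AddSubgroup (MonoidAlgebra R H) :=
  wordFilt MonoidAlgebra.singleOneRingHom (P.letter π) (P.letterWt c f W)

variable {R : Type*} [Ring R] {π : R} {c : ℕ} {f : σ → ℕ} {W : ℕ → ℕ}

theorem commute_letter (hπ : ∀ r, π * r = r * π) (r : R) (s : Option σ ⊕ (Σ k, P.U k)) :
    Commute (MonoidAlgebra.singleOneRingHom r) (P.letter π s) := by
  rcases s with s | u
  · exact commute_single_one_letterPi hπ P.e r s
  · exact commute_single_one_groupSubOne r _

theorem filt_antitone : Antitone (P.filt π c f W) := wordFilt_antitone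

theorem mul_mem_filt (hπ : ∀ r, π * r = r * π) {i j : ℕ} {x y : MonoidAlgebra R H}
    (hx : x ∈ P.filt π c f W i) (hy : y ∈ P.filt π c f W j) : x * y ∈ P.filt π c f W (i + j) :=
  mul_mem_wordFilt (P.commute_letter hπ) hx hy

theorem letterPi_mem_filt (s : Option σ) : letterPi π P.e s ∈ P.filt π c f W (s.elim c f) :=
  letter_mem_wordFilt (t := P.letter π) (wt := P.letterWt c f W) (Sum.inl s) le_rfl

theorem groupSubOne_mem_filt {k : ℕ} {u : H} (hu : u ∈ P.U k) :
    groupSubOne R u ∈ P.filt π c f W (W k) :=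
  letter_mem_wordFilt (t := P.letter π) (wt := P.letterWt c f W) (Sum.inr ⟨k, u, hu⟩) le_rfl

theorem singleOneRingHom_mem_filt (r : R) :
    MonoidAlgebra.singleOneRingHom r ∈ P.filt π c f W 0 := scalar_mem_wordFilt r

theorem mem_filt_zero (hπ : ∀ r, π * r = r * π) (x : MonoidAlgebra R H) :
    x ∈ P.filt π c f W 0 := by
  refine mem_of_forall_single_mem (fun r g => ?_) x
  refine P.mul_mem_filt hπ (i := 0) (j := 0) (P.singleOneRingHom_mem_filt r) ?_
  rw [single_eq_groupSubOne_add_one, ← map_one (MonoidAlgebra.singleOneRingHom (R := R))]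
  exact add_mem (P.filt_antitone (Nat.zero_le _)
    (P.groupSubOne_mem_filt (k := 0) (by rw [P.top]; trivial))) (P.singleOneRingHom_mem_filt 1)

theorem mul_mem_filt_left (hπ : ∀ r, π * r = r * π) (a : MonoidAlgebra R H) {j : ℕ}
    {x : MonoidAlgebra R H} (hx : x ∈ P.filt π c f W j) : a * x ∈ P.filt π c f W j := by
  simpa using P.mul_mem_filt hπ (P.mem_filt_zero hπ a) hx

theorem mul_mem_filt_right (hπ : ∀ r, π * r = r * π) (a : MonoidAlgebra R H) {j : ℕ}
    {x : MonoidAlgebra R H} (hx : x ∈ P.filt π c f W j) : x * a ∈ P.filt π c f W j := by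
  simpa using P.mul_mem_filt hπ hx (P.mem_filt_zero hπ a)

theorem singleOneRingHom_pi_mul_mem_filt (hπ : ∀ r, π * r = r * π) {j : ℕ} {x : MonoidAlgebra R H}
    (hx : x ∈ P.filt π c f W j) :
    MonoidAlgebra.singleOneRingHom π * x ∈ P.filt π c f W (c + j) :=
  P.mul_mem_filt hπ (P.letterPi_mem_filt none) hx

/-- Modulo the elements `u - 1`, every element of the group ring is a scalar. -/
theorem exists_sub_singleOneRingHom_mem_filt (hπ : ∀ r, π * r = r * π) (hW : ∀ k, 0 < W k)
    (x : MonoidAlgebra R H) :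
    ∃ r : R, x - MonoidAlgebra.singleOneRingHom r ∈ P.filt π c f W 1 := by
  induction x using MonoidAlgebra.induction_linear with
  | zero => exact ⟨0, by rw [map_zero, sub_zero]; exact zero_mem _⟩
  | add x y hx hy =>
    obtain ⟨r, hr⟩ := hx
    obtain ⟨r', hr'⟩ := hy
    refine ⟨r + r', ?_⟩
    rw [map_add, add_sub_add_comm]; exact add_mem hr hr'
  | single g r =>
    refine ⟨r, ?_⟩
    have e : MonoidAlgebra.single g r - MonoidAlgebra.singleOneRingHom r =
        MonoidAlgebra.singleOneRingHom r * groupSubOne R g := by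
      simp [groupSubOne, mul_sub, MonoidAlgebra.single_mul_single]
    rw [e]
    exact P.mul_mem_filt_left hπ _ (P.filt_antitone (hW 0)
      (P.groupSubOne_mem_filt (by rw [P.top]; trivial)))

/-- The first term of the filtration is the augmentation ideal. -/
theorem mem_filt_one_iff (hπ : ∀ r, π * r = r * π) (hw : IsWeight P.lv c f W) {K : Type*} [Field K]
    {φ : R →+* K} (hker : ∀ r, φ r = 0 ↔ π ∣ r) (x : MonoidAlgebra R H) :
    x ∈ P.filt π c f W 1 ↔ augHom H φ x = 0 := by
  have hletter : ∀ s, augHom H φ (P.letter π s) = 0 := by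
    rintro ((_ | s) | u)
    · exact (augHom_single φ 1 π).trans ((hker π).2 dvd_rfl)
    · exact augHom_groupSubOne φ _
    · exact augHom_groupSubOne φ _
  have hle : P.filt π c f W 1 ≤ (augHom H φ : MonoidAlgebra R H →+ K).ker := by
    refine (AddSubgroup.closure_le _).2 ?_
    rintro _ ⟨r, l, hl, rfl⟩
    show augHom H φ _ = 0
    cases l with
    | nil => simp at hl
    | cons s l => rw [List.map_cons, List.prod_cons, map_mul, map_mul, hletter]; simp
  constructor
  · exact fun hx => hle hx
  · intro hx
    obtain ⟨r, hr⟩ := P.exists_sub_singleOneRingHom_mem_filt (c := c) (f := f) hπ hw.W_pos x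
    have h1 : augHom H φ (x - MonoidAlgebra.singleOneRingHom r) = - φ r := by
      rw [map_sub, hx, augHom_singleOneRingHom, zero_sub]
    have h2 : φ r = 0 := by
      have h0 : augHom H φ (x - MonoidAlgebra.singleOneRingHom r) = 0 := hle hr
      rw [h1] at h0
      simpa using h0
    obtain ⟨r', rfl⟩ := (hker r).1 h2
    have h3 : MonoidAlgebra.singleOneRingHom (π * r') ∈ P.filt π c f W 1 := by
      rw [map_mul]
      exact P.mul_mem_filt_right hπ _ (P.filt_antitone hw.c_pos (P.letterPi_mem_filt none))
    have := add_mem hr h3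
    rwa [sub_add_cancel] at this

/-- The commutators of letters have larger weight than expected. -/
theorem letterPi_commutator_mem_filt (hπ : ∀ r, π * r = r * π) (hw : IsWeight P.lv c f W)
    (s t : Option σ) : letterPi π P.e s * letterPi π P.e t - letterPi π P.e t * letterPi π P.e s ∈
      P.filt π c f W (s.elim c f + t.elim c f + 1) := by
  have hcen : ∀ x : MonoidAlgebra R H, letterPi π P.e none * x = x * letterPi π P.e none := by
    intro x
    have : x ∈ (AddMonoidHom.mulLeft (letterPi π P.e none) -
        AddMonoidHom.mulRight (letterPi π P.e none)).ker := by
      refine mem_of_forall_single_mem (fun r g => ?_) x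
      simp [AddMonoidHom.mem_ker, letterPi, MonoidAlgebra.single_mul_single, hπ]
    simpa [AddMonoidHom.mem_ker, sub_eq_zero] using this
  rcases s with _ | s
  · rw [hcen, sub_self]; exact zero_mem _
  rcases t with _ | t
  · rw [hcen, sub_self]; exact zero_mem _
  have h1 : ⁅P.e s, P.e t⁆ ∈ P.U (max (P.lv s) (P.lv t) + 1) := by
    rcases le_total (P.lv s) (P.lv t) with h | h
    · rw [max_eq_right h, ← inv_mem_iff, commutatorElement_inv]
      exact P.central _ _ (P.e_mem t) _
    · rw [max_eq_left h]
      exact P.central _ _ (P.e_mem s) _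
  have h2 := P.mul_mem_filt_right hπ (MonoidAlgebra.single (P.e t * P.e s) 1)
    (P.groupSubOne_mem_filt (R := R) (π := π) (c := c) (f := f) (W := W) h1)
  rw [← groupSubOne_mul_sub_mul] at h2
  exact P.filt_antitone (hw.add_lt s t) h2

/-- All elements of the group ring commute with the letters modulo higher terms; for group elements
`g` the commutator with `e s` has higher level than `e s`. -/
theorem mul_letterPi_sub_mem_filt (hπ : ∀ r, π * r = r * π) (hw : IsWeight P.lv c f W)
    (a : MonoidAlgebra R H) (s : Option σ) :
    a * letterPi π P.e s - letterPi π P.e s * a ∈ P.filt π c f W (s.elim c f + 1) := by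
  let T : AddSubgroup (MonoidAlgebra R H) := (P.filt π c f W (s.elim c f + 1)).comap
    (AddMonoidHom.mulRight (letterPi π P.e s) - AddMonoidHom.mulLeft (letterPi π P.e s))
  have : a ∈ T := by
    refine mem_of_forall_single_mem (fun r g => ?_) a
    show MonoidAlgebra.singleOneRingHom r * MonoidAlgebra.single g 1 * letterPi π P.e s -
      letterPi π P.e s * (MonoidAlgebra.singleOneRingHom r * MonoidAlgebra.single g 1) ∈
        P.filt π c f W (s.elim c f + 1)
    rw [← mul_assoc, ← (commute_single_one_letterPi hπ P.e r s).eq, mul_assoc, mul_assoc, ← mul_sub]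
    refine P.mul_mem_filt_left hπ _ ?_
    cases s with
    | none =>
      have : MonoidAlgebra.single g 1 * letterPi π P.e none -
          letterPi π P.e none * MonoidAlgebra.single g 1 = 0 := by
        simp [letterPi, MonoidAlgebra.single_mul_single]
      rw [this]; exact zero_mem _
    | some s =>
      have e : (MonoidAlgebra.single g 1 : MonoidAlgebra R H) * groupSubOne R (P.e s) -
          groupSubOne R (P.e s) * MonoidAlgebra.single g 1 =
          -(groupSubOne R (P.e s) * groupSubOne R g - groupSubOne R g * groupSubOne R (P.e s)) := by
        rw [single_eq_groupSubOne_add_one]; noncomm_ring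
      show MonoidAlgebra.single g 1 * groupSubOne R (P.e s) -
        groupSubOne R (P.e s) * MonoidAlgebra.single g 1 ∈ P.filt π c f W (f s + 1)
      rw [e, groupSubOne_mul_sub_mul]
      refine neg_mem (P.mul_mem_filt_right hπ _ (P.filt_antitone ?_
        (P.groupSubOne_mem_filt (P.central _ _ (P.e_mem s) g))))
      have := hw.two_mul_lt s
      show f s + 1 ≤ _
      omega
  exact this

end CentralBasis

end GroupRingFiltration

section Spanning

namespace CentralBasis

variable {p : ℕ} {H σ : Type*} [Group H] [LinearOrder σ] (P : CentralBasis p H σ)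
variable {R : Type*} [Ring R] {π : R} {c : ℕ} {f : σ → ℕ} {W : ℕ → ℕ}

theorem prod_letterPi_mem_filt (hπ : ∀ r, π * r = r * π) (l : List (Option σ)) :
    (l.map (letterPi π P.e)).prod ∈ P.filt π c f W (l.map fun s => s.elim c f).sum := by
  induction l with
  | nil => exact P.mem_filt_zero hπ _
  | cons s l ih => simpa using P.mul_mem_filt hπ (P.letterPi_mem_filt s) ih

theorem mul_prod_letterPi_sub_mem_filt (hπ : ∀ r, π * r = r * π) (hw : IsWeight P.lv c f W)
    (a : MonoidAlgebra R H) (l : List (Option σ)) :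
    a * (l.map (letterPi π P.e)).prod - (l.map (letterPi π P.e)).prod * a ∈
      P.filt π c f W ((l.map fun s => s.elim c f).sum + 1) := by
  induction l with
  | nil => simp
  | cons s l ih =>
    simp only [List.map_cons, List.prod_cons, List.sum_cons]
    have h1 := P.mul_mem_filt hπ (P.mul_letterPi_sub_mem_filt hπ hw a s)
      (P.prod_letterPi_mem_filt (c := c) (f := f) (W := W) hπ l)
    have h2 := P.mul_mem_filt hπ (P.letterPi_mem_filt (π := π) (c := c) (f := f) (W := W) s) ih
    have e : a * (letterPi π P.e s * (l.map (letterPi π P.e)).prod) -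
        letterPi π P.e s * (l.map (letterPi π P.e)).prod * a =
        (a * letterPi π P.e s - letterPi π P.e s * a) * (l.map (letterPi π P.e)).prod +
        letterPi π P.e s *
          (a * (l.map (letterPi π P.e)).prod - (l.map (letterPi π P.e)).prod * a) := by
      noncomm_ring
    rw [e]
    exact add_mem (P.filt_antitone (by omega) h1) (P.filt_antitone (by omega) h2)

theorem wordSpan_le_filt (hπ : ∀ r, π * r = r * π) (j : ℕ) :
    wordSpan (P.filt π c f W) (letterPi π P.e) (fun s => s.elim c f) j ≤ P.filt π c f W j := by
  refine sup_le ((AddSubgroup.closure_le _).2 ?_) (P.filt_antitone (Nat.le_succ j))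
  rintro _ ⟨a, l, rfl, rfl⟩
  exact P.mul_mem_filt_left hπ a (P.prod_letterPi_mem_filt hπ l)

theorem filt_succ_le_wordSpan {i j : ℕ} (h : j < i) :
    P.filt π c f W i ≤ wordSpan (P.filt π c f W) (letterPi π P.e) (fun s => s.elim c f) j :=
  (P.filt_antitone h).trans le_sup_right

theorem mul_mem_wordSpan (hπ : ∀ r, π * r = r * π) (hw : IsWeight P.lv c f W) {i j : ℕ}
    {x y : MonoidAlgebra R H}
    (hx : x ∈ wordSpan (P.filt π c f W) (letterPi π P.e) (fun s => s.elim c f) i)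
    (hy : y ∈ wordSpan (P.filt π c f W) (letterPi π P.e) (fun s => s.elim c f) j) :
    x * y ∈ wordSpan (P.filt π c f W) (letterPi π P.e) (fun s => s.elim c f) (i + j) := by
  have hyF := P.wordSpan_le_filt hπ j hy
  obtain ⟨x1, hx1, x2, hx2, rfl⟩ := AddSubgroup.mem_sup.1 hx
  rw [add_mul]
  refine add_mem ?_ (P.filt_succ_le_wordSpan (by omega) (P.mul_mem_filt hπ hx2 hyF))
  clear hx
  induction hx1 using AddSubgroup.closure_induction with
  | zero => simp
  | add a b _ _ h1 h2 => rw [add_mul]; exact add_mem h1 h2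
  | neg a _ h1 => rw [neg_mul]; exact neg_mem h1
  | mem x hx =>
    obtain ⟨a, l, rfl, rfl⟩ := hx
    obtain ⟨y1, hy1, y2, hy2, rfl⟩ := AddSubgroup.mem_sup.1 hy
    rw [mul_add]
    refine add_mem ?_ (P.filt_succ_le_wordSpan (by omega) (P.mul_mem_filt hπ
      (P.mul_mem_filt_left hπ a (P.prod_letterPi_mem_filt hπ l)) hy2))
    clear hy hyF
    induction hy1 using AddSubgroup.closure_induction with
    | zero => simp
    | add a b _ _ h1 h2 => rw [mul_add]; exact add_mem h1 h2
    | neg a _ h1 => rw [mul_neg]; exact neg_mem h1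
    | mem y hy =>
      obtain ⟨b, l', rfl, rfl⟩ := hy
      have h1 := P.mul_prod_letterPi_sub_mem_filt hπ hw b l
      have h2 := P.mul_mem_filt_left hπ a (P.mul_mem_filt hπ h1
        (P.prod_letterPi_mem_filt (c := c) (f := f) (W := W) hπ l'))
      have e : a * (l.map (letterPi π P.e)).prod * (b * (l'.map (letterPi π P.e)).prod) =
          a * b * ((l ++ l').map (letterPi π P.e)).prod - a * ((b * (l.map (letterPi π P.e)).prod -
            (l.map (letterPi π P.e)).prod * b) * (l'.map (letterPi π P.e)).prod) := by
        rw [List.map_append, List.prod_append]; noncomm_ring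
      rw [e]
      refine sub_mem (AddSubgroup.mem_sup_left (AddSubgroup.subset_closure
        ⟨_, l ++ l', by simp, rfl⟩)) (P.filt_succ_le_wordSpan (by omega) h2)

/-- Modulo higher terms, `u - 1` for `u ∈ U k` is a combination of words of weight `W k`: the elements
`u` for which this holds form a subgroup containing a set of generators of `U k`. -/
theorem groupSubOne_mem_wordSpan (hp : p.Prime) (hπ : ∀ r, π * r = r * π) (hpπ : π ∣ (p : R))
    (hw : IsWeight P.lv c f W) {k : ℕ} {u : H} (hu : u ∈ P.U k) :
    groupSubOne R u ∈ wordSpan (P.filt π c f W) (letterPi π P.e) (fun s => s.elim c f) (W k) := by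
  have main : ∀ d, ∀ k, P.n ≤ k + d → ∀ u ∈ P.U k, groupSubOne R u ∈
      wordSpan (P.filt π c f W) (letterPi π P.e) (fun s => s.elim c f) (W k) := by
    intro d
    induction d with
    | zero =>
      intro k hk u hu
      have : u ∈ P.U P.n := P.anti (by omega) hu
      rw [P.bot, Subgroup.mem_bot] at this
      rw [this, groupSubOne_one]; exact zero_mem _
    | succ d ih =>
      intro k hk u hu
      have hmulF : ∀ {x y : H}, x ∈ P.U k → y ∈ P.U k →
          groupSubOne R x * groupSubOne R y ∈ P.filt π c f W (W k + 1) := fun hx hy =>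
        P.filt_antitone (by have := hw.W_pos k; omega)
          (P.mul_mem_filt hπ (P.groupSubOne_mem_filt hx) (P.groupSubOne_mem_filt hy))
      let Q : Subgroup H :=
        { carrier := {x | x ∈ P.U k ∧ groupSubOne R x ∈
            wordSpan (P.filt π c f W) (letterPi π P.e) (fun s => s.elim c f) (W k)}
          one_mem' := ⟨one_mem _, by rw [groupSubOne_one]; exact zero_mem _⟩
          mul_mem' := by
            rintro x y ⟨hx, hx'⟩ ⟨hy, hy'⟩
            refine ⟨mul_mem hx hy, ?_⟩
            rw [groupSubOne_mul]
            exact add_mem (add_mem (AddSubgroup.mem_sup_right (hmulF hx hy)) hx') hy'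
          inv_mem' := by
            rintro x ⟨hx, hx'⟩
            refine ⟨inv_mem hx, ?_⟩
            have h1 := groupSubOne_mul (R := R) x x⁻¹
            rw [mul_inv_cancel, groupSubOne_one] at h1
            have h2 : groupSubOne R x⁻¹ =
                -(groupSubOne R x * groupSubOne R x⁻¹ + groupSubOne R x) :=
              (neg_eq_of_add_eq_zero_right h1.symm).symm
            rw [h2]
            exact neg_mem (add_mem (AddSubgroup.mem_sup_right (hmulF hx (inv_mem hx))) hx') }
      have hQ : P.U k ≤ Q := by
        refine P.U_le_of_generators hp k (fun s hs => ⟨hs ▸ P.e_mem s, ?_⟩) (fun w hw' => ?_)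
          (fun x hx => ⟨P.anti (Nat.le_succ k) hx, ?_⟩)
        · have hle : W k ≤ f s := by rw [← hs]; exact hw.W_le s
          rcases hle.eq_or_lt with h | h
          · refine AddSubgroup.mem_sup_left (AddSubgroup.subset_closure
              ⟨1, [some s], by simp [h], by simp [letterPi]⟩)
          · exact AddSubgroup.mem_sup_right (P.filt_antitone h (P.letterPi_mem_filt (some s)))
        · refine ⟨pow_mem hw' _, AddSubgroup.mem_sup_right ?_⟩
          have hpow : ∀ i : ℕ, groupSubOne R (w ^ i) - (i : MonoidAlgebra R H) * groupSubOne R w ∈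
              P.filt π c f W (W k + 1) := by
            intro i
            induction i with
            | zero => simp [groupSubOne_one]
            | succ i ih =>
              have e : groupSubOne R (w ^ (i + 1)) -
                  ((i + 1 : ℕ) : MonoidAlgebra R H) * groupSubOne R w =
                  groupSubOne R (w ^ i) * groupSubOne R w +
                  (groupSubOne R (w ^ i) - (i : MonoidAlgebra R H) * groupSubOne R w) := by
                rw [pow_succ, groupSubOne_mul]; push_cast; noncomm_ring
              rw [e]
              exact add_mem (hmulF (pow_mem hw' i) hw') ih
          obtain ⟨r, hr⟩ := hpπ
          have h1 : ((p : MonoidAlgebra R H)) * groupSubOne R w ∈ P.filt π c f W (W k + 1) := by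
            have h2 : (p : MonoidAlgebra R H) = MonoidAlgebra.singleOneRingHom π *
                MonoidAlgebra.singleOneRingHom r := by
              rw [← map_mul, ← hr, map_natCast]
            rw [h2, mul_assoc]
            refine P.filt_antitone ?_ (P.singleOneRingHom_pi_mul_mem_filt hπ
              (P.mul_mem_filt_left hπ _ (P.groupSubOne_mem_filt hw')))
            have := hw.c_pos
            omega
          have := add_mem (hpow p) h1
          rwa [sub_add_cancel] at this
        · have hle : W k ≤ W (k + 1) := hw.W_mono (Nat.le_succ k)
          rcases hle.eq_or_lt with h | h
          · rw [h]; exact ih (k + 1) (by omega) x hx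
          · exact AddSubgroup.mem_sup_right (P.filt_antitone h (P.groupSubOne_mem_filt hx))
      exact (hQ hu).2
  exact main P.n k (by omega) u hu

/-- The classes of the words in `π` and the `e s - 1` generate the graded ring. -/
theorem filt_le_wordSpan (hp : p.Prime) (hπ : ∀ r, π * r = r * π) (hpπ : π ∣ (p : R))
    (hw : IsWeight P.lv c f W) (j : ℕ) : P.filt π c f W j ≤
      wordSpan (P.filt π c f W) (letterPi π P.e) (fun s => s.elim c f) j := by
  have hone : ∀ a : MonoidAlgebra R H, a ∈
      wordSpan (P.filt π c f W) (letterPi π P.e) (fun s => s.elim c f) 0 := fun a =>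
    AddSubgroup.mem_sup_left (AddSubgroup.subset_closure ⟨a, [], by simp, by simp⟩)
  have hword : ∀ l : List (Option σ ⊕ (Σ k, P.U k)), (l.map (P.letter π)).prod ∈
      wordSpan (P.filt π c f W) (letterPi π P.e) (fun s => s.elim c f) (l.map (P.letterWt c f W)).sum := by
    intro l
    induction l with
    | nil => exact hone _
    | cons s l ih =>
      simp only [List.map_cons, List.prod_cons, List.sum_cons]
      refine P.mul_mem_wordSpan hπ hw ?_ ih
      rcases s with s | u
      · exact AddSubgroup.mem_sup_left (AddSubgroup.subset_closure
          ⟨1, [s], by simp [letterWt], by simp [letter]⟩)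
      · exact P.groupSubOne_mem_wordSpan hp hπ hpπ hw u.2.2
  refine (AddSubgroup.closure_le _).2 ?_
  rintro _ ⟨r, l, hl, rfl⟩
  have h1 := P.mul_mem_wordSpan hπ hw (hone (MonoidAlgebra.singleOneRingHom r)) (hword l)
  rw [zero_add] at h1
  rcases hl.eq_or_lt with h | h
  · rw [h]; exact h1
  · exact P.filt_succ_le_wordSpan h (P.wordSpan_le_filt hπ _ h1)

/-- The filtration is finer than that by the powers of the augmentation ideal, since the weights of
letters are bounded. -/
theorem mem_ker_pow_of_mem_filt (hw : IsWeight P.lv c f W) {K : Type*} [Field K] {φ : R →+* K}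
    (hker : ∀ r, φ r = 0 ↔ π ∣ r) (n : ℕ) {x : MonoidAlgebra R H}
    (hx : x ∈ P.filt π c f W (n * c)) : x ∈ RingHom.ker (augHom H φ) ^ n := by
  have hle : P.filt π c f W (n * c) ≤
      (RingHom.ker (augHom H φ) ^ n : Ideal (MonoidAlgebra R H)).toAddSubgroup := by
    refine (AddSubgroup.closure_le _).2 ?_
    rintro _ ⟨r, l, hl, rfl⟩
    have hlen : n ≤ l.length := by
      have h1 : (l.map (P.letterWt c f W)).sum ≤ l.length * c := by
        have := List.sum_le_card_nsmul (l.map (P.letterWt c f W)) c (by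
          intro x hx
          obtain ⟨s, -, rfl⟩ := List.mem_map.1 hx
          rcases s with (_ | s) | u
          · exact le_rfl
          · exact hw.f_le s
          · exact hw.le u.1)
        simpa using this
      exact Nat.le_of_mul_le_mul_right (hl.trans h1) hw.c_pos
    have h2 := list_prod_mem_ideal_pow (RingHom.ker (augHom H φ)) (l.map (P.letter π)) (by
      intro x hx
      obtain ⟨s, -, rfl⟩ := List.mem_map.1 hx
      rw [RingHom.mem_ker]
      rcases s with (_ | s) | u
      · exact (augHom_single φ 1 π).trans ((hker π).2 dvd_rfl)
      · exact augHom_groupSubOne φ _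
      · exact augHom_groupSubOne φ _)
    rw [List.length_map] at h2
    exact Ideal.mul_mem_left _ _ (Ideal.pow_le_pow_right hlen h2)
  exact hle hx

theorem mem_filt_of_mem_ker_pow (hπ : ∀ r, π * r = r * π) (hw : IsWeight P.lv c f W)
    {K : Type*} [Field K] {φ : R →+* K} (hker : ∀ r, φ r = 0 ↔ π ∣ r) (n : ℕ)
    {x : MonoidAlgebra R H} (hx : x ∈ RingHom.ker (augHom H φ) ^ n) : x ∈ P.filt π c f W n := by
  induction n generalizing x with
  | zero => exact P.mem_filt_zero hπ x
  | succ n ih =>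
    rw [Submodule.pow_succ] at hx
    induction hx using Submodule.mul_induction_on' with
    | mem_mul_mem a ha b hb =>
      exact P.mul_mem_filt hπ (ih ha) ((P.mem_filt_one_iff hπ hw hker b).2 hb)
    | add a _ b _ h1 h2 => exact add_mem h1 h2

end CentralBasis

end Spanning

/-! ### Comparison of the group ring with the group rings of boxes -/

section Transfer

namespace CoordSystem

variable {p : ℕ} {G σ : Type*} [Group G] [LinearOrder σ] (S : CoordSystem p G σ)

/-- A property holds for all boxes containing a certain finite set of elements, and certain finitely
many generators. -/
def Eventually (Q : S.Box → Prop) : Prop :=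
  ∃ X : Set G, X.Finite ∧ ∃ F0 : Finset σ, ∀ B : S.Box, F0 ⊆ B.F → X ⊆ B.K → Q B

variable {S}

theorem Eventually.and {Q Q' : S.Box → Prop} (h : S.Eventually Q) (h' : S.Eventually Q') :
    S.Eventually fun B => Q B ∧ Q' B := by
  classical
  obtain ⟨X, hX, F, hQ⟩ := h
  obtain ⟨X', hX', F', hQ'⟩ := h'
  exact ⟨X ∪ X', hX.union hX', F ∪ F', fun B hF hB =>
    ⟨hQ B (Finset.union_subset_left hF) (Set.subset_union_left.trans hB),
      hQ' B (Finset.union_subset_right hF) (Set.subset_union_right.trans hB)⟩⟩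

theorem Eventually.mono {Q Q' : S.Box → Prop} (h : S.Eventually Q) (hQ : ∀ B, Q B → Q' B) :
    S.Eventually Q' := by
  obtain ⟨X, hX, F, h⟩ := h
  exact ⟨X, hX, F, fun B hF hB => hQ B (h B hF hB)⟩

theorem Eventually.of_forall {Q : S.Box → Prop} (h : ∀ B, Q B) : S.Eventually Q :=
  ⟨∅, Set.finite_empty, ∅, fun _ _ _ => h _⟩

theorem Eventually.exists {Q : S.Box → Prop} (hp : 0 < p) (h : S.Eventually Q) : ∃ B, Q B := by
  obtain ⟨X, hX, F, h⟩ := h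
  obtain ⟨B, hF, hB⟩ := S.exists_box hp X hX F
  exact ⟨B, h B hF hB⟩

theorem eventually_mem_F (s : σ) : S.Eventually fun B => s ∈ B.F :=
  ⟨∅, Set.finite_empty, {s}, fun _ h _ => h (Finset.mem_singleton_self s)⟩

theorem eventually_subset_F (F : Finset σ) : S.Eventually fun B => F ⊆ B.F :=
  ⟨∅, Set.finite_empty, F, fun _ h _ => h⟩

theorem eventually_mem_K (x : G) : S.Eventually fun B => x ∈ B.K :=
  ⟨{x}, Set.finite_singleton x, ∅, fun _ _ h => h (Set.mem_singleton x)⟩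

/-- The inclusion of the group ring of a box. -/
noncomputable def Box.incl (B : S.Box) (R : Type*) [Ring R] :
    MonoidAlgebra R B.K →+* MonoidAlgebra R G :=
  MonoidAlgebra.mapDomainRingHom R B.K.subtype

theorem Box.incl_injective (B : S.Box) (R : Type*) [Ring R] : Function.Injective (B.incl R) :=
  MonoidAlgebra.mapDomain_injective Subtype.val_injective

theorem Box.incl_single (B : S.Box) {R : Type*} [Ring R] (g : B.K) (r : R) :
    B.incl R (MonoidAlgebra.single g r) = MonoidAlgebra.single (g : G) r :=
  MonoidAlgebra.mapDomain_single

theorem Box.incl_singleOneRingHom (B : S.Box) {R : Type*} [Ring R] (r : R) :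
    B.incl R (MonoidAlgebra.singleOneRingHom r) = MonoidAlgebra.singleOneRingHom r :=
  B.incl_single 1 r

theorem Box.incl_groupSubOne (B : S.Box) (R : Type*) [Ring R] (g : B.K) :
    B.incl R (groupSubOne R g) = groupSubOne R (g : G) := by
  rw [groupSubOne, map_sub, map_one, B.incl_single]; rfl

end CoordSystem

namespace CentralBasis

variable {p : ℕ} {H σ : Type*} [Group H] [LinearOrder σ] {P : CentralBasis p H σ}
variable {N : Subgroup H} [hN : N.Normal] {S : CoordSystem p (H ⧸ N) σ}
variable {R : Type*} [Ring R] {π : R} {c : ℕ} {f : σ → ℕ} {W : ℕ → ℕ}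

/-- The homomorphism of group rings induced by the projection onto the quotient by `N`. -/
noncomputable def proj (N : Subgroup H) [N.Normal] (R : Type*) [Ring R] :
    MonoidAlgebra R H →+* MonoidAlgebra R (H ⧸ N) :=
  MonoidAlgebra.mapDomainRingHom R (QuotientGroup.mk' N)

theorem proj_single (h : H) (r : R) :
    proj N R (MonoidAlgebra.single h r) = MonoidAlgebra.single (h : H ⧸ N) r :=
  MonoidAlgebra.mapDomain_single

theorem proj_singleOneRingHom (r : R) :
    proj N R (MonoidAlgebra.singleOneRingHom r) = MonoidAlgebra.singleOneRingHom r :=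
  proj_single 1 r

theorem proj_groupSubOne (h : H) : proj N R (groupSubOne R h) = groupSubOne R (h : H ⧸ N) := by
  rw [groupSubOne, map_sub, map_one, proj_single]; rfl

theorem incl_letterPi (he : ∀ s, S.e s = P.e s) (B : S.Box) (s : Option σ)
    (hs : ∀ a, s = some a → a ∈ B.F) :
    B.incl R (letterPi π B.gen s) = proj N R (letterPi π P.e s) := by
  cases s with
  | none => exact (B.incl_singleOneRingHom π).trans (proj_singleOneRingHom π).symm
  | some a =>
    show B.incl R (groupSubOne R (B.gen a)) = proj N R (groupSubOne R (P.e a))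
    rw [B.incl_groupSubOne, proj_groupSubOne, B.gen_of_mem (hs a rfl), he]

theorem incl_prod_letterPi (he : ∀ s, S.e s = P.e s) (B : S.Box) (l : List (Option σ))
    (hl : ∀ a, some a ∈ l → a ∈ B.F) :
    B.incl R (l.map (letterPi π B.gen)).prod = proj N R (l.map (letterPi π P.e)).prod := by
  rw [map_list_prod, map_list_prod, List.map_map, List.map_map]
  congr 1
  refine List.map_congr_left fun s hs => ?_
  exact incl_letterPi he B s fun a ha => hl a (ha ▸ hs)

theorem eventually_exists_mem_wordFilt_letter (hπ : ∀ r, π * r = r * π) (hw : IsWeight S.lv c f W)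
    (he : ∀ s, S.e s = P.e s) (hΓ : ∀ k, ∀ x ∈ P.U k, (x : H ⧸ N) ∈ S.Γ k)
    (s : Option σ ⊕ (Σ k, P.U k)) : S.Eventually fun B => ∃ y ∈ wordFilt MonoidAlgebra.singleOneRingHom
    (letterPi π B.gen) (fun o => o.elim c f) (P.letterWt c f W s),
      B.incl R y = proj N R (P.letter π s) := by
  rcases s with ((_ | s) | u)
  · exact CoordSystem.Eventually.of_forall fun B => ⟨letterPi π B.gen none,
      letter_mem_wordFilt none le_rfl, incl_letterPi he B none (by simp)⟩
  · exact (CoordSystem.eventually_mem_F s).mono fun B hB => ⟨letterPi π B.gen (some s),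
      letter_mem_wordFilt (some s) le_rfl, incl_letterPi he B (some s) (by simpa using hB)⟩
  · refine (CoordSystem.eventually_mem_K ((u.2 : H) : H ⧸ N)).mono fun B hB =>
      ⟨groupSubOne R (⟨_, hB⟩ : B.K), B.groupSubOne_mem_wordFilt hπ hw u.1 _ (hΓ _ _ u.2.2), ?_⟩
    rw [B.incl_groupSubOne]
    exact (proj_groupSubOne _).symm

theorem eventually_exists_mem_wordFilt_prod (hπ : ∀ r, π * r = r * π) (hw : IsWeight S.lv c f W)
    (he : ∀ s, S.e s = P.e s) (hΓ : ∀ k, ∀ x ∈ P.U k, (x : H ⧸ N) ∈ S.Γ k)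
    (l : List (Option σ ⊕ (Σ k, P.U k))) : S.Eventually fun B =>
    ∃ y ∈ wordFilt MonoidAlgebra.singleOneRingHom
    (letterPi π B.gen) (fun o => o.elim c f) (l.map (P.letterWt c f W)).sum,
      B.incl R y = proj N R (l.map (P.letter π)).prod := by
  induction l with
  | nil =>
    exact CoordSystem.Eventually.of_forall fun B => ⟨1, by
      simpa using prod_mem_wordFilt (ρ := MonoidAlgebra.singleOneRingHom) (t := letterPi π B.gen)
        (wt := fun o => o.elim c f) [] (j := 0) (by simp), by simp⟩
  | cons s l ih =>
    refine ((eventually_exists_mem_wordFilt_letter hπ hw he hΓ s).and ih).mono ?_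
    rintro B ⟨⟨y, hy, hyx⟩, y', hy', hyx'⟩
    refine ⟨y * y', ?_, by rw [map_mul, hyx, hyx', List.map_cons, List.prod_cons, map_mul]⟩
    rw [List.map_cons, List.sum_cons]
    exact mul_mem_wordFilt (commute_single_one_letterPi hπ _) hy hy'

/-- The image of an element of the filtration of `R[H]` comes from elements of the filtrations of the
group rings of all sufficiently large boxes. -/
theorem eventually_exists_mem_wordFilt (hπ : ∀ r, π * r = r * π) (hw : IsWeight S.lv c f W)
    (he : ∀ s, S.e s = P.e s) (hΓ : ∀ k, ∀ x ∈ P.U k, (x : H ⧸ N) ∈ S.Γ k) {j : ℕ}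
    {x : MonoidAlgebra R H} (hx : x ∈ P.filt π c f W j) :
    S.Eventually fun B => ∃ y ∈ wordFilt MonoidAlgebra.singleOneRingHom (letterPi π B.gen)
      (fun o => o.elim c f) j, B.incl R y = proj N R x := by
  induction hx using AddSubgroup.closure_induction with
  | mem x hx =>
    obtain ⟨r, l, hl, rfl⟩ := hx
    refine (eventually_exists_mem_wordFilt_prod hπ hw he hΓ l).mono ?_
    rintro B ⟨y, hy, hyx⟩
    refine ⟨MonoidAlgebra.singleOneRingHom r * y,
      wordFilt_antitone hl (scalar_mul_mem_wordFilt r hy), ?_⟩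
    rw [map_mul, map_mul, hyx, B.incl_singleOneRingHom, proj_singleOneRingHom]
  | zero => exact CoordSystem.Eventually.of_forall fun B => ⟨0, zero_mem _, by simp⟩
  | add x x' _ _ h h' =>
    refine (h.and h').mono ?_
    rintro B ⟨⟨y, hy, hyx⟩, y', hy', hyx'⟩
    exact ⟨y + y', add_mem hy hy', by rw [map_add, map_add, hyx, hyx']⟩
  | neg x _ h =>
    refine h.mono ?_
    rintro B ⟨y, hy, hyx⟩
    exact ⟨-y, neg_mem hy, by rw [map_neg, map_neg, hyx]⟩

end CentralBasis

end Transfer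

section Independence

namespace CoordSystem.Box

variable {p : ℕ} {G σ : Type*} [Group G] [LinearOrder σ] {S : CoordSystem p G σ} (B : S.Box)
variable {R : Type*} [Ring R] {π : R} {c : ℕ} {f : σ → ℕ} {W : ℕ → ℕ}

/-- Up to terms of higher weight, a word is the ordered monomial with the same exponents. -/
theorem wordOf_sub_mem_wordFilt (hπ : ∀ r, π * r = r * π) (hw : IsWeight S.lv c f W)
    (α : Option σ →₀ ℕ) (hα : ∀ s, some s ∈ α.support → s ∈ B.F) :
    wordOf (letterPi π B.gen) α - MonoidAlgebra.singleOneRingHom (π ^ α none) *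
      (B.list.map fun s => groupSubOne R (B.gen s) ^ α (some s)).prod ∈
      wordFilt MonoidAlgebra.singleOneRingHom (letterPi π B.gen) (fun o => o.elim c f)
        (Finsupp.weight (fun o : Option σ => o.elim c f) α + 1) ∧
    α none * c + (B.list.map fun s => α (some s) * f s).sum =
      Finsupp.weight (fun o : Option σ => o.elim c f) α := by
  classical
  have hcount : ∀ o, α.toMultiset.toList.count o = α o := fun o => by
    have h := Finsupp.count_toMultiset α o
    rw [← Multiset.coe_toList (Finsupp.toMultiset α), Multiset.coe_count] at h
    convert h
  have hperm := perm_canonical (l := B.list) α.toMultiset.toList (fun s hs => B.mem_list.2 (hα s (by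
    rwa [Multiset.mem_toList, Finsupp.mem_toMultiset] at hs))) B.nodup_list
  simp only [hcount] at hperm
  have hcomm : ∀ s s', letterPi π B.gen s * letterPi π B.gen s' -
      letterPi π B.gen s' * letterPi π B.gen s ∈ wordFilt MonoidAlgebra.singleOneRingHom
        (letterPi π B.gen) (fun o => o.elim c f) (s.elim c f + s'.elim c f + 1) := by
    have hnone : ∀ s, letterPi π B.gen none * letterPi π B.gen s =
        letterPi π B.gen s * letterPi π B.gen none := fun s =>
      (commute_single_one_letterPi hπ B.gen π s).eq
    rintro (_ | s) (_ | s')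
    · rw [sub_self]; exact zero_mem _
    · rw [hnone, sub_self]; exact zero_mem _
    · rw [hnone, sub_self]; exact zero_mem _
    · exact B.commutator_mem_wordFilt hπ hw s s'
  have h1 := prod_sub_prod_mem_of_perm (commute_single_one_letterPi hπ B.gen) hcomm hperm
  have h2 := (hperm.map (fun o : Option σ => o.elim c f)).sum_eq
  rw [sum_map_toList_toMultiset] at h1 h2
  rw [prod_map_canonical] at h1
  rw [sum_map_canonical] at h2
  exact ⟨h1, h2.symm⟩

end CoordSystem.Box

namespace CentralBasis

variable {p : ℕ} {H σ : Type*} [Group H] [LinearOrder σ] (P : CentralBasis p H σ)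
variable {R : Type*} [Ring R] {π : R} {c : ℕ} {f : σ → ℕ} {W : ℕ → ℕ}

/-- If a combination of distinct words of weight `j` with scalar coefficients lies in the next term
of the filtration, then the coefficients are divisible by `π`. The same holds modulo `π` for words
not containing `π`. In the group ring of a sufficiently large finite section of `H` the coefficients
are the coordinates with respect to reduced monomials. -/
theorem dvd_of_sum_wordOf_mem [Fact p.Prime] (hπ : ∀ r, π * r = r * π) (hreg : ∀ r, π * r = 0 → r = 0)
    (hpπ : π ∣ (p : R)) (hw : IsWeight P.lv c f W) {j : ℕ} (A : Finset (Option σ →₀ ℕ))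
    (hA : ∀ α ∈ A, Finsupp.weight (fun o : Option σ => o.elim c f) α = j)
    (r : (Option σ →₀ ℕ) → R) {z y : MonoidAlgebra R H} (hz : z ∈ P.filt π c f W (j + 1))
    (hy : y = 0 ∨ ∀ α ∈ A, α none = 0)
    (hsum : ∑ α ∈ A, MonoidAlgebra.singleOneRingHom (r α) * wordOf (letterPi π P.e) α =
      z + MonoidAlgebra.singleOneRingHom π * y) :
    ∀ α ∈ A, π ∣ r α := by
  classical
  have hp : p.Prime := Fact.out
  obtain ⟨N, hN, S, hSL, hlv, he, hΓ, -⟩ := P.exists_coordSystem hp (2 * (j + 1))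
  have hlv' : S.lv = P.lv := funext hlv
  have hw' : IsWeight S.lv c f W := hlv' ▸ hw
  have hΓ' : ∀ k, ∀ x ∈ P.U k, (x : H ⧸ N) ∈ S.Γ k := fun k x hx => by
    rw [hΓ]; exact ⟨x, hx, rfl⟩
  have hy0 : S.Eventually fun B => ∃ y' : MonoidAlgebra R B.K, B.incl R y' = proj N R y ∧
      (y = 0 → y' = 0) := by
    by_cases h : y = 0
    · exact CoordSystem.Eventually.of_forall fun B => ⟨0, by rw [h, map_zero, map_zero], fun _ => rfl⟩
    · refine (eventually_exists_mem_wordFilt hπ hw' he hΓ'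
        (P.mem_filt_zero (c := c) (f := f) (W := W) hπ y)).mono ?_
      rintro B ⟨y', -, hy'⟩
      exact ⟨y', hy', fun h' => absurd h' h⟩
  obtain ⟨B, ⟨⟨z', hz', hzz⟩, y', hyy, hy0'⟩, hBF⟩ :=
    (((eventually_exists_mem_wordFilt hπ hw' he hΓ' hz).and hy0).and
      (CoordSystem.eventually_subset_F (A.biUnion fun α => α.support.biUnion fun o =>
        o.elim ∅ fun s => {s}))).exists hp.pos
  have hAF : ∀ α ∈ A, ∀ s, some s ∈ α.support → s ∈ B.F := fun α hα s hs =>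
    hBF (Finset.mem_biUnion.2 ⟨α, hα, Finset.mem_biUnion.2 ⟨some s, hs, by simp⟩⟩)
  have := B.finite
  obtain ⟨C, hC, hC', hCs, -⟩ := exists_coordinates R B.nodup_list B.bijective_prod_gen
  have hle : ∀ x ∈ wordFilt MonoidAlgebra.singleOneRingHom (letterPi π B.gen)
      (fun o => o.elim c f) (j + 1), x ∈ monoSpan π B.gen c f S.q B.list (j + 1) :=
    fun x hx => B.wordFilt_le hπ hpπ hw' (L := j + 1) (Or.inl hSL) le_rfl hx
  -- the given relation, in the group ring of the box and in terms of ordered monomials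
  have hrel : ∑ α ∈ A, MonoidAlgebra.singleOneRingHom (r α) * wordOf (letterPi π B.gen) α =
      z' + MonoidAlgebra.singleOneRingHom π * y' := by
    apply B.incl_injective R
    rw [map_add, map_mul, B.incl_singleOneRingHom, hzz, hyy, ← proj_singleOneRingHom (N := N),
      ← map_mul, ← map_add, ← hsum, map_sum, map_sum]
    refine Finset.sum_congr rfl fun α hα => ?_
    rw [map_mul, map_mul, B.incl_singleOneRingHom, proj_singleOneRingHom, wordOf, wordOf,
      incl_prod_letterPi he B _ fun a ha => hAF α hα a (by
        rwa [Multiset.mem_toList, Finsupp.mem_toMultiset] at ha)]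
  let mono : (Option σ →₀ ℕ) → MonoidAlgebra R B.K := fun α =>
    (B.list.map fun s => groupSubOne R (B.gen s) ^ α (some s)).prod
  obtain ⟨d, hd, hrel'⟩ : ∃ d ∈ monoSpan π B.gen c f S.q B.list (j + 1),
      ∑ α ∈ A, MonoidAlgebra.singleOneRingHom (r α * π ^ α none) * mono α =
        d + MonoidAlgebra.singleOneRingHom π * y' := by
    refine ⟨z' - ∑ α ∈ A, MonoidAlgebra.singleOneRingHom (r α) * (wordOf (letterPi π B.gen) α -
      MonoidAlgebra.singleOneRingHom (π ^ α none) * mono α),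
      sub_mem (hle _ hz') (sum_mem fun α hα => hle _ (scalar_mul_mem_wordFilt _ ?_)), ?_⟩
    · have := (B.wordOf_sub_mem_wordFilt (R := R) hπ hw' α (hAF α hα)).1
      rwa [hA α hα] at this
    · simp only [mul_sub, Finset.sum_sub_distrib, hrel, map_mul, mul_assoc]
      abel
  intro β hβ
  -- the exponents are at most the weight `j`, hence less than the orders of the generators
  have hred : ∀ α ∈ A, IsReducedExp S.q B.list fun s => α (some s) := by
    intro α hα
    refine ⟨fun s hs => ?_, fun s hs => ?_⟩
    · have h1 := (B.wordOf_sub_mem_wordFilt (R := R) hπ hw' α (hAF α hα)).2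
      rw [hA α hα] at h1
      have h2 : α (some s) * f s ≤ (B.list.map fun s => α (some s) * f s).sum :=
        List.single_le_sum (by simp) _ (List.mem_map.2 ⟨s, hs, rfl⟩)
      have h3 := Nat.mul_le_mul_left (α (some s)) (hw.pos s)
      have h4 : S.m s < p ^ S.m s := Nat.lt_pow_self hp.one_lt
      have h5 := hSL s
      show α (some s) < p ^ S.m s
      omega
    · by_contra h
      exact hs (B.mem_list.2 (hAF α hα s (Finsupp.mem_support_iff.2 h)))
  let b : {b : σ → ℕ // IsReducedExp S.q B.list b} := ⟨fun s => β (some s), hred β hβ⟩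
  -- distinct words of the same weight and equal exponents of the `e s - 1` would differ in the
  -- exponent of `π`, which is determined by the weight
  have hcoord : C b (∑ α ∈ A, MonoidAlgebra.singleOneRingHom (r α * π ^ α none) * mono α) =
      r β * π ^ β none := by
    rw [map_sum, Finset.sum_eq_single_of_mem β hβ]
    · exact hC b _
    · intro α hα hαβ
      refine hC' b ⟨fun s => α (some s), hred α hα⟩ _ fun h => hαβ ?_
      have hsome : ∀ s, α (some s) = β (some s) := fun s =>
        (congrFun (congrArg Subtype.val h) s).symm
      have h1 := (B.wordOf_sub_mem_wordFilt (R := R) hπ hw' α (hAF α hα)).2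
      have h2 := (B.wordOf_sub_mem_wordFilt (R := R) hπ hw' β (hAF β hβ)).2
      rw [hA α hα] at h1
      rw [hA β hβ] at h2
      simp only [hsome] at h1
      have h3 : α none * c = β none * c := by omega
      ext (_ | s)
      · exact Nat.eq_of_mul_eq_mul_right hw.c_pos h3
      · exact hsome s
  have hdvd : π ^ (β none + 1) ∣ C b d := by
    refine dvd_coordinate_of_mem_monoSpan hπ hC hC' hd b (β none) ?_
    have h2 := (B.wordOf_sub_mem_wordFilt (R := R) hπ hw' β (hAF β hβ)).2
    rw [hA β hβ] at h2
    show β none * c + (B.list.map fun s => β (some s) * f s).sum < j + 1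
    omega
  rw [hrel', map_add, hCs] at hcoord
  rcases hy with hy | hy
  -- `r β * π ^ β none` is divisible by `π ^ (β none + 1)`, and `π` is regular
  · rw [hy0' hy, map_zero, mul_zero, add_zero] at hcoord
    rw [hcoord] at hdvd
    obtain ⟨r', hr'⟩ := hdvd
    have hpow : ∀ (i : ℕ) (r : R), π ^ i * r = 0 → r = 0 := by
      intro i
      induction i with
      | zero => intro r h; simpa using h
      | succ i ih => intro r h; rw [pow_succ, mul_assoc] at h; exact hreg _ (ih _ h)
    refine ⟨r', ?_⟩
    rw [← sub_eq_zero]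
    refine hpow (β none) _ ?_
    have h6 : r β * π ^ β none = π ^ β none * r β := (Commute.pow_left (hπ (r β)) _).eq.symm
    rw [mul_sub, ← h6, hr', pow_succ, mul_assoc, sub_self]
  · rw [hy β hβ] at hcoord hdvd
    rw [zero_add, pow_one] at hdvd
    rw [pow_zero, mul_one] at hcoord
    rw [← hcoord]
    exact dvd_add hdvd (dvd_mul_right _ _)

end CentralBasis

end Independence

section Separation

theorem eq_sum_single {R G : Type*} [Ring R] [Group G] (x : MonoidAlgebra R G) :
    x = ∑ g ∈ x.coeff.support, MonoidAlgebra.single g (x.coeff g) :=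
  (MonoidAlgebra.sum_coeff_single x).symm

theorem exists_eq_pi_mul {R G : Type*} [Ring R] [Group G] {π : R} {x : MonoidAlgebra R G}
    (h : ∀ g, π ∣ x.coeff g) :
    ∃ y, x = MonoidAlgebra.singleOneRingHom π * y := by
  choose a ha using h
  refine ⟨∑ g ∈ x.coeff.support, MonoidAlgebra.single g (a g), ?_⟩
  rw [Finset.mul_sum]
  conv_lhs => rw [eq_sum_single x]
  refine Finset.sum_congr rfl fun g _ => ?_
  simp [MonoidAlgebra.single_mul_single, ← ha]

namespace CentralBasis

variable {p : ℕ} {H σ : Type*} [Group H] [LinearOrder σ] (P : CentralBasis p H σ)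
variable {R : Type*} [Ring R] {π : R} {c : ℕ} {f : σ → ℕ} {W : ℕ → ℕ}

/-- Modulo `π`, the weight of `π` does not matter. -/
theorem exists_mem_filt_add_pi_mul (hπ : ∀ r, π * r = r * π) (c' : ℕ) {j : ℕ}
    {z : MonoidAlgebra R H} (hz : z ∈ P.filt π c f W j) :
    ∃ z' ∈ P.filt π c' f W j, ∃ y, z = z' + MonoidAlgebra.singleOneRingHom π * y := by
  induction hz using AddSubgroup.closure_induction with
  | zero => exact ⟨0, zero_mem _, 0, by simp⟩
  | add a b _ _ h1 h2 =>
    obtain ⟨z, hz, y, rfl⟩ := h1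
    obtain ⟨z', hz', y', rfl⟩ := h2
    exact ⟨z + z', add_mem hz hz', y + y', by rw [mul_add]; abel⟩
  | neg a _ h1 =>
    obtain ⟨z, hz, y, rfl⟩ := h1
    exact ⟨-z, neg_mem hz, -y, by rw [mul_neg]; abel⟩
  | mem x hx =>
    obtain ⟨r, l, hl, rfl⟩ := hx
    by_cases h : Sum.inl none ∈ l
    · obtain ⟨l1, l2, rfl⟩ := List.append_of_mem h
      refine ⟨0, zero_mem _, MonoidAlgebra.singleOneRingHom r *
        ((l1.map (P.letter π)).prod * (l2.map (P.letter π)).prod), ?_⟩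
      have h1 := (commute_prod_map (P.commute_letter hπ) π l1).eq
      have h2 : MonoidAlgebra.singleOneRingHom π * MonoidAlgebra.singleOneRingHom r =
          (MonoidAlgebra.singleOneRingHom r * MonoidAlgebra.singleOneRingHom π :
            MonoidAlgebra R H) := by
        rw [← map_mul, hπ, map_mul]
      have h3 : P.letter π (Sum.inl none) = MonoidAlgebra.singleOneRingHom π := rfl
      rw [zero_add, List.map_append, List.map_cons, List.prod_append, List.prod_cons, h3,
        ← mul_assoc (MonoidAlgebra.singleOneRingHom π), h2, mul_assoc,
        ← mul_assoc (MonoidAlgebra.singleOneRingHom π), h1]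
      simp only [mul_assoc]
    · refine ⟨_, word_mem_wordFilt (t := P.letter π) (wt := P.letterWt c' f W) r l ?_, 0,
        by rw [mul_zero, add_zero]⟩
      have : l.map (P.letterWt c' f W) = l.map (P.letterWt c f W) := by
        refine List.map_congr_left fun s hs => ?_
        rcases s with (_ | s) | u
        · exact absurd hs h
        · rfl
        · rfl
      rw [this]; exact hl

/-- The intersection of the terms of the filtration modulo `π` is zero: in a fixed finite section of
`H` which separates the support of `x`, the image of `x` involves only monomials of bounded weight;
and modulo `π` their coefficients vanish if `x` lies in a deep term of the filtration. -/
theorem exists_eq_pi_mul_of_forall_mem [Fact p.Prime] (hπ : ∀ r, π * r = r * π)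
    (hpπ : π ∣ (p : R)) (hw : IsWeight P.lv c f W) {x : MonoidAlgebra R H}
    (hx : ∀ j, ∃ z ∈ P.filt π c f W j, ∃ y, x = z + MonoidAlgebra.singleOneRingHom π * y) :
    ∃ y, x = MonoidAlgebra.singleOneRingHom π * y := by
  classical
  have hp : p.Prime := Fact.out
  -- a section separating the support of `x`
  have hL0 : ∃ L, ∀ N : Subgroup H,
      (∀ k, ∀ y ∈ N, y ∈ P.U k → ∃ u ∈ P.U k, (u ^ p ^ L)⁻¹ * y ∈ P.U (k + 1)) →
      ∀ g ∈ x.coeff.support, ∀ h ∈ x.coeff.support, g ≠ h → g⁻¹ * h ∉ N := by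
    have h1 : ∀ w : H, ∃ L0, w ≠ 1 → ∀ L, L0 ≤ L → ∀ N : Subgroup H,
        (∀ k, ∀ y ∈ N, y ∈ P.U k → ∃ u ∈ P.U k, (u ^ p ^ L)⁻¹ * y ∈ P.U (k + 1)) → w ∉ N := by
      intro w
      by_cases hw : w = 1
      · exact ⟨0, fun h => absurd hw h⟩
      · obtain ⟨L0, h⟩ := P.exists_forall_notMem hw
        exact ⟨L0, fun _ => h⟩
    choose L0 hL0 using h1
    refine ⟨(x.coeff.support ×ˢ x.coeff.support).sup fun g => L0 (g.1⁻¹ * g.2),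
      fun N hN g hg h hh hgh => hL0 (g⁻¹ * h) (fun h' => hgh (inv_mul_eq_one.1 h')) _ ?_ N hN⟩
    exact Finset.le_sup (f := fun g : H × H => L0 (g.1⁻¹ * g.2)) (b := (g, h))
      (Finset.mem_product.2 ⟨hg, hh⟩)
  obtain ⟨L, hL⟩ := hL0
  obtain ⟨N, hN, S, -, hlv, he, hΓ, hNL⟩ := P.exists_coordSystem hp L
  have hsep := hL N hNL
  have hlv' : S.lv = P.lv := funext hlv
  have hw' : IsWeight S.lv c f W := hlv' ▸ hw
  have hΓ' : ∀ k, ∀ x ∈ P.U k, (x : H ⧸ N) ∈ S.Γ k := fun k x hx => by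
    rw [hΓ]; exact ⟨x, hx, rfl⟩
  choose a ha haa using fun h : H => S.exists_nf_eq (h : H ⧸ N)
  let wt : (σ →₀ ℕ) → ℕ := fun b => ∑ s ∈ b.support, b s * f s
  let j := (x.coeff.support.sup fun h => wt (a h)) + 1
  obtain ⟨z0, hz0, y0, hxz0⟩ := hx j
  -- modulo `π`, the weight of `π` may be increased to `c + j`; then the weights up to `j` are spanned
  -- by reduced monomials although the orders of the generators are fixed
  obtain ⟨z, hz, y1, hz1⟩ := P.exists_mem_filt_add_pi_mul hπ (c + j) hz0
  have hxz : x = z + MonoidAlgebra.singleOneRingHom π * (y0 + y1) := by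
    rw [hxz0, hz1, mul_add]; abel
  have hw'' := hw'.of_le (Nat.le_add_right c j)
  obtain ⟨B, ⟨⟨z', hz', hzz⟩, y', -, hyy⟩, hBF⟩ :=
    (((eventually_exists_mem_wordFilt hπ hw'' he hΓ' hz).and
      (eventually_exists_mem_wordFilt hπ hw'' he hΓ' (P.mem_filt_zero (c := c + j) (f := f) (W := W)
        hπ (y0 + y1)))).and
      (CoordSystem.eventually_subset_F (x.coeff.support.biUnion fun h => (a h).support))).exists hp.pos
  have haF : ∀ h ∈ x.coeff.support, (a h).support ⊆ B.F := fun h hh =>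
    (Finset.subset_biUnion_of_mem (fun h => (a h).support) hh).trans hBF
  have := B.finite
  obtain ⟨C, hC, hC', hCs, hCT⟩ := exists_coordinates R B.nodup_list B.bijective_prod_gen
  let x' : MonoidAlgebra R B.K := ∑ h ∈ x.coeff.support,
    MonoidAlgebra.singleOneRingHom (x.coeff h) *
      MonoidAlgebra.single (B.list.map fun s => B.gen s ^ a h s).prod 1
  have hxx : B.incl R x' = proj N R x := by
    conv_rhs => rw [eq_sum_single x]
    rw [map_sum, map_sum]
    refine Finset.sum_congr rfl fun h hh => ?_
    rw [map_mul, B.incl_single, B.incl_singleOneRingHom, B.coe_prod_gen (haF h hh), haa, proj_single]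
    simp [MonoidAlgebra.single_mul_single]
  have hx' : x' = z' + MonoidAlgebra.singleOneRingHom π * y' := by
    apply B.incl_injective R
    rw [hxx, map_add, map_mul, B.incl_singleOneRingHom, hzz, hyy, ← proj_singleOneRingHom (N := N),
      ← map_mul, ← map_add, ← hxz]
  have hdvd : ∀ b, π ∣ C b x' := by
    intro b
    by_cases hb : (B.list.map fun s => b.1 s * f s).sum < j
    · -- coordinates of small weight are divisible by `π`, as `x` is in a deep term modulo `π`
      rw [hx', map_add, hCs]
      have h1 := B.wordFilt_le hπ hpπ hw'' (L := j) (Or.inr (Nat.le_add_left j c)) le_rfl hz'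
      have h2 := dvd_coordinate_of_mem_monoSpan hπ hC hC' h1 b 0 (by simpa using hb)
      rw [zero_add, pow_one] at h2
      exact dvd_add h2 (dvd_mul_right _ _)
    · -- coordinates of large weight vanish
      have h0 : C b x' = 0 := by
        rw [map_sum]
        refine Finset.sum_eq_zero fun h hh => ?_
        rw [hCs]
        have h1 : ∃ s ∈ B.list, a h s < b.1 s := by
          by_contra! hle
          have h2 : (B.list.map fun s => b.1 s * f s).sum ≤ (B.list.map fun s => a h s * f s).sum :=
            List.sum_le_sum fun s hs => Nat.mul_le_mul_right _ (hle s hs)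
          have h3 : (B.list.map fun s => a h s * f s).sum = wt (a h) := by
            rw [← List.sum_toFinset _ B.nodup_list]
            refine (Finset.sum_subset (fun s hs => List.mem_toFinset.2 (B.mem_list.2
              (haF h hh hs))) fun s _ hs => ?_).symm
            rw [Finsupp.notMem_support_iff.1 hs, zero_mul]
          have h4 : wt (a h) ≤ x.coeff.support.sup fun h => wt (a h) :=
            Finset.le_sup (f := fun h => wt (a h)) hh
          omega
        obtain ⟨s, hs, hsb⟩ := h1
        have h2 : ∀ w ∈ monoSpan π B.gen c f (fun s => a h s + 1) B.list 0, C b w = 0 := by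
          intro w hw
          induction hw using AddSubgroup.closure_induction with
          | zero => exact map_zero _
          | add w w' _ _ h1 h2 => rw [map_add, h1, h2, add_zero]
          | neg w _ h1 => rw [map_neg, h1, neg_zero]
          | mem w hw =>
            obtain ⟨r, i, d, hd, -, rfl⟩ := hw
            obtain ⟨d', hd', hdd⟩ := exists_isReducedExp (q := S.q) (l := B.list) d fun t ht =>
              (Nat.lt_succ_iff.1 (hd t ht)).trans_lt (ha h t)
            have e : (B.list.map fun s => groupSubOne R (B.gen s) ^ d s) =
                B.list.map fun s => groupSubOne R (B.gen s) ^ d' s :=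
              List.map_congr_left fun t ht => by rw [hdd t ht]
            rw [e]
            refine hC' b ⟨d', hd'⟩ _ fun h => ?_
            have h3 : b.1 s = d' s := congrFun (congrArg Subtype.val h) s
            rw [hdd s hs] at h3
            have h4 : d s < a _ s + 1 := hd s hs
            omega
        rw [h2 _ (single_prod_pow_mem_monoSpan hπ B.nodup_list _ fun s _ => Nat.lt_succ_self _),
          mul_zero]
      rw [h0]; exact dvd_zero π
  -- hence the image of `x` in the finite section is divisible by `π`, and so is `x`
  obtain ⟨w, hw⟩ : ∃ w, MonoidAlgebra.singleOneRingHom π * w = x' := by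
    have : x' ∈ (AddMonoidHom.mulLeft (MonoidAlgebra.singleOneRingHom π :
        MonoidAlgebra R B.K)).range := by
      refine hCT _ _ fun b => ?_
      obtain ⟨r, hr⟩ := hdvd b
      refine ⟨MonoidAlgebra.singleOneRingHom r *
        (B.list.map fun s => groupSubOne R (B.gen s) ^ b.1 s).prod, ?_⟩
      rw [AddMonoidHom.coe_mulLeft, ← mul_assoc, ← map_mul, ← hr]
    exact this
  refine exists_eq_pi_mul fun h => ?_
  by_cases hh : h ∈ x.coeff.support
  · have h1 : (proj N R x).coeff (h : H ⧸ N) = x.coeff h := by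
      refine Finsupp.mapDomain_apply' (x.coeff.support : Set H) x.coeff subset_rfl ?_ hh
      intro g hg g' hg' hgg
      by_contra hne
      exact hsep g hg g' hg' hne (QuotientGroup.eq.1 hgg)
    rw [← h1, ← hxx, ← hw, map_mul, B.incl_singleOneRingHom]
    simp
  · rw [Finsupp.notMem_support_iff.1 hh]; exact dvd_zero π

end CentralBasis

end Separation

/-! ### The filtrations of the two group rings as ring filtrations -/

section Filtrations

namespace CentralBasis

variable {p : ℕ} {H σ : Type*} [Group H] [LinearOrder σ] (P : CentralBasis p H σ)
variable {R : Type*} [Ring R] {π : R} {c : ℕ} {f : σ → ℕ} {W : ℕ → ℕ}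

theorem prod_letterPi_sub_mem_of_perm (hπ : ∀ r, π * r = r * π) (hw : IsWeight P.lv c f W)
    {l l' : List (Option σ)} (h : l.Perm l') :
    (l.map (letterPi π P.e)).prod - (l'.map (letterPi π P.e)).prod ∈
      P.filt π c f W ((l.map fun s => s.elim c f).sum + 1) :=
  prod_sub_prod_mem_of_perm_of_mul_mem P.filt_antitone (P.mem_filt_zero hπ 1) (P.mul_mem_filt hπ)
    P.letterPi_mem_filt (P.letterPi_commutator_mem_filt hπ hw) h

theorem prod_letterPi_sub_wordOf_mem (hπ : ∀ r, π * r = r * π) (hw : IsWeight P.lv c f W)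
    {l : List (Option σ)} {α : Option σ →₀ ℕ} (h : (l : Multiset (Option σ)) = α.toMultiset) :
    (l.map (letterPi π P.e)).prod - wordOf (letterPi π P.e) α ∈
      P.filt π c f W ((l.map fun s => s.elim c f).sum + 1) :=
  P.prod_letterPi_sub_mem_of_perm hπ hw (Multiset.coe_eq_coe.1 (h.trans (Multiset.coe_toList _).symm))

/-- The independence of words, for a family of words indexed injectively. -/
theorem dvd_of_sum_mem [Fact p.Prime] (hπ : ∀ r, π * r = r * π) (hreg : ∀ r, π * r = 0 → r = 0)
    (hpπ : π ∣ (p : R)) (hw : IsWeight P.lv c f W) {j : ℕ} {I : Type*} (A : Finset I)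
    (w : I → Option σ →₀ ℕ) (hinj : Function.Injective w)
    (hA : ∀ i ∈ A, Finsupp.weight (fun o : Option σ => o.elim c f) (w i) = j)
    (r : I → R) {z y : MonoidAlgebra R H} (hz : z ∈ P.filt π c f W (j + 1))
    (hy : y = 0 ∨ ∀ i ∈ A, w i none = 0)
    (hsum : ∑ i ∈ A, MonoidAlgebra.singleOneRingHom (r i) * wordOf (letterPi π P.e) (w i) =
      z + MonoidAlgebra.singleOneRingHom π * y) (i : I) (hi : i ∈ A) : π ∣ r i := by
  classical
  have : Nonempty I := ⟨i⟩
  have hinv : ∀ i, Function.invFun w (w i) = i := Function.leftInverse_invFun hinj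
  have h := P.dvd_of_sum_wordOf_mem hπ hreg hpπ hw (A.image w) (by simpa using hA)
    (fun α => r (Function.invFun w α)) hz (by simpa using hy)
    (by rw [Finset.sum_image hinj.injOn]; simpa [hinv] using hsum)
    (w i) (Finset.mem_image_of_mem w hi)
  simpa [hinv] using h

/-- Modulo higher terms, every element of the filtration is a combination of words with scalar
coefficients. -/
theorem exists_sum_wordOf_sub_mem (hp : p.Prime) (hπ : ∀ r, π * r = r * π) (hpπ : π ∣ (p : R))
    (hw : IsWeight P.lv c f W) {j : ℕ} {x : MonoidAlgebra R H} (hx : x ∈ P.filt π c f W j) :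
    ∃ r : (Option σ →₀ ℕ) →₀ R,
      (∀ α ∈ r.support, Finsupp.weight (fun o : Option σ => o.elim c f) α = j) ∧
      x - r.sum (fun α a => MonoidAlgebra.singleOneRingHom a * wordOf (letterPi π P.e) α) ∈
        P.filt π c f W (j + 1) := by
  classical
  obtain ⟨x1, hx1, x2, hx2, rfl⟩ := AddSubgroup.mem_sup.1 (P.filt_le_wordSpan hp hπ hpπ hw j hx)
  suffices h : ∃ r : (Option σ →₀ ℕ) →₀ R,
      (∀ α ∈ r.support, Finsupp.weight (fun o : Option σ => o.elim c f) α = j) ∧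
      x1 - r.sum (fun α a => MonoidAlgebra.singleOneRingHom a * wordOf (letterPi π P.e) α) ∈
        P.filt π c f W (j + 1) by
    obtain ⟨r, h1, h2⟩ := h
    refine ⟨r, h1, ?_⟩
    rw [add_sub_right_comm]
    exact add_mem h2 hx2
  clear hx
  have hz : ∀ α : Option σ →₀ ℕ, (MonoidAlgebra.singleOneRingHom (0 : R)) *
      wordOf (letterPi π P.e) α = 0 := fun α => by rw [map_zero, zero_mul]
  have ha : ∀ (α : Option σ →₀ ℕ) (a b : R), MonoidAlgebra.singleOneRingHom (a + b) *
      wordOf (letterPi π P.e) α = MonoidAlgebra.singleOneRingHom a * wordOf (letterPi π P.e) α +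
        MonoidAlgebra.singleOneRingHom b * wordOf (letterPi π P.e) α := fun α a b => by
    rw [map_add, add_mul]
  induction hx1 using AddSubgroup.closure_induction with
  | zero => exact ⟨0, by simp, by simp⟩
  | add a b _ _ h1 h2 =>
    obtain ⟨r, h1, h1'⟩ := h1
    obtain ⟨r', h2, h2'⟩ := h2
    refine ⟨r + r', fun α hα => ?_, ?_⟩
    · rcases Finset.mem_union.1 (Finsupp.support_add hα) with h | h
      · exact h1 α h
      · exact h2 α h
    · rw [Finsupp.sum_add_index' hz ha, add_sub_add_comm]
      exact add_mem h1' h2'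
  | neg a _ h1 =>
    obtain ⟨r, h1, h1'⟩ := h1
    refine ⟨-r, fun α hα => h1 α (by rwa [Finsupp.support_neg] at hα), ?_⟩
    have e : (-r).sum (fun α a => MonoidAlgebra.singleOneRingHom a *
        wordOf (letterPi π P.e) α) = - r.sum fun α a => MonoidAlgebra.singleOneRingHom a *
        wordOf (letterPi π P.e) α := by
      rw [Finsupp.sum_neg_index hz, Finsupp.sum, Finsupp.sum, ← Finset.sum_neg_distrib]
      exact Finset.sum_congr rfl fun α _ => by rw [map_neg, neg_mul]
    rw [e, ← neg_sub']
    exact neg_mem h1'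
  | mem x hx =>
    obtain ⟨a, l, hl, rfl⟩ := hx
    obtain ⟨r, hr⟩ := P.exists_sub_singleOneRingHom_mem_filt (c := c) (f := f) hπ hw.W_pos a
    let α : Option σ →₀ ℕ := Multiset.toFinsupp (l : Multiset (Option σ))
    have hα : (l : Multiset (Option σ)) = α.toMultiset := (Multiset.toFinsupp_toMultiset _).symm
    have h1 := P.prod_letterPi_sub_wordOf_mem hπ hw hα
    have h2 : Finsupp.weight (fun o : Option σ => o.elim c f) α = j := by
      rw [← sum_map_toList_toMultiset, ← hl]
      refine List.Perm.sum_eq (List.Perm.map _ ?_)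
      exact Multiset.coe_eq_coe.1 ((Multiset.coe_toList _).trans hα.symm)
    refine ⟨Finsupp.single α r, fun β hβ => ?_, ?_⟩
    · rw [Finset.mem_singleton.1 (Finsupp.support_single_subset hβ), h2]
    · rw [Finsupp.sum_single_index (hz α)]
      have e : a * (l.map (letterPi π P.e)).prod -
          MonoidAlgebra.singleOneRingHom r * wordOf (letterPi π P.e) α =
          (a - MonoidAlgebra.singleOneRingHom r) * (l.map (letterPi π P.e)).prod +
          MonoidAlgebra.singleOneRingHom r *
            ((l.map (letterPi π P.e)).prod - wordOf (letterPi π P.e) α) := by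
        noncomm_ring
      rw [e]
      have h3 := P.mul_mem_filt hπ hr (P.prod_letterPi_mem_filt (c := c) (f := f) (W := W) hπ l)
      rw [hl] at h1 h3
      refine add_mem (P.filt_antitone (by omega) h3) (P.mul_mem_filt_left hπ _ h1)

/-- Multiplication by `π` is injective on the graded ring. -/
theorem mem_filt_succ_of_pi_mul_mem [Fact p.Prime] (hπ : ∀ r, π * r = r * π)
    (hreg : ∀ r, π * r = 0 → r = 0) (hpπ : π ∣ (p : R)) (hw : IsWeight P.lv c f W) {m : ℕ}
    {y : MonoidAlgebra R H} (hy : y ∈ P.filt π c f W m)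
    (hπy : MonoidAlgebra.singleOneRingHom π * y ∈ P.filt π c f W (c + m + 1)) :
    y ∈ P.filt π c f W (m + 1) := by
  classical
  obtain ⟨r, hr, hyr⟩ := P.exists_sum_wordOf_sub_mem Fact.out hπ hpπ hw hy
  -- multiplication by `π` appends the letter `π` to words
  have h1 : ∀ α, Finsupp.weight (fun o : Option σ => o.elim c f) α = m →
      MonoidAlgebra.singleOneRingHom π * wordOf (letterPi π P.e) α -
      wordOf (letterPi π P.e) (α + Finsupp.single none 1) ∈ P.filt π c f W (c + m + 1) := by
    intro α hα
    have h2 := P.prod_letterPi_sub_wordOf_mem hπ hw (l := none :: α.toMultiset.toList)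
      (α := α + Finsupp.single none 1) (by
        rw [← Multiset.cons_coe, Multiset.coe_toList, map_add, Finsupp.toMultiset_single, one_smul,
          add_comm, Multiset.singleton_add])
    rw [List.map_cons, List.map_cons, List.prod_cons, List.sum_cons, sum_map_toList_toMultiset,
      hα] at h2
    exact h2
  have h2 : ∑ α ∈ r.support, MonoidAlgebra.singleOneRingHom (r α) *
      wordOf (letterPi π P.e) (α + Finsupp.single none 1) ∈ P.filt π c f W (c + m + 1) := by
    have h3 : ∑ α ∈ r.support, MonoidAlgebra.singleOneRingHom (r α) *
        (MonoidAlgebra.singleOneRingHom π * wordOf (letterPi π P.e) α -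
          wordOf (letterPi π P.e) (α + Finsupp.single none 1)) ∈ P.filt π c f W (c + m + 1) :=
      sum_mem fun α hα => P.mul_mem_filt_left hπ _ (h1 α (hr α hα))
    have h4 := P.singleOneRingHom_pi_mul_mem_filt hπ hyr
    have h5 : ∑ α ∈ r.support, MonoidAlgebra.singleOneRingHom (r α) *
        (MonoidAlgebra.singleOneRingHom π * wordOf (letterPi π P.e) α) =
        MonoidAlgebra.singleOneRingHom π * r.sum (fun α a => MonoidAlgebra.singleOneRingHom a *
          wordOf (letterPi π P.e) α) := by
      rw [Finsupp.sum, Finset.mul_sum]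
      refine Finset.sum_congr rfl fun α _ => ?_
      rw [← mul_assoc, ← mul_assoc, ← map_mul, ← map_mul, hπ]
    simp only [mul_sub] at h3 h4
    rw [Finset.sum_sub_distrib, h5] at h3
    have h6 := sub_mem hπy (add_mem h4 h3)
    convert h6 using 1
    abel
  have h3 : ∀ α ∈ r.support, π ∣ r α := by
    refine P.dvd_of_sum_mem hπ hreg hpπ hw r.support (fun α => α + Finsupp.single none 1)
      (add_left_injective _) (j := c + m) (fun α hα => ?_) r (z := _) (y := 0) h2 (Or.inl rfl)
      (by rw [mul_zero, add_zero])
    rw [map_add, hr α hα, Finsupp.weight_single]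
    simp [add_comm]
  have h4 : r.sum (fun α a => MonoidAlgebra.singleOneRingHom a * wordOf (letterPi π P.e) α) ∈
      P.filt π c f W (m + 1) := by
    refine sum_mem fun α hα => ?_
    obtain ⟨b, hb⟩ := h3 α hα
    have h5 : wordOf (letterPi π P.e) α ∈ P.filt π c f W m := by
      have := P.prod_letterPi_mem_filt (π := π) (c := c) (f := f) (W := W) hπ α.toMultiset.toList
      rwa [sum_map_toList_toMultiset, hr α hα] at this
    change MonoidAlgebra.singleOneRingHom (r α) * wordOf (letterPi π P.e) α ∈ _
    rw [hb, map_mul, mul_assoc]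
    refine P.filt_antitone ?_ (P.singleOneRingHom_pi_mul_mem_filt hπ (P.mul_mem_filt_left hπ _ h5))
    have := hw.c_pos
    omega
  have := add_mem hyr h4
  rwa [sub_add_cancel] at this

/-- The filtration of `R[H]` is separated. -/
theorem eq_zero_of_forall_mem_filt [Fact p.Prime] (hπ : ∀ r, π * r = r * π)
    (hreg : ∀ r, π * r = 0 → r = 0) (hres : ∀ r : R, (∀ m : ℕ, π ^ m ∣ r) → r = 0)
    (hpπ : π ∣ (p : R)) (hw : IsWeight P.lv c f W) {x : MonoidAlgebra R H}
    (hx : ∀ j, x ∈ P.filt π c f W j) : x = 0 := by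
  have step : ∀ x : MonoidAlgebra R H, (∀ j, x ∈ P.filt π c f W j) →
      ∃ y, x = MonoidAlgebra.singleOneRingHom π * y ∧ ∀ j, y ∈ P.filt π c f W j := by
    intro x hx
    obtain ⟨y, rfl⟩ := P.exists_eq_pi_mul_of_forall_mem hπ hpπ hw fun j =>
      ⟨x, hx j, 0, by rw [mul_zero, add_zero]⟩
    refine ⟨y, rfl, fun j => ?_⟩
    induction j with
    | zero => exact P.mem_filt_zero hπ y
    | succ m ih => exact P.mem_filt_succ_of_pi_mul_mem hπ hreg hpπ hw ih (hx _)
  have hpow : ∀ n : ℕ, ∃ y, x = MonoidAlgebra.singleOneRingHom (π ^ n) * y ∧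
      ∀ j, y ∈ P.filt π c f W j := by
    intro n
    induction n with
    | zero => exact ⟨x, by rw [pow_zero, map_one, one_mul], hx⟩
    | succ n ih =>
      obtain ⟨y, hy, hyj⟩ := ih
      obtain ⟨y', hy', hyj'⟩ := step y hyj
      exact ⟨y', by rw [hy, hy', pow_succ, map_mul, mul_assoc], hyj'⟩
  ext h
  refine hres _ fun n => ?_
  obtain ⟨y, hy, -⟩ := hpow n
  rw [hy]
  simp

/-- The filtration of `R[H]`. -/
noncomputable def ringFiltration [Fact p.Prime] (hπ : ∀ r, π * r = r * π)
    (hreg : ∀ r, π * r = 0 → r = 0) (hres : ∀ r : R, (∀ m : ℕ, π ^ m ∣ r) → r = 0)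
    (hpπ : π ∣ (p : R)) (hw : IsWeight P.lv c f W) : RingFiltration (MonoidAlgebra R H) where
  F := P.filt π c f W
  anti := P.filt_antitone
  zero := eq_top_iff.2 fun x _ => P.mem_filt_zero hπ x
  mul := P.mul_mem_filt hπ
  sep _ hx := P.eq_zero_of_forall_mem_filt hπ hreg hres hpπ hw hx

/-- Words are independent modulo higher terms, with coefficients modulo the augmentation ideal. -/
theorem augHom_eq_zero_of_sum_mem [Fact p.Prime] (hπ : ∀ r, π * r = r * π)
    (hreg : ∀ r, π * r = 0 → r = 0) (hpπ : π ∣ (p : R)) (hw : IsWeight P.lv c f W)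
    {K : Type*} [Field K] {φ : R →+* K} (hker : ∀ r, φ r = 0 ↔ π ∣ r) {j : ℕ} {I : Type*}
    (A : Finset I) (w : I → Option σ →₀ ℕ) (hinj : Function.Injective w)
    (hA : ∀ i ∈ A, Finsupp.weight (fun o : Option σ => o.elim c f) (w i) = j)
    (a : I → MonoidAlgebra R H) {z y : MonoidAlgebra R H} (hz : z ∈ P.filt π c f W (j + 1))
    (hy : y = 0 ∨ ∀ i ∈ A, w i none = 0)
    (hsum : ∑ i ∈ A, a i * wordOf (letterPi π P.e) (w i) =
      z + MonoidAlgebra.singleOneRingHom π * y) (i : I) (hi : i ∈ A) :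
    augHom H φ (a i) = 0 := by
  choose r hr using fun i =>
    P.exists_sub_singleOneRingHom_mem_filt (c := c) (f := f) (W := W) hπ hw.W_pos (a i)
  have h1 : ∑ i ∈ A, (a i - MonoidAlgebra.singleOneRingHom (r i)) * wordOf (letterPi π P.e) (w i) ∈
      P.filt π c f W (j + 1) := by
    refine sum_mem fun i hi => ?_
    have h2 := P.prod_letterPi_mem_filt (π := π) (c := c) (f := f) (W := W) hπ (w i).toMultiset.toList
    rw [sum_map_toList_toMultiset, hA i hi] at h2
    rw [add_comm]
    exact P.mul_mem_filt hπ (hr i) h2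
  have h2 := P.dvd_of_sum_mem hπ hreg hpπ hw A w hinj hA r (sub_mem hz h1) hy (by
    simp only [sub_mul, Finset.sum_sub_distrib, hsum]; abel) i hi
  have h3 := (P.mem_filt_one_iff hπ hw hker _).1 (hr i)
  rwa [map_sub, augHom_singleOneRingHom, (hker _).2 h2, sub_zero] at h3

end CentralBasis

end Filtrations

section ImageFiltration

theorem exists_eq_pi_mul_of_mapRingHom_eq_zero {R K G : Type*} [Ring R] [Field K] [Group G] {π : R}
    {φ : R →+* K} (hker : ∀ r, φ r = 0 ↔ π ∣ r) {x : MonoidAlgebra R G}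
    (hx : MonoidAlgebra.mapRingHom G φ x = 0) : ∃ y, x = MonoidAlgebra.singleOneRingHom π * y := by
  refine exists_eq_pi_mul fun g => (hker _).1 ?_
  have h := congrArg (fun y : MonoidAlgebra K G => y.coeff g) hx
  simpa using h

theorem mapRingHom_surjective {R K G : Type*} [Ring R] [Field K] [Group G] {φ : R →+* K}
    (hφ : Function.Surjective φ) : Function.Surjective (MonoidAlgebra.mapRingHom G φ) := by
  intro y
  induction y using MonoidAlgebra.induction_linear with
  | zero => exact ⟨0, map_zero _⟩
  | add a b h1 h2 =>
    obtain ⟨x, rfl⟩ := h1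
    obtain ⟨x', rfl⟩ := h2
    exact ⟨x + x', map_add _ _ _⟩
  | single g r =>
    obtain ⟨r', rfl⟩ := hφ r
    exact ⟨MonoidAlgebra.single g r', by simp⟩

theorem augHom_mapRingHom {R K H : Type*} [Ring R] [Field K] [Group H] (φ : R →+* K)
    (x : MonoidAlgebra R H) :
    augHom H (RingHom.id K) (MonoidAlgebra.mapRingHom H φ x) = augHom H φ x := by
  induction x using MonoidAlgebra.induction_linear with
  | zero => simp
  | add a b h1 h2 => rw [map_add, map_add, h1, h2, map_add]
  | single g r => simp [augHom_single]

theorem augHom_surjective {R K H : Type*} [Ring R] [Field K] [Group H] {φ : R →+* K}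
    (hφ : Function.Surjective φ) : Function.Surjective (augHom H φ) := fun k => by
  obtain ⟨r, rfl⟩ := hφ k
  exact ⟨MonoidAlgebra.singleOneRingHom r, augHom_singleOneRingHom φ r⟩

namespace CentralBasis

variable {p : ℕ} {H σ : Type*} [Group H] [LinearOrder σ] (P : CentralBasis p H σ)
variable {R : Type*} [Ring R] {π : R} {c : ℕ} {f : σ → ℕ} {W : ℕ → ℕ}
variable {K : Type*} [Field K] {φ : R →+* K}

theorem mapRingHom_letterPi_none (hker : ∀ r, φ r = 0 ↔ π ∣ r) :
    MonoidAlgebra.mapRingHom H φ (letterPi π P.e none) = 0 := by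
  simp [letterPi, (hker π).2 dvd_rfl]

theorem mapRingHom_prod_letterPi_map_some (l : List σ) :
    MonoidAlgebra.mapRingHom H φ ((l.map some).map (letterPi π P.e)).prod =
      (l.map fun s => groupSubOne K (P.e s)).prod := by
  rw [map_list_prod, List.map_map, List.map_map]
  congr 1
  refine List.map_congr_left fun s _ => ?_
  exact mapRingHom_groupSubOne φ (P.e s)

variable [Fact p.Prime]

/-- The image in `K[H]` of the filtration of `R[H]`. -/
noncomputable def imageFiltration (hπ : ∀ r, π * r = r * π) (hpπ : π ∣ (p : R))
    (hw : IsWeight P.lv c f W) (hφ : Function.Surjective φ) (hker : ∀ r, φ r = 0 ↔ π ∣ r) :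
    RingFiltration (MonoidAlgebra K H) where
  F j := (P.filt π c f W j).map (MonoidAlgebra.mapRingHom H φ : MonoidAlgebra R H →+ _)
  anti i j h := AddSubgroup.map_mono (P.filt_antitone h)
  zero := by
    refine eq_top_iff.2 fun y _ => ?_
    obtain ⟨x, rfl⟩ := mapRingHom_surjective hφ y
    exact ⟨x, P.mem_filt_zero hπ x, rfl⟩
  mul := by
    rintro i j _ _ ⟨x, hx, rfl⟩ ⟨y, hy, rfl⟩
    exact ⟨x * y, P.mul_mem_filt hπ hx hy, map_mul (MonoidAlgebra.mapRingHom H φ) x y⟩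
  sep := by
    intro y hy
    obtain ⟨x, rfl⟩ := mapRingHom_surjective hφ y
    obtain ⟨w, rfl⟩ : ∃ w, x = MonoidAlgebra.singleOneRingHom π * w := by
      refine P.exists_eq_pi_mul_of_forall_mem hπ hpπ hw fun j => ?_
      obtain ⟨z, hz, hzx⟩ := hy j
      obtain ⟨w, hw⟩ := exists_eq_pi_mul_of_mapRingHom_eq_zero hker (x := x - z) (by
        rw [map_sub, sub_eq_zero]; exact hzx.symm)
      exact ⟨z, hz, w, by rw [← hw]; abel⟩
    rw [map_mul]
    have : MonoidAlgebra.mapRingHom H φ (MonoidAlgebra.singleOneRingHom π) = 0 := by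
      simp [(hker π).2 dvd_rfl]
    rw [this, zero_mul]

theorem mem_imageFiltration (hπ : ∀ r, π * r = r * π) (hpπ : π ∣ (p : R))
    (hw : IsWeight P.lv c f W) (hφ : Function.Surjective φ) (hker : ∀ r, φ r = 0 ↔ π ∣ r)
    (j : ℕ) (y : MonoidAlgebra K H) : y ∈ (P.imageFiltration hπ hpπ hw hφ hker).F j ↔
      ∃ x ∈ P.filt π c f W j, MonoidAlgebra.mapRingHom H φ x = y := Iff.rfl

/-- The graded ring of the image filtration is a polynomial ring. -/
theorem exists_isPolynomialGr_imageFiltration (hπ : ∀ r, π * r = r * π)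
    (hreg : ∀ r, π * r = 0 → r = 0) (hpπ : π ∣ (p : R))
    (hw : IsWeight P.lv c f W) (hφ : Function.Surjective φ) (hker : ∀ r, φ r = 0 ↔ π ∣ r) :
    (∀ s, (P.imageFiltration hπ hpπ hw hφ hker).val (groupSubOne K (P.e s)) =
      ((f s : ℤ) : WithTop ℤ)) ∧
    ∃ Ψ : MvPolynomial σ K ≃+* (P.imageFiltration hπ hpπ hw hφ hker).val.gr,
      (P.imageFiltration hπ hpπ hw hφ hker).val.IsPolynomialGr (augHom H (RingHom.id K))
        (fun s => groupSubOne K (P.e s)) Ψ := by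
  have hmap : ∀ s, MonoidAlgebra.mapRingHom H φ (letterPi π P.e (some s)) =
      groupSubOne K (P.e s) := fun s => mapRingHom_groupSubOne φ (P.e s)
  refine RingFiltration.exists_isPolynomialGr _ (augHom_surjective Function.surjective_id)
    (fun y => ?_) (fun s => ?_) (fun s r => ?_) (fun y s => ?_) (fun j => ?_)
    (fun j A hA a ha α hα => ?_)
  · constructor
    · rintro ⟨x, hx, rfl⟩
      exact (augHom_mapRingHom φ x).trans ((P.mem_filt_one_iff hπ hw hker x).1 hx)
    · intro h
      obtain ⟨x, rfl⟩ := mapRingHom_surjective hφ y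
      exact ⟨x, (P.mem_filt_one_iff hπ hw hker x).2 ((augHom_mapRingHom φ x).symm.trans h), rfl⟩
  · exact ⟨_, P.letterPi_mem_filt (some s), hmap s⟩
  · refine ⟨_, P.letterPi_commutator_mem_filt hπ hw (some s) (some r), ?_⟩
    rw [← hmap s, ← hmap r, ← map_mul, ← map_mul, ← map_sub]; rfl
  · obtain ⟨x, rfl⟩ := mapRingHom_surjective hφ y
    refine ⟨_, P.mul_letterPi_sub_mem_filt hπ hw x (some s), ?_⟩
    rw [← hmap s, ← map_mul, ← map_mul, ← map_sub]; rfl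
  · rintro _ ⟨x, hx, rfl⟩
    obtain ⟨x1, hx1, x2, hx2, rfl⟩ := AddSubgroup.mem_sup.1
      (P.filt_le_wordSpan Fact.out hπ hpπ hw j hx)
    rw [map_add]
    refine add_mem ?_ (AddSubgroup.mem_sup_right ⟨x2, hx2, rfl⟩)
    clear hx
    induction hx1 using AddSubgroup.closure_induction with
    | zero => rw [map_zero]; exact zero_mem _
    | add a b _ _ h1 h2 => rw [map_add]; exact add_mem h1 h2
    | neg a _ h1 => rw [map_neg]; exact neg_mem h1
    | mem x hx =>
      obtain ⟨a, l, hl, rfl⟩ := hx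
      change MonoidAlgebra.mapRingHom H φ (a * (l.map (letterPi π P.e)).prod) ∈ _
      rw [map_mul]
      by_cases h : none ∈ l
      · -- words containing `π` vanish in `K[H]`
        have : MonoidAlgebra.mapRingHom H φ (l.map (letterPi π P.e)).prod = 0 := by
          rw [map_list_prod]
          refine List.prod_eq_zero (List.mem_map.2 ⟨letterPi π P.e none,
            List.mem_map.2 ⟨none, h, rfl⟩, P.mapRingHom_letterPi_none hker⟩)
        rw [this, mul_zero]; exact zero_mem _
      · obtain ⟨l', rfl⟩ : ∃ l' : List σ, l'.map some = l := by
          have : l ∈ Set.range (List.map (some : σ → Option σ)) := by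
            rw [Set.range_list_map]
            intro o ho
            cases o with
            | none => exact absurd ho h
            | some s => exact ⟨s, rfl⟩
          exact this
        rw [P.mapRingHom_prod_letterPi_map_some]
        refine AddSubgroup.mem_sup_left (AddSubgroup.subset_closure ⟨_, l', ?_, rfl⟩)
        rw [← hl, List.map_map]; rfl
  · classical
    choose b hb using fun α => mapRingHom_surjective (G := H) hφ (a α)
    let w : (σ →₀ ℕ) → Option σ →₀ ℕ := Finsupp.mapDomain some
    have hwinj : Function.Injective w := Finsupp.mapDomain_injective (Option.some_injective σ)
    have hwms : ∀ α, ((α.toMultiset.toList.map some : List (Option σ)) : Multiset (Option σ)) =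
        (w α).toMultiset := fun α => by
      rw [← Multiset.map_coe, Multiset.coe_toList, Finsupp.toMultiset_map]
    have hwt : ∀ α, Finsupp.weight (fun o : Option σ => o.elim c f) (w α) = Finsupp.weight f α := by
      intro α
      rw [← sum_map_toList_toMultiset, ← sum_map_toList_toMultiset]
      have h1 := Multiset.coe_eq_coe.1 ((hwms α).trans (Multiset.coe_toList _).symm)
      rw [← (h1.map _).sum_eq, List.map_map]; rfl
    have hwnone : ∀ α, w α none = 0 := fun α =>
      Finsupp.mapDomain_of_notMem_range _ _ (by simp)
    -- the words in `K[H]` are the images of words not containing `π`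
    have hword : ∀ α ∈ A, ((α.toMultiset.toList.map some).map (letterPi π P.e)).prod -
        wordOf (letterPi π P.e) (w α) ∈ P.filt π c f W (j + 1) := fun α hα => by
      have := P.prod_letterPi_sub_wordOf_mem (c := c) (f := f) (W := W) hπ hw (hwms α)
      rw [List.map_map, show ((fun s : Option σ => s.elim c f) ∘ some) = f from rfl,
        sum_map_toList_toMultiset, hA α hα] at this
      exact this
    obtain ⟨z, hz, hza⟩ := ha
    have hza' : MonoidAlgebra.mapRingHom H φ z = ∑ α ∈ A, a α *
      wordOf (fun s => groupSubOne K (P.e s)) α := hza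
    obtain ⟨y, hy⟩ := exists_eq_pi_mul_of_mapRingHom_eq_zero hker
      (x := ∑ α ∈ A, b α * ((α.toMultiset.toList.map some).map (letterPi π P.e)).prod - z) (by
        rw [map_sub, sub_eq_zero, hza', map_sum]
        refine Finset.sum_congr rfl fun α _ => ?_
        rw [map_mul, hb, P.mapRingHom_prod_letterPi_map_some]; rfl)
    have h1 := P.augHom_eq_zero_of_sum_mem hπ hreg hpπ hw hker A w hwinj
      (fun α hα => (hwt α).trans (hA α hα)) b (y := y)
      (sub_mem hz (sum_mem fun α hα => P.mul_mem_filt_left hπ (b α) (hword α hα)))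
      (Or.inr fun α _ => hwnone α) (by
        rw [← hy]
        simp only [mul_sub, Finset.sum_sub_distrib]; abel) α hα
    rw [← hb, augHom_mapRingHom, h1]

/-- The graded ring of the filtration of `R[H]` is a polynomial ring. -/
theorem exists_isPolynomialGr_ringFiltration (hπ : ∀ r, π * r = r * π)
    (hreg : ∀ r, π * r = 0 → r = 0) (hres : ∀ r : R, (∀ m : ℕ, π ^ m ∣ r) → r = 0)
    (hpπ : π ∣ (p : R)) (hw : IsWeight P.lv c f W) (hφ : Function.Surjective φ)
    (hker : ∀ r, φ r = 0 ↔ π ∣ r) :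
    (∀ s : Option σ, (P.ringFiltration hπ hreg hres hpπ hw).val (letterPi π P.e s) =
      (((s.elim c f : ℕ) : ℤ) : WithTop ℤ)) ∧
    ∃ Φ : MvPolynomial (Option σ) K ≃+* (P.ringFiltration hπ hreg hres hpπ hw).val.gr,
      (P.ringFiltration hπ hreg hres hpπ hw).val.IsPolynomialGr (augHom H φ)
        (letterPi π P.e) Φ := by
  let D := P.ringFiltration hπ hreg hres hpπ hw
  have hspan : ∀ j, D.F j ≤ wordSpan D.F (letterPi π P.e) (fun s : Option σ => s.elim c f) j :=
    fun j => P.filt_le_wordSpan Fact.out hπ hpπ hw j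
  have hcomm : ∀ s t : Option σ, letterPi π P.e s * letterPi π P.e t -
      letterPi π P.e t * letterPi π P.e s ∈ D.F (s.elim c f + t.elim c f + 1) :=
    fun s t => P.letterPi_commutator_mem_filt hπ hw s t
  have hcomm' : ∀ (a : MonoidAlgebra R H) (s : Option σ), a * letterPi π P.e s -
      letterPi π P.e s * a ∈ D.F (s.elim c f + 1) :=
    fun a s => P.mul_letterPi_sub_mem_filt hπ hw a s
  refine RingFiltration.exists_isPolynomialGr D (f := fun s : Option σ => s.elim c f)
    (augHom_surjective hφ) (P.mem_filt_one_iff hπ hw hker) P.letterPi_mem_filt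
    hcomm hcomm' hspan (fun j A hA a ha => ?_)
  exact P.augHom_eq_zero_of_sum_mem hπ hreg hpπ hw hker A id Function.injective_id hA a ha
    (y := 0) (Or.inl rfl) (by simp)

end CentralBasis

end ImageFiltration

/-! ### Central series whose factors have given bases modulo `p` -/

section SeriesBasis

variable {p : ℕ} {H : Type*} [Group H] {n : ℕ} {U : Fin (n + 1) → Subgroup H}
variable {ι : Fin n → Type*} {e : ∀ i, ι i → H}

theorem IsGoodCentralSeries.normal_succ (hU : IsGoodCentralSeries p U) (i : Fin n) :
    (U i.succ).Normal :=
  Subgroup.normal_of_commutator_mem fun x hx g => hU.central i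
    (Subgroup.commutator_mem_commutator ((hU.lt i).le hx) (Subgroup.mem_top g))

variable [Fact p.Prime]

theorem IsGoodCentralSeries.exists_coordinates (hU : IsGoodCentralSeries p U)
    (he : ∀ i, IsBasisModPow p (U i.castSucc) (U i.succ) (e i)) (m : ℕ) (i : Fin n) :
    ∃ β : H → (ι i →₀ ZMod (p ^ m)),
      (∀ x ∈ U i.castSucc, ∀ y ∈ U i.castSucc, β (x * y) = β x + β y) ∧
      (∀ x ∈ U i.castSucc, β x = 0 ↔ ∃ w ∈ U i.castSucc, (w ^ p ^ m)⁻¹ * x ∈ U i.succ) ∧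
      ∀ a, β (e i a) = Finsupp.single a 1 := by
  have := hU.normal_succ i
  exact IsBasisModPow.exists_coordinates (hU.lt i).le
    ((Subgroup.commutator_mono le_rfl le_top).trans (hU.central i)) (hU.torsionFree i) (he i) m

/-- The bases of the factors of a good central series give coordinates on the group. The indices are
ordered by level, and arbitrarily within a level. -/
theorem IsGoodCentralSeries.exists_centralBasis (hU : IsGoodCentralSeries p U)
    (he : ∀ i, IsBasisModPow p (U i.castSucc) (U i.succ) (e i)) :
    ∃ (_ : LinearOrder (Σ i, ι i)) (P : CentralBasis p H (Σ i, ι i)),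
      (∀ s, P.e s = e s.1 s.2) ∧ ∀ s, P.lv s = s.1 := by
  classical
  let _ : ∀ i, LinearOrder (ι i) := fun i => IsWellOrder.linearOrder WellOrderingRel
  let ord : LinearOrder (Σ i, ι i) :=
    LinearOrder.lift' (fun s => (toLex s : Σₗ i, ι i)) fun _ _ h => h
  -- the order of `ord` is the lexicographic one, not the componentwise one of `Sigma`
  have hmono : ∀ s t : Σ i, ι i, ord.le s t → (s.1 : ℕ) ≤ t.1 := by
    intro s t h
    have h' : Sigma.Lex (· < ·) (fun _ => (· ≤ ·)) s t := h
    rcases Sigma.lex_iff.1 h' with h | ⟨h, -⟩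
    · exact le_of_lt h
    · rw [h]
  let V : ℕ → Subgroup H := fun k => if h : k < n + 1 then U ⟨k, h⟩ else ⊥
  have hV : ∀ i : Fin (n + 1), V i = U i := fun i => dif_pos i.2
  have hV0 : ∀ i : Fin n, V i = U i.castSucc := fun i => hV i.castSucc
  have hV1 : ∀ i : Fin n, V (i + 1) = U i.succ := fun i => hV i.succ
  have hbot : ∀ k, n ≤ k → V k = ⊥ := by
    intro k hk
    rcases hk.eq_or_lt with rfl | hk
    · exact (hV (Fin.last n)).trans hU.bot
    · exact dif_neg (by omega)
  -- statements about consecutive terms are those of the given series, or trivial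
  have hcases : ∀ k, (∃ i : Fin n, (i : ℕ) = k) ∨ n ≤ k := fun k => by
    rcases lt_or_ge k n with h | h
    · exact Or.inl ⟨⟨k, h⟩, rfl⟩
    · exact Or.inr h
  have hanti : ∀ k, V (k + 1) ≤ V k := by
    intro k
    rcases hcases k with ⟨i, rfl⟩ | h
    · rw [hV0, hV1]; exact (hU.lt i).le
    · rw [hbot (k + 1) (by omega)]; exact bot_le
  have hcen : ∀ k, ∀ x ∈ V k, ∀ g, ⁅x, g⁆ ∈ V (k + 1) := by
    intro k x hx g
    rcases hcases k with ⟨i, rfl⟩ | h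
    · rw [hV0] at hx
      rw [hV1]
      exact hU.central i (Subgroup.commutator_mem_commutator hx trivial)
    · rw [hbot k h, Subgroup.mem_bot] at hx
      rw [hx, commutatorElement_one_left]; exact one_mem _
  refine ⟨ord, {
    lv := fun s => s.1
    mono := fun s t h => hmono s t h
    U := V
    n := n
    anti := antitone_nat_of_succ_le hanti
    top := (hV 0).trans hU.top
    bot := hbot n le_rfl
    central := hcen
    torsionFree := ?_
    height := ?_
    e := fun s => e s.1 s.2
    e_mem := fun s => by rw [hV0]; exact (he s.1).choose s.2
    coords := ?_ }, fun _ => rfl, fun _ => rfl⟩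
  · intro k x hx m hm hxm
    rcases hcases k with ⟨i, rfl⟩ | h
    · rw [hV0] at hx
      rw [hV1] at hxm ⊢
      exact hU.torsionFree i x hx m hm hxm
    · rw [hbot k h, Subgroup.mem_bot] at hx
      rw [hx]; exact one_mem _
  · intro k x hx hxm
    rcases hcases k with ⟨i, rfl⟩ | h
    · rw [hV0] at hx
      rw [hV0, hV1] at hxm
      rw [hV1]
      exact hU.height i x hx hxm
    · rw [hbot k h, Subgroup.mem_bot] at hx
      rw [hx]; exact one_mem _
  · intro m
    choose β hadd hzero hsingle using hU.exists_coordinates he m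
    refine ⟨fun s x => β s.1 x s.2, fun s x hx y hy => ?_, fun s => ?_, fun s t hst hne => ?_,
      fun k x hx => ?_, fun k x hx => ?_⟩
    · rw [hV0] at hx hy
      show β s.1 (x * y) s.2 = β s.1 x s.2 + β s.1 y s.2
      rw [hadd s.1 x hx y hy, Finsupp.add_apply]
    · show β s.1 (e s.1 s.2) s.2 = 1
      rw [hsingle, Finsupp.single_eq_same]
    · obtain ⟨i, a⟩ := s
      obtain ⟨j, b⟩ := t
      obtain rfl : i = j := Fin.ext hst
      show β i (e i b) a = 0
      rw [hsingle, Finsupp.single_apply, if_neg]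
      rintro rfl
      exact hne rfl
    · rcases hcases k with ⟨i, rfl⟩ | h
      · refine ((β i x).support.finite_toSet.image (fun a => (⟨i, a⟩ : Σ i, ι i))).subset ?_
        rintro ⟨j, a⟩ ⟨hj, ha⟩
        obtain rfl : j = i := Fin.ext hj
        exact ⟨a, Finsupp.mem_support_iff.2 ha, rfl⟩
      · refine Set.finite_empty.subset ?_
        rintro s ⟨hs, -⟩
        have := s.1.2
        have hs' : (s.1 : ℕ) = k := hs
        omega
    · rcases hcases k with ⟨i, rfl⟩ | h
      · rw [hV0] at hx
        rw [hV0, hV1, ← hzero i x hx]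
        constructor
        · intro h
          ext a
          exact h ⟨i, a⟩ rfl
        · rintro h ⟨j, a⟩ hj
          obtain rfl : j = i := Fin.ext hj
          show β j x a = 0
          rw [h, Finsupp.zero_apply]
      · rw [hbot k h, Subgroup.mem_bot] at hx
        refine ⟨fun _ => ⟨1, one_mem _, by rw [hx]; simp⟩, fun _ s hs => ?_⟩
        have := s.1.2
        have hs' : (s.1 : ℕ) = k := hs
        omega

/-- Since the factors are nontrivial without elements of infinite height, no basis is empty. -/
theorem IsGoodCentralSeries.nonempty_index (hU : IsGoodCentralSeries p U)
    (he : ∀ i, IsBasisModPow p (U i.castSucc) (U i.succ) (e i)) (i : Fin n) : Nonempty (ι i) := by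
  by_contra hemp
  rw [not_nonempty_iff] at hemp
  refine (hU.lt i).not_ge fun x hx => hU.height i x hx fun m => ?_
  obtain ⟨β, -, hzero, -⟩ := hU.exists_coordinates he m i
  exact (hzero x hx).1 (Subsingleton.elim _ _)

variable {f : Option (Σ i, ι i) → ℕ}

open Classical in
/-- The least weight of the basis elements of level `k`; from level `n` on, the weight of `π`. -/
noncomputable def levelWeight (f : Option (Σ i, ι i) → ℕ) (k : ℕ) : ℕ :=
  if h : k < n then sInf (Set.range fun a : ι ⟨k, h⟩ => f (some ⟨⟨k, h⟩, a⟩)) else f none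

theorem levelWeight_le (i : Fin n) (a : ι i) : levelWeight f i ≤ f (some ⟨i, a⟩) := by
  rw [levelWeight, dif_pos i.2]
  exact Nat.sInf_le ⟨a, rfl⟩

theorem levelWeight_of_le {k : ℕ} (h : n ≤ k) : levelWeight f k = f none :=
  dif_neg (by omega)

theorem exists_levelWeight_eq (hι : ∀ i, Nonempty (ι i)) (i : Fin n) :
    ∃ a : ι i, levelWeight f i = f (some ⟨i, a⟩) := by
  have := hι i
  obtain ⟨a, ha⟩ := Nat.sInf_mem (Set.range_nonempty fun a : ι i => f (some ⟨i, a⟩))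
  refine ⟨a, ?_⟩
  rw [levelWeight, dif_pos i.2]
  exact ha.symm

/-- The growth condition for consecutive levels gives the one for the least weights of the levels. -/
theorem isWeight_levelWeight (hι : ∀ i, Nonempty (ι i)) (hfpos : ∀ s, 0 < f s)
    (hfπ : ∀ (i : Fin n) (a : ι i), (i : ℕ) + 1 = n → 2 * f (some ⟨i, a⟩) < f none)
    (hfE : ∀ (i j : Fin n) (a : ι i) (b : ι j), (i : ℕ) + 1 = j →
      2 * f (some ⟨i, a⟩) < f (some ⟨j, b⟩)) :
    IsWeight (fun s : Σ i, ι i => (s.1 : ℕ)) (f none) (fun s => f (some s)) (levelWeight f) := by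
  have hlt : ∀ s : Σ i, ι i, 2 * f (some s) < levelWeight f (s.1 + 1) := by
    rintro ⟨i, a⟩
    rcases lt_or_ge ((i : ℕ) + 1) n with h | h
    · obtain ⟨b, hb⟩ := exists_levelWeight_eq (f := f) hι ⟨i + 1, h⟩
      exact (hfE i ⟨i + 1, h⟩ a b rfl).trans_eq hb.symm
    · rw [levelWeight_of_le h]
      exact hfπ i a (by have := i.2; omega)
  have hmono : Monotone (levelWeight f) := monotone_nat_of_le_succ fun k => by
    rcases lt_or_ge k n with h | h
    · obtain ⟨a⟩ := hι ⟨k, h⟩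
      have h1 : levelWeight f k ≤ f (some ⟨⟨k, h⟩, a⟩) := levelWeight_le ⟨k, h⟩ a
      have h2 : 2 * f (some ⟨⟨k, h⟩, a⟩) < levelWeight f (k + 1) := hlt ⟨⟨k, h⟩, a⟩
      omega
    · rw [levelWeight_of_le h, levelWeight_of_le (by omega)]
  refine ⟨fun k => ?_, hmono, fun s => levelWeight_le s.1 s.2, hlt, fun k => ?_⟩
  · rcases lt_or_ge k n with h | h
    · obtain ⟨a, ha⟩ := exists_levelWeight_eq (f := f) hι ⟨k, h⟩
      exact (hfpos _).trans_eq ha.symm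
    · rw [levelWeight_of_le h]; exact hfpos _
  · exact (hmono (Nat.le_add_right k n)).trans_eq (levelWeight_of_le (by omega))

end SeriesBasis

/-! ### The epimorphism of graded rings, and the topology -/

namespace CentralBasis

variable {p : ℕ} {H σ : Type*} [Group H] [LinearOrder σ] (P : CentralBasis p H σ)
variable {R : Type*} [Ring R] {π : R} {c : ℕ} {f : σ → ℕ} {W : ℕ → ℕ}
variable {K : Type*} [Field K] {φ : R →+* K} [Fact p.Prime]

/-- The terms of the filtration of `K[H]` are the images of those of `R[H]`. -/
theorem le_val_imageFiltration_iff (hπ : ∀ r, π * r = r * π)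
    (hreg : ∀ r, π * r = 0 → r = 0) (hres : ∀ r : R, (∀ m : ℕ, π ^ m ∣ r) → r = 0)
    (hpπ : π ∣ (p : R)) (hw : IsWeight P.lv c f W) (hφ : Function.Surjective φ)
    (hker : ∀ r, φ r = 0 ↔ π ∣ r) (j : ℤ) (y : MonoidAlgebra K H) :
    (j : WithTop ℤ) ≤ (P.imageFiltration hπ hpπ hw hφ hker).val y ↔
      ∃ x, (j : WithTop ℤ) ≤ (P.ringFiltration hπ hreg hres hpπ hw).val x ∧
        MonoidAlgebra.mapRingHom H φ x = y := by
  simp only [RingFiltration.le_val_iff, P.mem_imageFiltration hπ hpπ hw hφ hker]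
  rfl

/-- The topology is the adic one, since the weights of letters are positive and at most `c`. -/
theorem isAdicFor_ringFiltration (hπ : ∀ r, π * r = r * π)
    (hreg : ∀ r, π * r = 0 → r = 0) (hres : ∀ r : R, (∀ m : ℕ, π ^ m ∣ r) → r = 0)
    (hpπ : π ∣ (p : R)) (hw : IsWeight P.lv c f W) (hker : ∀ r, φ r = 0 ↔ π ∣ r) :
    (P.ringFiltration hπ hreg hres hpπ hw).val.IsAdicFor (RingHom.ker (augHom H φ)) := by
  constructor
  · refine fun n => ⟨((n * c : ℕ) : ℤ), fun x hx => ?_⟩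
    rw [RingFiltration.le_val_iff, Int.toNat_natCast] at hx
    exact P.mem_ker_pow_of_mem_filt hw hker n hx
  · refine fun j => ⟨j.toNat, fun x hx => ?_⟩
    rw [RingFiltration.le_val_iff]
    exact P.mem_filt_of_mem_ker_pow hπ hw hker _ hx

/-- The reduction `R[H] → K[H]` induces the homomorphism of polynomial rings which maps the variable
of `π` to zero and fixes the other variables. -/
theorem exists_grMap_imageFiltration (hπ : ∀ r, π * r = r * π)
    (hreg : ∀ r, π * r = 0 → r = 0) (hres : ∀ r : R, (∀ m : ℕ, π ^ m ∣ r) → r = 0)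
    (hpπ : π ∣ (p : R)) (hw : IsWeight P.lv c f W) (hφ : Function.Surjective φ)
    (hker : ∀ r, φ r = 0 ↔ π ∣ r)
    {Φ : MvPolynomial (Option σ) K ≃+* (P.ringFiltration hπ hreg hres hpπ hw).val.gr}
    (hval : ∀ s : Option σ, (P.ringFiltration hπ hreg hres hpπ hw).val (letterPi π P.e s) =
      (((s.elim c f : ℕ) : ℤ) : WithTop ℤ))
    (hΦ : (P.ringFiltration hπ hreg hres hpπ hw).val.IsPolynomialGr (augHom H φ)
      (letterPi π P.e) Φ)
    {Ψ : MvPolynomial σ K ≃+* (P.imageFiltration hπ hpπ hw hφ hker).val.gr}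
    (hval' : ∀ s, (P.imageFiltration hπ hpπ hw hφ hker).val (groupSubOne K (P.e s)) =
      ((f s : ℤ) : WithTop ℤ))
    (hΨ : (P.imageFiltration hπ hpπ hw hφ hker).val.IsPolynomialGr (augHom H (RingHom.id K))
      (fun s => groupSubOne K (P.e s)) Ψ) :
    ∃ θ : (P.ringFiltration hπ hreg hres hpπ hw).val.gr →+*
        (P.imageFiltration hπ hpπ hw hφ hker).val.gr,
      (∀ (j : ℤ) (x : MonoidAlgebra R H)
        (hx : (j : WithTop ℤ) ≤ (P.ringFiltration hπ hreg hres hpπ hw).val x),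
        ∃ hx' : (j : WithTop ℤ) ≤ (P.imageFiltration hπ hpπ hw hφ hker).val
            (MonoidAlgebra.mapRingHom H φ x),
          θ ((P.ringFiltration hπ hreg hres hpπ hw).val.cls j x hx) =
            (P.imageFiltration hπ hpπ hw hφ hker).val.cls j (MonoidAlgebra.mapRingHom H φ x) hx') ∧
      Function.Surjective θ ∧
      ∀ q, θ (Φ q) = Ψ (MvPolynomial.aeval
        (fun s : Option σ => s.elim (0 : MvPolynomial σ K) MvPolynomial.X) q) := by
  let D := P.ringFiltration hπ hreg hres hpπ hw
  let E := P.imageFiltration hπ hpπ hw hφ hker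
  let α : MvPolynomial (Option σ) K →ₐ[K] MvPolynomial σ K :=
    MvPolynomial.aeval fun s => s.elim 0 MvPolynomial.X
  have hψ : RingFiltration.IsClassMap D E.val (MonoidAlgebra.mapRingHom H φ) (augHom H φ)
      (letterPi π P.e) (fun s => s.elim c f)
      ((Ψ : MvPolynomial σ K →+* E.val.gr).comp (α : MvPolynomial (Option σ) K →+* _)) :=
    { le := fun j x hx =>
        (P.le_val_imageFiltration_iff hπ hreg hres hpπ hw hφ hker j _).2 ⟨x, hx, rfl⟩
      const := fun x => by
        obtain ⟨hx, h⟩ := hΨ.const (MonoidAlgebra.mapRingHom H φ x)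
        refine ⟨hx, ?_⟩
        rw [augHom_mapRingHom] at h
        rw [← h]
        simp [α]
      var := fun s => by
        cases s with
        | none =>
          have h0 := P.mapRingHom_letterPi_none (H := H) hker
          refine ⟨by rw [h0]; exact E.val.le_zero _, ?_⟩
          rw [E.val.cls_congr rfl h0 _ (E.val.le_zero _), E.val.cls_zero]
          simp [α]
        | some s =>
          have h0 : MonoidAlgebra.mapRingHom H φ (letterPi π P.e (some s)) =
            groupSubOne K (P.e s) := mapRingHom_groupSubOne φ (P.e s)
          have h1 : ((f s : ℤ) : WithTop ℤ) ≤
              E.val (MonoidAlgebra.mapRingHom H φ (letterPi π P.e (some s))) := by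
            rw [h0]; exact (hval' s).ge
          refine ⟨h1, ?_⟩
          have h2 := (hΨ.var s).trans ((E.val.homComp_eq_cls (hval' s)).trans
            (E.val.cls_congr rfl h0.symm _ h1))
          refine Eq.trans ?_ h2
          simp [α] }
  obtain ⟨θ, hcls, hθ⟩ := D.exists_grMap hval hΦ
    (P.filt_le_wordSpan Fact.out hπ hpπ hw) hψ
  refine ⟨θ, fun j x hx => ⟨_, hcls j x hx⟩, fun y => ?_, hθ⟩
  refine ⟨Φ (MvPolynomial.rename some (Ψ.symm y)), ?_⟩
  rw [hθ]
  have : α (MvPolynomial.rename some (Ψ.symm y)) = Ψ.symm y := by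
    simp only [α, MvPolynomial.aeval_rename]
    exact MvPolynomial.aeval_X_left_apply _
  show Ψ (α _) = y
  rw [this, RingEquiv.apply_symm_apply]

end CentralBasis

theorem mainTheorem11
    {H : Type*} [Group H] [Group.IsNilpotent H] (p : ℕ) [Fact p.Prime]
    -- `H` is torsion free, without nontrivial elements of infinite `p`-height
    (hH : ∀ (h : H) (m : ℕ), 0 < m → h ^ m = 1 → h = 1)
    (hHp : ∀ h : H, (∀ m : ℕ, ∃ u : H, u ^ p ^ m = h) → h = 1)
    -- the central series and the bases of its factors modulo `p`
    {n : ℕ} (U : Fin (n + 1) → Subgroup H) (hU : IsGoodCentralSeries p U)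
    {ι : Fin n → Type*} (e : ∀ i, ι i → H)
    (he : ∀ i, IsBasisModPow p (U i.castSucc) (U i.succ) (e i))
    -- `π` is central and regular with `⋂ (π) ^ m = 0`, and `R / (π)` is the field `K`
    {R : Type*} [Ring R] (π : R) (hcentral : ∀ r, π * r = r * π) (hreg : IsRegular π)
    (hres : ∀ r : R, (∀ m : ℕ, π ^ m ∣ r) → r = 0)
    {K : Type*} [Field K] [CharP K p] (φ : R →+* K) (hφ : Function.Surjective φ)
    (hker : ∀ r, φ r = 0 ↔ π ∣ r)
    -- the weight function
    (f : Option (Σ i, ι i) → ℕ) (hfpos : ∀ s, 0 < f s)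
    (hfπ : ∀ (i : Fin n) (a : ι i), (i : ℕ) + 1 = n → 2 * f (some ⟨i, a⟩) < f none)
    (hfE : ∀ (i j : Fin n) (a : ι i) (b : ι j), (i : ℕ) + 1 = j →
      2 * f (some ⟨i, a⟩) < f (some ⟨j, b⟩)) :
    ∃ (v : PseudoValuation (MonoidAlgebra R H))
      (Φ : MvPolynomial (Option (Σ i, ι i)) K ≃+* v.gr),
      -- `v` extends the weight function, and its graded ring is the polynomial ring
      (∀ s, v (systemPi π e s) = ((f s : ℤ) : WithTop ℤ)) ∧
      v.IsPolynomialGr (augHom H φ) (systemPi π e) Φ ∧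
      -- the topology of `v` is the adic one
      v.IsAdicFor (RingHom.ker (augHom H φ)) ∧
      -- uniqueness
      (∀ (w : PseudoValuation (MonoidAlgebra R H))
        (Φ' : MvPolynomial (Option (Σ i, ι i)) K ≃+* w.gr),
        (∀ s, w (systemPi π e s) = ((f s : ℤ) : WithTop ℤ)) →
        w.IsPolynomialGr (augHom H φ) (systemPi π e) Φ' → w = v) ∧
      -- the image of `v` in `K[H]`, and the epimorphism of graded rings defined by `R → K`
      (∃ (vbar : PseudoValuation (MonoidAlgebra K H))
        (Ψ : MvPolynomial (Σ i, ι i) K ≃+* vbar.gr) (θ : v.gr →+* vbar.gr),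
        (∀ (j : ℤ) (y : MonoidAlgebra K H), (j : WithTop ℤ) ≤ vbar y ↔
          ∃ x, (j : WithTop ℤ) ≤ v x ∧ MonoidAlgebra.mapRingHom H φ x = y) ∧
        (∀ s, vbar (systemE K e s) = ((f (some s) : ℤ) : WithTop ℤ)) ∧
        vbar.IsPolynomialGr (augHom H (RingHom.id K)) (systemE K e) Ψ ∧
        (∀ (j : ℤ) (x : MonoidAlgebra R H) (hx : (j : WithTop ℤ) ≤ v x),
          ∃ hx' : (j : WithTop ℤ) ≤ vbar (MonoidAlgebra.mapRingHom H φ x),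
            θ (v.cls j x hx) = vbar.cls j (MonoidAlgebra.mapRingHom H φ x) hx') ∧
        Function.Surjective θ ∧
        (∀ q, θ (Φ q) = Ψ (MvPolynomial.aeval
          (fun s => s.elim (0 : MvPolynomial (Σ i, ι i) K) MvPolynomial.X) q))) := by
  obtain ⟨_, P, hPe, hPlv⟩ := hU.exists_centralBasis he
  have hreg' : ∀ r, π * r = 0 → r = 0 := fun r h => hreg.left (h.trans (mul_zero π).symm)
  have hpπ : π ∣ (p : R) := (hker p).1 (by rw [map_natCast, CharP.cast_eq_zero])
  have hw : IsWeight P.lv (f none) (fun s => f (some s)) (levelWeight f) := by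
    rw [funext hPlv]
    exact isWeight_levelWeight (hU.nonempty_index he) hfpos hfπ hfE
  have hf : ∀ s : Option (Σ i, ι i), s.elim (f none) (fun s => f (some s)) = f s := by
    rintro (_ | s) <;> rfl
  have hsysPi : letterPi π P.e = systemPi π e := by
    funext s
    rcases s with _ | s
    · rfl
    · exact congrArg (groupSubOne R) (hPe s)
  have hsysE : (fun s => groupSubOne K (P.e s)) = systemE K e :=
    funext fun s => congrArg (groupSubOne K) (hPe s)
  obtain ⟨hval, Φ, hΦ⟩ :=
    P.exists_isPolynomialGr_ringFiltration hcentral hreg' hres hpπ hw hφ hker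
  obtain ⟨hval', Ψ, hΨ⟩ :=
    P.exists_isPolynomialGr_imageFiltration hcentral hreg' hpπ hw hφ hker
  obtain ⟨θ, hcls, hθ, hθΦ⟩ :=
    P.exists_grMap_imageFiltration hcentral hreg' hres hpπ hw hφ hker hval hΦ hval' hΨ
  refine ⟨_, Φ, fun s => ?_, hsysPi ▸ hΦ,
    P.isAdicFor_ringFiltration hcentral hreg' hres hpπ hw hker, fun w Φ' hwf hw' => ?_,
    _, Ψ, θ, P.le_val_imageFiltration_iff hcentral hreg' hres hpπ hw hφ hker, fun s => ?_,
    hsysE ▸ hΨ, hcls, hθ, hθΦ⟩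
  · rw [← hsysPi, hval, hf]
  · rw [← hsysPi] at hwf hw'
    refine RingFiltration.eq_val_of_isPolynomialGr _ hval hΦ
      (P.filt_le_wordSpan Fact.out hcentral hpπ hw)
      (fun n => ⟨n * f none, fun x hx => P.mem_ker_pow_of_mem_filt hw hker n hx⟩) w Φ'
      (fun s => by rw [hwf, hf]) hw'
  · rw [← hsysE]; exact hval' s
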